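/- Let $W=\bigoplus_{k=0}^{\ell}W^{-k}$ be a finite-dimensional non-positively graded real vector space, $U\subset W^0$ an open subset, and $Q$ a differential (a derivation of degree $1$ with $Q^2=0$) on the graded commutative algebra $\mathcal A_{W|_U}=C^\infty(U)\otimes S\bigl((W^{<0})^*\bigr)$, in which $(W^{-k})^*$ has degree $k$. Let $F_Q\in\mathcal A_{W|_U}\otimes W$ be defined by $\langle F_Q,\xi\rangle=Q\xi$ for $\xi\in W^*$. Let $N\subset\mathbb R^n$ be an $n$-dimensional submanifold with corners which contains $0$ and is star-shaped with respect to $0$. Put $$\Omega(N,W)^m=\bigoplus_{k\ge 0}\Omega^{m+k}(N)\otimes W^{-k},$$ and let $\Omega(N,W|_U)^0\subset\Omega(N,W)^0$ be the set of those $A$ whose $0$-form part takes values in $U$; for such $A$ let $F_Q(A)\in\Omega(N,W)^1$ be obtained by substituting $\langle A,\xi\rangle$ for every $\xi\in W^*$ in $F_Q$. Let $E=\sum_i x^i\partial_{x^i}$ be the Euler vector field, let $h$ be the de Rham homotopy operator of the retraction $R(x,t)=tx$, that is $h\beta=\int_0^1 i_{\partial_t}R^*\beta\,dt$, and put $$\kappa(A)=A-h(F_Q(A)).$$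 For $B\in\Omega(N,W)^0$ consider the vector field $$\hat E_B=E_{\mathrm{lift}}+F_Q(B+i_E\,\cdot\,)$$ on the part of the total space of $(\bigwedge T^*N\otimes W)^1\to N$ where the $0$-form part of $B+i_E\,\cdot\,$ lies in $U$. Here $E_{\mathrm{lift}}$ is the natural lift of $E$: in linear coordinates it is $E$ plus the vertical linear field which multiplies the fibre coordinates of form degree $j$ by $-j$. The second term is a vertical vector field. (1) Let $1\le\rho\le\infty$ and let $B\in\Omega(N,W)^0$ be of class $C^\rho$, with $0$-form part sending $0\in N$ into $U$. Among the pairs $(N',a)$, where $N'\subset N$ is a star-shaped open neighbourhood of $0$ in $N$ and $a\in\Omega(N',W)^1$ is a $C^\rho$ solution of $$\mathcal L_E a=F_Q(B+i_Ea)$$ (the $0$-form part of $B+i_Ea$ taking values in $U$), there is a greatest one: its domain $N'$ contains the domain of every other solution, and every other solution is the restriction of $a$. A $C^\rho$ form $A\in\Omega(N,W|_U)^0$ with $\kappa(A)=B$ exists if and only if $N'=N$, and in that case $A$ is unique and $A=B+i_Ea$. The vector field $\hat E_B$ has exactly one fixed point $P$; it lies over $0$ and is hyperbolic. The stable subspace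 of the linearization at $P$ is the vertical subspace, on which the linearization acts by $-j$ on forms of degree $j$; the unstable subspace, on which the linearization is the identity, projects bijectively onto $T_0\mathbb R^n=\mathbb R^n$. The image of the greatest solution $a:N'\to(\bigwedge T^*N\otimes W)^1$ is the unstable manifold of $\hat E_B$ at $P$. (2) Suppose in addition that $N$ is compact and let $r\ge1$ be an integer. Then the space $\Omega_r(N,W)^0$ of $C^r$ forms, with the $C^r$ norm, is a Banach space, the subset $\Omega_r(N,W|_U)^0$ is open in it, and $$\kappa:\Omega_r(N,W|_U)^0\to\Omega_r(N,W)^0$$ is a smooth open embedding of Banach manifolds: it is injective and smooth ($C^\infty$), its image is open, and the inverse map, defined on the image, is smooth. For every $B$ in the image, $\kappa^{-1}(B)=B+i_Ea$, where $a$ is a $C^r$ solution of $\mathcal L_Ea=F_Q(B+i_Ea)$ on the whole of $N$ whose image is the unstable manifold of $\hat E_B$ at its hyperbolic fixed point. -/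

import Mathlib

open scoped ContDiff Manifold

noncomputable section

namespace Kuranishi

/-- The Euclidean space `ℝⁿ`. -/
abbrev Euc (n : ℕ) : Type := EuclideanSpace ℝ (Fin n)

/-! ### Codimension zero submanifolds with corners -/

/-- `N ⊆ ℝⁿ` is an `n`-dimensional submanifold with corners: near each of its points there is a
smooth chart of `ℝⁿ` which turns `N` into a coordinate sector `{y | ∀ i ∈ s, 0 ≤ y i}`. -/
def IsSubmanifoldWithCorners {n : ℕ} (N : Set (Euc n)) : Prop :=
  ∀ x ∈ N, ∃ φ : OpenPartialHomeomorph (Euc n) (Euc n), x ∈ φ.source ∧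
    ContDiffOn ℝ ∞ φ φ.source ∧ ContDiffOn ℝ ∞ φ.symm φ.target ∧
    ∃ s : Finset (Fin n), ∀ y ∈ φ.source, y ∈ N ↔ ∀ i ∈ s, 0 ≤ φ y i

/-! ### Exterior forms on `ℝⁿ` and the exterior algebra of its dual -/

/-- The algebra `⋀ (ℝⁿ)^*`. -/
abbrev Ext (n : ℕ) : Type := ExteriorAlgebra ℝ (Module.Dual ℝ (Euc n))

/-- The coordinate covector `dxⁱ`. -/
def dx {n : ℕ} (i : Fin n) : Module.Dual ℝ (Euc n) :=
  (EuclideanSpace.basisFun (Fin n) ℝ).toBasis.coord i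

/-- The alternating form `w`, seen as the element
`(1/k!) ∑ w(e_{i₁}, …, e_{i_k}) dx^{i₁} ⋯ dx^{i_k}` of the exterior algebra. -/
def toExt {n k : ℕ} : (Euc n [⋀^Fin k]→L[ℝ] ℝ) →ₗ[ℝ] Ext n :=
  (k.factorial : ℝ)⁻¹ • ∑ i : Fin k → Fin n,
    { toFun := fun w => w (fun j => EuclideanSpace.basisFun (Fin n) ℝ (i j)) •
        ExteriorAlgebra.ιMulti ℝ k (fun j => dx (i j))
      map_add' := fun w v => by simp [add_smul]
      map_smul' := fun c w => by simp [mul_smul] }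

theorem continuous_of_multilinear {n k : ℕ} (f : MultilinearMap ℝ (fun _ : Fin k => Euc n) ℝ) :
    Continuous f := by
  have h : (f : (Fin k → Euc n) → ℝ) = fun v => ∑ r : Fin k → Fin n,
      (∏ j, v j (r j)) * f (fun j => EuclideanSpace.basisFun (Fin n) ℝ (r j)) := by
    funext v
    have hv : v = fun j => ∑ i : Fin n, v j i • EuclideanSpace.basisFun (Fin n) ℝ i := by
      funext j
      conv_lhs => rw [← (EuclideanSpace.basisFun (Fin n) ℝ).sum_repr (v j)]
      simp
    conv_lhs => rw [hv, f.map_sum]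
    refine Finset.sum_congr rfl fun r _ => ?_
    rw [f.map_smul_univ, smul_eq_mul]
  rw [h]
  fun_prop

/-- The degree `k` part of an element of the exterior algebra as an alternating form, with
`(θ₁ ⋯ θ_k)(v₁, …, v_k) = det (θ_j(v_i))`. -/
def ofExt {n : ℕ} (k : ℕ) (w : Ext n) : Euc n [⋀^Fin k]→L[ℝ] ℝ :=
  let f : Euc n [⋀^Fin k]→ₗ[ℝ] ℝ :=
    (ExteriorAlgebra.liftAlternating
      (Function.update 0 k (exteriorPower.alternatingMapToDual ℝ (Euc n) k)) w).compAlternatingMap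
      (exteriorPower.ιMulti ℝ k)
  { f with cont := continuous_of_multilinear f.toMultilinearMap }

theorem ι_mul_list_prod {n : ℕ} (m : Module.Dual ℝ (Euc n)) (l : List (Module.Dual ℝ (Euc n))) :
    ExteriorAlgebra.ι ℝ m * (l.map (ExteriorAlgebra.ι ℝ)).prod =
      (-1 : Ext n) ^ l.length * ((l.map (ExteriorAlgebra.ι ℝ)).prod * ExteriorAlgebra.ι ℝ m) := by
  induction l with
  | nil => simp
  | cons a l ih =>
    have h : ExteriorAlgebra.ι ℝ m * ExteriorAlgebra.ι ℝ a =
        -(ExteriorAlgebra.ι ℝ a * ExteriorAlgebra.ι ℝ m) :=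
      eq_neg_of_add_eq_zero_left (ExteriorAlgebra.ι_add_mul_swap m a)
    have hc : Commute (ExteriorAlgebra.ι ℝ a) ((-1 : Ext n) ^ l.length) :=
      (Commute.neg_one_right _).pow_right _
    simp only [List.map_cons, List.prod_cons, List.length_cons]
    rw [← mul_assoc, h, neg_mul, mul_assoc, ih, ← mul_assoc (ExteriorAlgebra.ι ℝ a), hc.eq,
      pow_succ]
    simp only [mul_assoc, neg_mul, mul_neg, one_mul]

theorem list_prod_comm {n : ℕ} (l l' : List (Module.Dual ℝ (Euc n))) :
    (l.map (ExteriorAlgebra.ι ℝ)).prod * (l'.map (ExteriorAlgebra.ι ℝ)).prod =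
      (-1 : Ext n) ^ (l.length * l'.length) *
        ((l'.map (ExteriorAlgebra.ι ℝ)).prod * (l.map (ExteriorAlgebra.ι ℝ)).prod) := by
  induction l with
  | nil => simp
  | cons a l ih =>
    have hc : Commute (ExteriorAlgebra.ι ℝ a) ((-1 : Ext n) ^ (l.length * l'.length)) :=
      (Commute.neg_one_right _).pow_right _
    simp only [List.map_cons, List.prod_cons, List.length_cons]
    rw [mul_assoc, ih, ← mul_assoc, hc.eq, mul_assoc, ← mul_assoc (ExteriorAlgebra.ι ℝ a),
      ι_mul_list_prod, add_mul, one_mul, pow_add]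
    simp only [mul_assoc]

theorem toExt_graded_comm {n k l : ℕ} (w : Euc n [⋀^Fin k]→L[ℝ] ℝ) (η : Euc n [⋀^Fin l]→L[ℝ] ℝ) :
    toExt w * toExt η = (-1 : Ext n) ^ (k * l) * (toExt η * toExt w) := by
  have key : ∀ (a : Fin k → Module.Dual ℝ (Euc n)) (b : Fin l → Module.Dual ℝ (Euc n)),
      ExteriorAlgebra.ιMulti ℝ k a * ExteriorAlgebra.ιMulti ℝ l b =
        (-1 : Ext n) ^ (k * l) *
          (ExteriorAlgebra.ιMulti ℝ l b * ExteriorAlgebra.ιMulti ℝ k a) := by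
    intro a b
    have := list_prod_comm (List.ofFn a) (List.ofFn b)
    simpa [ExteriorAlgebra.ιMulti_apply, List.map_ofFn, Function.comp_def] using this
  simp only [toExt, LinearMap.smul_apply, LinearMap.sum_apply, LinearMap.coe_mk, AddHom.coe_mk,
    smul_mul_assoc, mul_smul_comm, Finset.sum_mul, Finset.mul_sum, Finset.smul_sum, key]
  rw [Finset.sum_comm]
  refine Finset.sum_congr rfl fun i _ => Finset.sum_congr rfl fun j _ => ?_
  simp only [smul_smul]
  congr 1
  ring

theorem toExt_zero_degree {n : ℕ} (w : Euc n [⋀^Fin 0]→L[ℝ] ℝ) :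
    toExt w = algebraMap ℝ (Ext n) (w 0) := by
  simp only [toExt, Nat.factorial_zero, Nat.cast_one, inv_one, one_smul, LinearMap.sum_apply,
    LinearMap.coe_mk, AddHom.coe_mk, ExteriorAlgebra.ιMulti_zero_apply]
  rw [Fintype.sum_unique, Algebra.algebraMap_eq_smul_one]
  congr 2
  exact Subsingleton.elim _ _

/-! ### Forms with values in a non-positively graded vector space

A finite-dimensional non-positively graded vector space `W = W⁰ ⊕ W⁻¹ ⊕ ⋯ ⊕ W^{-ℓ}` is given by
its homogeneous parts; `W k` is the part of degree `-k`. -/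

section Graded

variable {n ℓ : ℕ} (W : Fin (ℓ + 1) → Type*) [∀ k, NormedAddCommGroup (W k)]
  [∀ k, NormedSpace ℝ (W k)]

/-- The fibre `(⋀ (ℝⁿ)^* ⊗ W)^m = ⨁ₖ ⋀^{k+m} (ℝⁿ)^* ⊗ W^{-k}`. -/
abbrev Fiber (n : ℕ) (m : ℕ) : Type _ := ∀ k : Fin (ℓ + 1), Euc n [⋀^Fin ((k : ℕ) + m)]→L[ℝ] W k

variable {W}

/-- The `W⁰`-valued 0-form part of an element of degree `0`. -/
def zeroPart (α : Fiber W n 0) : W 0 := α 0 0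

/-! ### The graded algebra of functions on `W|_U` -/

variable (W)

/-- `C^∞(U)`. -/
abbrev SmoothFn (U : TopologicalSpace.Opens (W 0)) : Type _ :=
  C^∞⟮𝓘(ℝ, W 0), U; 𝓘(ℝ, ℝ), ℝ⟯

/-- The linear coordinates: a functional on `W^{-k}`, of degree `k`. -/
abbrev Coord : Type _ := Σ k : Fin (ℓ + 1), StrongDual ℝ (W k)

variable {W}

/-- The restriction to `U` of a linear functional on `W⁰`. -/
def linearFn (U : TopologicalSpace.Opens (W 0)) (ξ : StrongDual ℝ (W 0)) : SmoothFn W U :=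
  ⟨fun u => ξ u, ξ.contDiff.contMDiff.comp contMDiff_subtype_val⟩

variable (W)

/-- The relations defining `C^∞(U) ⊗ S((W^{<0})^*)`: linearity in the coordinates, graded
commutativity, and the identification of coordinates of degree `0` with functions on `U`. -/
inductive AlgRel (U : TopologicalSpace.Opens (W 0)) :
    FreeAlgebra (SmoothFn W U) (Coord W) → FreeAlgebra (SmoothFn W U) (Coord W) → Prop
  | add (k : Fin (ℓ + 1)) (ξ η : StrongDual ℝ (W k)) :
      AlgRel U (FreeAlgebra.ι _ ⟨k, ξ + η⟩) (FreeAlgebra.ι _ ⟨k, ξ⟩ + FreeAlgebra.ι _ ⟨k, η⟩)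
  | smul (k : Fin (ℓ + 1)) (c : ℝ) (ξ : StrongDual ℝ (W k)) :
      AlgRel U (FreeAlgebra.ι _ ⟨k, c • ξ⟩)
        (algebraMap ℝ (SmoothFn W U) c • FreeAlgebra.ι _ ⟨k, ξ⟩)
  | comm (g g' : Coord W) :
      AlgRel U (FreeAlgebra.ι _ g * FreeAlgebra.ι _ g')
        ((-1) ^ ((g.1 : ℕ) * (g'.1 : ℕ)) * (FreeAlgebra.ι _ g' * FreeAlgebra.ι _ g))
  | fn (ξ : StrongDual ℝ (W 0)) :
      AlgRel U (FreeAlgebra.ι _ ⟨0, ξ⟩) (algebraMap _ _ (linearFn U ξ))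

/-- The graded commutative algebra `𝒜_{W|_U} = C^∞(U) ⊗ S((W^{<0})^*)`. -/
abbrev FnAlg (U : TopologicalSpace.Opens (W 0)) : Type _ := RingQuot (AlgRel W U)

variable {W}

/-- The linear functional `ξ` on `W^{-k}` as an element of `𝒜_{W|_U}`. -/
def coordFn (U : TopologicalSpace.Opens (W 0)) (g : Coord W) : FnAlg W U :=
  RingQuot.mkAlgHom (SmoothFn W U) (AlgRel W U) (FreeAlgebra.ι _ g)

variable (W)

/-- The part of degree `m` of `𝒜_{W|_U}`: the `C^∞(U)`-span of the monomials of degree `m`. -/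
def degreePart (U : TopologicalSpace.Opens (W 0)) (m : ℕ) : Submodule (SmoothFn W U) (FnAlg W U) :=
  Submodule.span _ {p | ∃ l : List (Coord W), (l.map fun g => (g.1 : ℕ)).sum = m ∧
    p = (l.map (coordFn U)).prod}

/-- A differential `Q` on the graded algebra `𝒜_{W|_U}`: a derivation of degree `1` whose square
is zero. -/
structure Differential (U : TopologicalSpace.Opens (W 0)) where
  /-- the underlying linear map -/
  toLinearMap : FnAlg W U →ₗ[ℝ] FnAlg W U
  degree : ∀ m, ∀ a ∈ degreePart W U m, toLinearMap a ∈ degreePart W U (m + 1)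
  leibniz : ∀ m, ∀ a ∈ degreePart W U m, ∀ b : FnAlg W U,
    toLinearMap (a * b) = toLinearMap a * b + (-1) ^ m * (a * toLinearMap b)
  sq_zero : ∀ a, toLinearMap (toLinearMap a) = 0

variable {W}

/-- The pairing `⟨α, ξ⟩` of `α` with a coordinate, in the exterior algebra. -/
def pairing (α : Fiber W n 0) (g : Coord W) : Ext n :=
  toExt (g.2.compContinuousAlternatingMap (α g.1))

/-- Evaluation of functions at the point `u ∈ U`, with values in the scalars of `⋀ (ℝⁿ)^*`. -/
def evalFn (n : ℕ) {U : TopologicalSpace.Opens (W 0)} (u : U) : SmoothFn W U →+* Ext n where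
  toFun f := algebraMap ℝ (Ext n) (f u)
  map_one' := by simp
  map_mul' f g := by simp
  map_zero' := by simp
  map_add' f g := by simp

/-- The homomorphism `𝒜_{W|_U} → ⋀ (ℝⁿ)^*`, `F ↦ F(α)`, which substitutes `⟨α, ξ⟩` for each
coordinate `ξ`; functions on `U` are evaluated at the 0-form part of `α`. -/
def subst {U : TopologicalSpace.Opens (W 0)} (α : Fiber W n 0) (hα : zeroPart α ∈ U) :
    FnAlg W U →+* Ext n :=
  letI : Algebra (SmoothFn W U) (Ext n) := (evalFn n ⟨zeroPart α, hα⟩).toAlgebra' (by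
    intro c x
    exact Algebra.commutes (R := ℝ) (A := Ext n) (c ⟨zeroPart α, hα⟩) x)
  (RingQuot.liftAlgHom (SmoothFn W U) ⟨FreeAlgebra.lift (SmoothFn W U) (pairing α), by
    intro x y h
    have hmap : ∀ f : SmoothFn W U, algebraMap (SmoothFn W U) (Ext n) f =
        algebraMap ℝ (Ext n) (f ⟨zeroPart α, hα⟩) := fun f => rfl
    induction h with
    | add k ξ η =>
      simp only [map_add, FreeAlgebra.lift_ι_apply, pairing]
      rw [← map_add]
      rfl
    | smul k c ξ =>
      simp only [map_smul, FreeAlgebra.lift_ι_apply, pairing]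
      rw [Algebra.smul_def, hmap]
      have : (algebraMap ℝ (SmoothFn W U) c) ⟨zeroPart α, hα⟩ = c := by
        rfl
      rw [this, ← Algebra.smul_def, ← map_smul]
      rfl
    | comm g g' =>
      simp only [map_mul, map_pow, map_neg, map_one, FreeAlgebra.lift_ι_apply, pairing]
      exact toExt_graded_comm _ _
    | fn ξ =>
      rw [AlgHom.commutes, hmap, FreeAlgebra.lift_ι_apply]
      exact toExt_zero_degree _⟩).toRingHom

variable [∀ k, FiniteDimensional ℝ (W k)]

open Classical in
/-- `F_Q(α)`, where `F_Q = ∑ Qξⁱ ⊗ wᵢ ∈ 𝒜_{W|_U} ⊗ W` for dual bases `ξⁱ`, `wᵢ`, i.e.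
`⟨F_Q, ξ⟩ = Qξ`. (The value is `0` when the 0-form part of `α` is not in `U`.) -/
def FQ {U : TopologicalSpace.Opens (W 0)} (Q : Differential W U) (α : Fiber W n 0) :
    Fiber W n 1 :=
  if hα : zeroPart α ∈ U then fun k => ∑ i, (ofExt ((k : ℕ) + 1) (subst α hα (Q.toLinearMap
      (coordFn U ⟨k, LinearMap.toContinuousLinearMap ((Module.finBasis ℝ (W k)).coord i)⟩)))).smulRight
    (Module.finBasis ℝ (W k) i)
  else 0

end Graded

/-! ### Operations on forms -/

section Operations

variable {n : ℕ} {V : Type*} [NormedAddCommGroup V] [NormedSpace ℝ V]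

/-- The de Rham homotopy operator `h β = ∫₀¹ i_{∂_t} R^*β dt` of the retraction `R(x, t) = t x`. -/
def deRhamHomotopy {k : ℕ} (β : Euc n → Euc n [⋀^Fin (k + 1)]→L[ℝ] V) (x : Euc n) :
    Euc n [⋀^Fin k]→L[ℝ] V :=
  ∫ t in (0 : ℝ)..1, ((β (t • x)).curryLeft x).compContinuousLinearMap
    (t • ContinuousLinearMap.id ℝ (Euc n))

/-- The Lie derivative along the Euler vector field `E = ∑ xⁱ ∂/∂xⁱ`: the derivative at `s = 0` of
the pullback along its flow `x ↦ eˢ x`. On a star-shaped set the flow is defined for `s ≤ 0`. -/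
def lieDerivEuler {k : ℕ} (β : Euc n → Euc n [⋀^Fin k]→L[ℝ] V) (x : Euc n) :
    Euc n [⋀^Fin k]→L[ℝ] V :=
  derivWithin (fun s : ℝ => (β (Real.exp s • x)).compContinuousLinearMap
    (Real.exp s • ContinuousLinearMap.id ℝ (Euc n))) (Set.Iic 0) 0

end Operations

section GradedOperations

variable {n ℓ : ℕ} {W : Fin (ℓ + 1) → Type*} [∀ k, NormedAddCommGroup (W k)]
  [∀ k, NormedSpace ℝ (W k)]

/-- The homotopy operator on forms of degree `1` with values in `W`. -/
def hW (β : Euc n → Fiber W n 1) (x : Euc n) : Fiber W n 0 :=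
  fun k => deRhamHomotopy (fun y => β y k) x

/-- The Lie derivative along `E` on forms of degree `1` with values in `W`. -/
def lieW (β : Euc n → Fiber W n 1) (x : Euc n) : Fiber W n 1 :=
  fun k => lieDerivEuler (fun y => β y k) x

/-- Contraction with the Euler vector field at the point `x`. -/
def iE (x : Euc n) (y : Fiber W n 1) : Fiber W n 0 := fun k => (y k).curryLeft x

/-! ### Banach spaces of `C^r` maps -/

/-- Families of bounded continuous maps `N → (multilinear maps of order i)`, `i ≤ r`, with the
maximum of the supremum norms. -/
def JetSpace (N : Set (Euc n)) (r : ℕ) (F : Type*) [NormedAddCommGroup F] [NormedSpace ℝ F] :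
    Type _ :=
  ∀ i : Fin (r + 1), BoundedContinuousFunction N (Euc n [×(i : ℕ)]→L[ℝ] F)

section Jets

variable (N : Set (Euc n)) (r : ℕ) (F : Type*) [NormedAddCommGroup F] [NormedSpace ℝ F]

instance : NormedAddCommGroup (JetSpace N r F) :=
  inferInstanceAs (NormedAddCommGroup
    (∀ i : Fin (r + 1), BoundedContinuousFunction N (Euc n [×(i : ℕ)]→L[ℝ] F)))

instance : NormedSpace ℝ (JetSpace N r F) :=
  inferInstanceAs (NormedSpace ℝ
    (∀ i : Fin (r + 1), BoundedContinuousFunction N (Euc n [×(i : ℕ)]→L[ℝ] F)))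

/-- The space `C^r(N, F)` of `C^r` maps on `N` (with bounded derivatives, which is automatic when
`N` is compact). A map is recorded together with its derivatives of order `i ≤ r`; the norm is the
`C^r` norm, the maximum of the suprema of the norms of these derivatives. -/
def CrMap : Submodule ℝ (JetSpace N r F) where
  carrier := {J | ∃ p : Euc n → FormalMultilinearSeries ℝ (Euc n) F,
    HasFTaylorSeriesUpToOn r (fun x => (p x 0).curry0) p N ∧
      ∀ (i : Fin (r + 1)) (x : N), J i x = p x i}
  add_mem' := by
    rintro J K ⟨p, hp, hJ⟩ ⟨q, hq, hK⟩
    refine ⟨p + q, hp.add hq, fun i x => ?_⟩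
    change J i x + K i x = _
    simp [hJ, hK]
  zero_mem' := by
    refine ⟨0, ?_, fun i x => rfl⟩
    have h := (contDiff_const (𝕜 := ℝ) (E := Euc n) (n := (r : WithTop ℕ∞))
      (c := (0 : F))).ftaylorSeries.hasFTaylorSeriesUpToOn N
    refine (h.congr_series fun m _ x _ => ?_).congr fun x _ => by simp
    simp [ftaylorSeries]
  smul_mem' := by
    rintro c J ⟨p, hp, hJ⟩
    refine ⟨fun x => c • p x, ?_, fun i x => ?_⟩
    · exact hp.continuousLinearMap_comp (c • ContinuousLinearMap.id ℝ F)
    · change c • J i x = _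
      simp [hJ]

end Jets

open Classical in
/-- The value of a `C^r` map at a point (`0` outside `N`). -/
def ev {N : Set (Euc n)} {r : ℕ} {F : Type*} [NormedAddCommGroup F] [NormedSpace ℝ F]
    (f : CrMap N r F) (x : Euc n) : F :=
  if h : x ∈ N then (f.1 0 ⟨x, h⟩).curry0 else 0

variable (W) in
/-- The Banach space `Ω_r(N, W)^0`. -/
abbrev OmegaR (N : Set (Euc n)) (r : ℕ) : Type _ := CrMap N r (Fiber W n 0)

variable (W) in
/-- The subset `Ω_r(N, W|_U)^0`. -/
def OmegaRU (N : Set (Euc n)) (r : ℕ) (U : TopologicalSpace.Opens (W 0)) : Set (OmegaR W N r) :=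
  {A | ∀ x ∈ N, zeroPart (ev A x) ∈ U}

/-! ### The equation `ℒ_E a = F_Q(B + i_E a)` and the lifted Euler vector field -/

variable [∀ k, FiniteDimensional ℝ (W k)] {U : TopologicalSpace.Opens (W 0)}

/-- `κ(A) = A - h(F_Q(A))`, pointwise. -/
def kappa (Q : Differential W U) (A : Euc n → Fiber W n 0) (x : Euc n) : Fiber W n 0 :=
  A x - hW (fun y => FQ Q (A y)) x

/-- `a` is a `C^ρ` solution of `ℒ_E a = F_Q(B + i_E a)` on `N'`, a star-shaped open neighbourhood
of `0` in `N`. -/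
structure IsSolution (Q : Differential W U) (N : Set (Euc n)) (ρ : ℕ∞) (B : Euc n → Fiber W n 0)
    (N' : Set (Euc n)) (a : Euc n → Fiber W n 1) : Prop where
  zero_mem : (0 : Euc n) ∈ N'
  starConvex : StarConvex ℝ 0 N'
  isOpen : ∃ O : Set (Euc n), IsOpen O ∧ N' = N ∩ O
  contDiffOn : ContDiffOn ℝ ρ a N'
  mem : ∀ x ∈ N', zeroPart (B x + iE x (a x)) ∈ U
  eqn : ∀ x ∈ N', lieW a x = FQ Q (B x + iE x (a x))

/-- `A ∈ Ω(N, W|_U)^0`, of class `C^ρ`, satisfies `B = κ(A)`. -/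
structure IsPreimage (Q : Differential W U) (N : Set (Euc n)) (ρ : ℕ∞) (B A : Euc n → Fiber W n 0) :
    Prop where
  contDiffOn : ContDiffOn ℝ ρ A N
  mem : ∀ x ∈ N, zeroPart (A x) ∈ U
  eqn : ∀ x ∈ N, B x = kappa Q A x

/-- The part of the total space of `(⋀ T^*N ⊗ W)^1` where `F_Q(B + i_E ·)` is defined. -/
def hatDomain (U : TopologicalSpace.Opens (W 0)) (N : Set (Euc n)) (B : Euc n → Fiber W n 0) :
    Set (Euc n × Fiber W n 1) :=
  {p | p.1 ∈ N ∧ zeroPart (B p.1 + iE p.1 p.2) ∈ U}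

/-- The vector field `Ê = E_lift + F_Q(B + i_E ·)`; the natural lift `E_lift` of `E` multiplies the
fibre coordinates of form degree `j` by `-j`. -/
def hatE (Q : Differential W U) (B : Euc n → Fiber W n 0) (p : Euc n × Fiber W n 1) :
    Euc n × Fiber W n 1 :=
  (p.1, (fun k : Fin (ℓ + 1) => -(((k : ℕ) : ℝ) + 1) • p.2 k) + FQ Q (B p.1 + iE p.1 p.2))

end GradedOperations

/-! ### Hyperbolic fixed points and unstable manifolds -/

section Dynamics

variable {Z : Type*} [NormedAddCommGroup Z] [NormedSpace ℝ Z]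

/-- The stable subspace `{v | exp(tL) v → 0 as t → +∞}`. -/
def stableSubspace (L : Z →L[ℝ] Z) : Submodule ℝ Z where
  carrier := {v | Filter.Tendsto (fun t : ℝ => NormedSpace.exp (t • L) v) Filter.atTop (nhds 0)}
  add_mem' := fun {v w} hv hw => by simpa using Filter.Tendsto.add hv hw
  zero_mem' := by simp
  smul_mem' := fun c v hv => by simpa using Filter.Tendsto.const_smul hv c

/-- The unstable subspace `{v | exp(tL) v → 0 as t → -∞}`. -/
def unstableSubspace (L : Z →L[ℝ] Z) : Submodule ℝ Z where
  carrier := {v | Filter.Tendsto (fun t : ℝ => NormedSpace.exp (t • L) v) Filter.atBot (nhds 0)}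
  add_mem' := fun {v w} hv hw => by simpa using Filter.Tendsto.add hv hw
  zero_mem' := by simp
  smul_mem' := fun c v hv => by simpa using Filter.Tendsto.const_smul hv c

/-- The unstable manifold of the fixed point `P` of the vector field `X` on `D`: the points whose
integral curve exists in `D` for all negative times and tends to `P` as time tends to `-∞`. -/
def unstableManifold (X : Z → Z) (D : Set Z) (P : Z) : Set Z :=
  {p | ∃ γ : ℝ → Z, γ 0 = p ∧
    (∀ s ≤ 0, γ s ∈ D ∧ HasDerivWithinAt γ (X (γ s)) (Set.Iic 0) s) ∧
    Filter.Tendsto γ Filter.atBot (nhds P)}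

end Dynamics

section HatE

variable {n ℓ : ℕ} {W : Fin (ℓ + 1) → Type*} [∀ k, NormedAddCommGroup (W k)]
  [∀ k, NormedSpace ℝ (W k)] [∀ k, FiniteDimensional ℝ (W k)] {U : TopologicalSpace.Opens (W 0)}

/-- `P` is the unique fixed point of `Ê`, it lies over `0`, and it is hyperbolic: the stable
subspace is the vertical one, with eigenvalues `-j` on the forms of degree `j`, and the unstable
subspace, with the only eigenvalue `1`, projects bijectively onto `ℝⁿ`. -/
structure IsHyperbolicFixedPoint (Q : Differential W U) (N : Set (Euc n))
    (B : Euc n → Fiber W n 0) (P : Euc n × Fiber W n 1) : Prop where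
  fst_eq : P.1 = 0
  mem : P ∈ hatDomain U N B
  unique : ∀ p ∈ hatDomain U N B, hatE Q B p = 0 ↔ p = P
  hyperbolic : ∃ L : (Euc n × Fiber W n 1) →L[ℝ] (Euc n × Fiber W n 1),
    HasFDerivWithinAt (hatE Q B) L (hatDomain U N B) P ∧
    IsCompl (stableSubspace L) (unstableSubspace L) ∧
    stableSubspace L = LinearMap.ker (LinearMap.fst ℝ (Euc n) (Fiber W n 1)) ∧
    (∀ y : Fiber W n 1, L (0, y) = (0, fun k : Fin (ℓ + 1) => -(((k : ℕ) : ℝ) + 1) • y k)) ∧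
    Function.Bijective (fun v : unstableSubspace L => (v : Euc n × Fiber W n 1).1) ∧
    ∀ v ∈ unstableSubspace L, L v = v

end HatE

end Kuranishi

end

/-!
Write a form on the ray through `x` as a curve in `t ∈ [0, 1]`. The homotopy operator becomes
`h β (t x) = t i_x ∫₀¹ τ ^ k β_k(τ t x) dτ`, so `κ(A) = B` is a nonlinear Volterra equation on each
ray separately, and the equation `ℒ_E a = F_Q(B + i_E a)` is its differential form, singular at
`t = 0`, under the substitution `A = B + i_E a`, `a_k(x) = ∫₀¹ τ ^ k F_Q(A)_k(τ x) dτ`.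
The linearization of a Volterra equation is invertible, because the `m`-th power of a Volterra
operator has norm `O(C ^ m / m!)`. Hence solutions on a ray are unique, and the inverse function
theorem on `C([0, 1], X)`, with `x` as a parameter, shows that the set of those `x` whose ray
carries a solution is open in `N` and that the solution depends on `x` in a `C^ρ` way: this set is
the greatest domain. The same argument on `C^r(N, W)` makes `κ` a local diffeomorphism.

In the time `s = log t` a solution on a ray is an integral curve of `Ê_B` that stays in the
domain for all `s ≤ 0` and tends to the fixed point as `s → -∞`, so the graph of the greatest
solution is the unstable manifold.

A submanifold with corners need not be locally convex, but nearby points of it are joined by curves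
of comparable length, which gives the mean value inequality needed for derivatives within `N`.
-/

noncomputable section

namespace Kuranishi

open Set Filter Topology Metric unitInterval

/-! ### Locally quasiconvex sets -/

section Quasiconvex

variable {E F : Type*} [NormedAddCommGroup E] [NormedSpace ℝ E] [NormedAddCommGroup F]
  [NormedSpace ℝ F] {S : Set E} {z : E}

/-- `S` is quasiconvex near `z`: two points of `S` near `z` are joined by a differentiable curve in
`S`, staying near `z`, whose speed is at most a constant times their distance. Manifolds with
corners have this property without being locally convex, and it suffices for the mean value
inequality. -/
def LocallyQuasiconvexAt (S : Set E) (z : E) : Prop :=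
  ∃ C : ℝ, 0 ≤ C ∧ ∀ V ∈ 𝓝 z, ∀ᶠ p : E × E in 𝓝 (z, z), p.1 ∈ S → p.2 ∈ S →
    ∃ γ γ' : ℝ → E, γ 0 = p.1 ∧ γ 1 = p.2 ∧ ∀ t ∈ Icc (0 : ℝ) 1, γ t ∈ S ∧ γ t ∈ V ∧
      HasDerivWithinAt γ (γ' t) (Icc 0 1) t ∧ ‖γ' t‖ ≤ C * ‖p.2 - p.1‖

/-- `S` is quasiconvex near each of its points. -/
def LocallyQuasiconvex (S : Set E) : Prop :=
  ∀ z ∈ S, LocallyQuasiconvexAt S z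

theorem locallyQuasiconvexAt_of_convex (hS : Convex ℝ S) (z : E) : LocallyQuasiconvexAt S z := by
  refine ⟨1, zero_le_one, fun V hV => ?_⟩
  obtain ⟨δ, hδ, hball⟩ := Metric.mem_nhds_iff.1 hV
  filter_upwards [prod_mem_nhds (ball_mem_nhds z hδ) (ball_mem_nhds z hδ)] with p hp h1 h2
  refine ⟨fun t => p.1 + t • (p.2 - p.1), fun _ => p.2 - p.1, by simp, by simp, fun t ht =>
    ⟨hS.add_smul_sub_mem h1 h2 ht, hball ((convex_ball z δ).add_smul_sub_mem hp.1 hp.2 ht), ?_,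
      by simp⟩⟩
  simpa using (((hasDerivAt_id t).smul_const (p.2 - p.1)).const_add p.1).hasDerivWithinAt

theorem locallyQuasiconvexAt_of_chart {N : Set E} (φ : OpenPartialHomeomorph E E)
    (hφ : ContDiffOn ℝ 1 φ φ.source) (hφs : ContDiffOn ℝ 1 φ.symm φ.target)
    (hN : ∀ y ∈ φ.source, y ∈ N ↔ φ y ∈ S) (hz : z ∈ φ.source)
    (hS : LocallyQuasiconvexAt S (φ z)) : LocallyQuasiconvexAt N z := by
  have hy : φ z ∈ φ.target := φ.map_source hz
  obtain ⟨C, hC, hcurve⟩ := hS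
  obtain ⟨C₁, T₁, hT₁, hlip⟩ :=
    (hφ.contDiffAt (φ.open_source.mem_nhds hz)).exists_lipschitzOnWith
  obtain ⟨C₂, hC₂⟩ : ∃ C₂, ‖fderiv ℝ φ.symm (φ z)‖ < C₂ := exists_gt _
  have hC₂0 : 0 ≤ C₂ := (norm_nonneg _).trans hC₂.le
  have hbound : ∀ᶠ y in 𝓝 (φ z), ‖fderiv ℝ φ.symm y‖ < C₂ :=
    ((hφs.continuousOn_fderiv_of_isOpen φ.open_target le_rfl).continuousAt
      (φ.open_target.mem_nhds hy)).norm.eventually_lt_const hC₂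
  refine ⟨C₂ * (C * C₁), by positivity, fun V hV => ?_⟩
  have hV' : φ.symm ⁻¹' V ∈ 𝓝 (φ z) :=
    (φ.continuousAt_symm hy).preimage_mem_nhds (by rwa [φ.left_inv hz])
  have hφz : Tendsto (Prod.map φ φ) (𝓝 (z, z)) (𝓝 (φ z, φ z)) :=
    (φ.continuousAt hz).prodMap (φ.continuousAt hz)
  have hdomain : T₁ ∩ φ.source ∈ 𝓝 z := inter_mem hT₁ (φ.open_source.mem_nhds hz)
  filter_upwards [hφz.eventually (hcurve _ (inter_mem (inter_mem hV' hbound)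
    (φ.open_target.mem_nhds hy))), prod_mem_nhds hdomain hdomain]
  rintro ⟨x, y⟩ hp ⟨⟨hxT, hxφ⟩, hyT, hyφ⟩ hx hy
  obtain ⟨γ, γ', h0, h1, hγ⟩ := hp ((hN x hxφ).1 hx) ((hN y hyφ).1 hy)
  dsimp only [Prod.map] at h0 h1
  refine ⟨φ.symm ∘ γ, fun t => fderiv ℝ φ.symm (γ t) (γ' t), by simp [h0, φ.left_inv hxφ],
    by simp [h1, φ.left_inv hyφ], fun t ht => ?_⟩
  obtain ⟨hmS, ⟨⟨hmV, hmb⟩, hmt⟩, hd, hspeed⟩ := hγ t ht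
  have hdφ : HasFDerivAt φ.symm (fderiv ℝ φ.symm (γ t)) (γ t) :=
    ((hφs.differentiableOn one_ne_zero).differentiableAt
      (φ.open_target.mem_nhds hmt)).hasFDerivAt
  refine ⟨(hN _ (φ.map_target hmt)).2 (by rwa [φ.right_inv hmt]), hmV,
    hdφ.comp_hasDerivWithinAt t hd, ?_⟩
  calc ‖fderiv ℝ φ.symm (γ t) (γ' t)‖
      ≤ ‖fderiv ℝ φ.symm (γ t)‖ * ‖γ' t‖ := ContinuousLinearMap.le_opNorm _ _
    _ ≤ C₂ * (C * (C₁ * ‖y - x‖)) := by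
      gcongr
      · exact hmb.le
      · exact hspeed.trans (by gcongr; exact hlip.norm_sub_le hyT hxT)
    _ = C₂ * (C * C₁) * ‖y - x‖ := by ring

theorem locallyQuasiconvex_of_isOpen (hS : IsOpen S) : LocallyQuasiconvex S := fun _ hz =>
  locallyQuasiconvexAt_of_chart (OpenPartialHomeomorph.ofSet S hS) contDiffOn_id contDiffOn_id
    (fun _ hy => iff_of_true hy (mem_univ _)) hz (locallyQuasiconvexAt_of_convex convex_univ _)

theorem LocallyQuasiconvexAt.exists_norm_image_sub_le (hS : LocallyQuasiconvexAt S z) :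
    ∃ C : ℝ, 0 ≤ C ∧ ∀ V ∈ 𝓝 z, ∀ᶠ p : E × E in 𝓝 (z, z), p.1 ∈ S → p.2 ∈ S →
      ∀ (g : E → F) (g' : E → E →L[ℝ] F) (ε : ℝ),
        (∀ y ∈ S, y ∈ V → HasFDerivWithinAt g (g' y) S y) → (∀ y ∈ S, y ∈ V → ‖g' y‖ ≤ ε) →
          ‖g p.2 - g p.1‖ ≤ C * ε * ‖p.2 - p.1‖ := by
  obtain ⟨C, hC, h⟩ := hS
  refine ⟨C, hC, fun V hV => ?_⟩
  filter_upwards [h V hV] with p hp h1 h2 g g' ε hg hb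
  obtain ⟨γ, γ', h0, h1, hγ⟩ := hp h1 h2
  have hmv : ‖(g ∘ γ) 1 - (g ∘ γ) 0‖ ≤ C * ε * ‖p.2 - p.1‖ := by
    refine norm_image_sub_le_of_norm_deriv_le_segment_01' (f' := fun t => g' (γ t) (γ' t))
      (fun t ht => ?_) (fun t ht => ?_)
    · obtain ⟨hs, hv, hd, -⟩ := hγ t ht
      exact (hg _ hs hv).comp_hasDerivWithinAt t hd (fun s hs => (hγ s hs).1)
    · obtain ⟨hs, hv, -, hn⟩ := hγ t (Ico_subset_Icc_self ht)
      have hε : 0 ≤ ε := (norm_nonneg _).trans (hb _ hs hv)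
      calc ‖g' (γ t) (γ' t)‖ ≤ ‖g' (γ t)‖ * ‖γ' t‖ := (g' (γ t)).le_opNorm _
        _ ≤ ε * (C * ‖p.2 - p.1‖) := by gcongr; exact hb _ hs hv
        _ = C * ε * ‖p.2 - p.1‖ := by ring
  rwa [Function.comp_apply, Function.comp_apply, h0, h1] at hmv

theorem LocallyQuasiconvexAt.eventually_norm_sub_sub_le (hS : LocallyQuasiconvexAt S z) {f : E → F}
    {f' : E → E →L[ℝ] F} (hf : ∀ x ∈ S, HasFDerivWithinAt f (f' x) S x)
    (hf' : ContinuousWithinAt f' S z) {ε : ℝ} (hε : 0 < ε) :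
    ∀ᶠ p : E × E in 𝓝 (z, z), p.1 ∈ S → p.2 ∈ S →
      ‖f p.2 - f p.1 - f' p.1 (p.2 - p.1)‖ ≤ ε * ‖p.2 - p.1‖ := by
  obtain ⟨C, hC, h⟩ := hS.exists_norm_image_sub_le (F := F)
  set η := ε / (C + 1) with hη
  have hη0 : 0 < η := by positivity
  have hV : ∀ᶠ y in 𝓝 z, y ∈ S → ‖f' y - f' z‖ ≤ η := by
    simpa only [eventually_nhdsWithin_iff, mem_closedBall, dist_eq_norm] using
      hf'.eventually (closedBall_mem_nhds (f' z) hη0)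
  filter_upwards [h _ hV, continuous_fst.continuousAt.eventually hV] with p hp hp1 h1 h2
  have hmv := hp h1 h2 (fun y => f y - f' z y) (fun y => f' y - f' z) η
    (fun y hy _ => (hf y hy).sub (f' z).hasFDerivWithinAt) (fun y hy hyV => hyV hy)
  calc ‖f p.2 - f p.1 - f' p.1 (p.2 - p.1)‖
      = ‖((f p.2 - f' z p.2) - (f p.1 - f' z p.1)) - (f' p.1 - f' z) (p.2 - p.1)‖ := by
        congr 1; simp only [_root_.sub_apply, map_sub]; abel
    _ ≤ C * η * ‖p.2 - p.1‖ + η * ‖p.2 - p.1‖ := by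
        refine (norm_sub_le _ _).trans (add_le_add hmv ?_)
        exact (ContinuousLinearMap.le_opNorm _ _).trans (by gcongr; exact hp1 h1)
    _ = ε * ‖p.2 - p.1‖ := by rw [hη]; field_simp

theorem LocallyQuasiconvexAt.eventually_norm_limit_sub_le (hS : LocallyQuasiconvexAt S z)
    (hz : z ∈ S) :
    ∃ C : ℝ, 0 ≤ C ∧ ∀ᶠ x in 𝓝[S] z,
      ∀ (u : ℕ → E → F) (u' : ℕ → E → E →L[ℝ] F) (v : E → F) (ε : ℝ),
      (∀ᶠ m in atTop, ∀ y ∈ S, HasFDerivWithinAt (u m) (u' m y) S y ∧ ‖u' m y‖ ≤ ε) →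
      (∀ y ∈ S, Tendsto (fun m => u m y) atTop (𝓝 (v y))) → ‖v x - v z‖ ≤ C * ε * ‖x - z‖ := by
  obtain ⟨C, hC, h⟩ := hS.exists_norm_image_sub_le (F := F)
  refine ⟨C, hC, ?_⟩
  have hz_pair : Tendsto (fun x => (z, x)) (𝓝[S] z) (𝓝 (z, z)) :=
    (Continuous.prodMk_right z).continuousAt.mono_left nhdsWithin_le_nhds
  filter_upwards [hz_pair.eventually (h univ univ_mem), self_mem_nhdsWithin]
    with x hx hxS u u' v ε hu huv
  refine le_of_tendsto ((huv x hxS).sub (huv z hz)).norm ?_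
  filter_upwards [hu] with m hm
  exact hx hz hxS (u m) (u' m) ε (fun y hy _ => (hm y hy).1) (fun y hy _ => (hm y hy).2)

theorem LocallyQuasiconvex.hasFDerivWithinAt_of_tendsto (hS : LocallyQuasiconvex S)
    {f : ℕ → E → F} {f' : ℕ → E → E →L[ℝ] F} {g : E → F} {g' : E → E →L[ℝ] F}
    (hf : ∀ m, ∀ x ∈ S, HasFDerivWithinAt (f m) (f' m x) S x)
    (hfg : ∀ x ∈ S, Tendsto (fun m => f m x) atTop (𝓝 (g x)))
    (hfg' : ∀ ε > 0, ∀ᶠ m in atTop, ∀ x ∈ S, ‖f' m x - g' x‖ ≤ ε) (hz : z ∈ S) :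
    HasFDerivWithinAt g (g' z) S z := by
  obtain ⟨C, hC, h⟩ := (hS z hz).eventually_norm_limit_sub_le (F := F) hz
  rw [hasFDerivWithinAt_iff_isLittleO, Asymptotics.isLittleO_iff]
  intro ε hε
  set η := ε / (2 * C + 2) with hη
  have hη0 : 0 < η := by positivity
  obtain ⟨m₀, hm₀⟩ := (hfg' η hη0).exists
  have hdiff : ∀ᶠ m in atTop, ∀ y ∈ S,
      HasFDerivWithinAt (f m - f m₀) (f' m y - f' m₀ y) S y ∧ ‖f' m y - f' m₀ y‖ ≤ 2 * η := by
    filter_upwards [hfg' η hη0] with m hm y hy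
    refine ⟨(hf m y hy).sub (hf m₀ y hy), ?_⟩
    calc ‖f' m y - f' m₀ y‖ = ‖(f' m y - g' y) - (f' m₀ y - g' y)‖ := by
          rw [sub_sub_sub_cancel_right]
      _ ≤ η + η := (norm_sub_le _ _).trans (add_le_add (hm y hy) (hm₀ y hy))
      _ = 2 * η := by ring
  filter_upwards [(hasFDerivWithinAt_iff_isLittleO.1 (hf m₀ z hz)).def hη0, h] with x hx1 hx2
  have hlim := hx2 (fun m => f m - f m₀) (fun m y => f' m y - f' m₀ y) (g - f m₀) (2 * η) hdiff
    fun y hy => (hfg y hy).sub_const _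
  calc ‖g x - g z - g' z (x - z)‖
      = ‖((g - f m₀) x - (g - f m₀) z) + (f m₀ x - f m₀ z - f' m₀ z (x - z)) +
          (f' m₀ z - g' z) (x - z)‖ := by
        congr 1; simp only [_root_.sub_apply, Pi.sub_apply]; abel
    _ ≤ C * (2 * η) * ‖x - z‖ + η * ‖x - z‖ + η * ‖x - z‖ := by
        refine norm_add₃_le.trans (add_le_add (add_le_add hlim hx1) ?_)
        exact (ContinuousLinearMap.le_opNorm _ _).trans (by gcongr; exact hm₀ z hz)
    _ = ε * ‖x - z‖ := by rw [hη]; field_simp; ring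

end Quasiconvex

/-! ### Submanifolds with corners -/

section Corners

variable {n : ℕ} {N : Set (Euc n)}

theorem convex_sector (s : Finset (Fin n)) : Convex ℝ {y : Euc n | ∀ i ∈ s, 0 ≤ y i} := by
  intro x hx y hy a b ha hb _ i hi
  have hxi := hx i hi
  have hyi := hy i hi
  simp only [PiLp.add_apply, PiLp.smul_apply, smul_eq_mul]
  positivity

theorem interior_sector_nonempty (s : Finset (Fin n)) :
    (interior {y : Euc n | ∀ i ∈ s, 0 ≤ y i}).Nonempty := by
  have hopen : IsOpen {y : Euc n | ∀ i, 0 < y i} := by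
    simp only [ofPred_forall]
    exact isOpen_iInter_of_finite fun i => isOpen_lt continuous_const (by fun_prop)
  refine ⟨WithLp.toLp 2 fun _ => 1, interior_maximal (fun y hy i _ => (hy i).le) hopen ?_⟩
  exact fun i => zero_lt_one

theorem IsSubmanifoldWithCorners.uniqueDiffOn (hN : IsSubmanifoldWithCorners N) :
    UniqueDiffOn ℝ N := by
  intro x hx
  obtain ⟨φ, hxφ, hφ, hφs, s, hs⟩ := hN x hx
  have hsector : UniqueDiffOn ℝ {y : Euc n | ∀ i ∈ s, 0 ≤ y i} :=
    uniqueDiffOn_convex (convex_sector s) (interior_sector_nonempty s)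
  have hpre := (uniqueMDiffOn_iff_uniqueDiffOn.2 hsector).uniqueMDiffOn_preimage (e := φ.symm)
    ⟨(hφs.differentiableOn (by simp)).mdifferentiableOn,
      (hφ.differentiableOn (by simp)).mdifferentiableOn⟩
  refine (uniqueMDiffOn_iff_uniqueDiffOn.1 hpre x ⟨hxφ, (hs x hxφ).1 hx⟩).mono ?_
  exact fun y hy => (hs y hy.1).2 hy.2

theorem IsSubmanifoldWithCorners.locallyQuasiconvex (hN : IsSubmanifoldWithCorners N) :
    LocallyQuasiconvex N := by
  intro z hz
  obtain ⟨φ, hzφ, hφ, hφs, s, hs⟩ := hN z hz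
  exact locallyQuasiconvexAt_of_chart (S := {y : Euc n | ∀ i ∈ s, 0 ≤ y i}) φ (hφ.of_le (by simp))
    (hφs.of_le (by simp)) hs hzφ (locallyQuasiconvexAt_of_convex (convex_sector s) _)

end Corners

/-! ### Superposition operators on spaces of continuous maps -/

section Superposition

variable {K : Type*} [TopologicalSpace K]

open Classical in
/-- The superposition (Nemytskii) operator `A ↦ f ∘ A` on continuous maps, with value `0` where
`f ∘ A` is not continuous, so that it is defined on all maps even if `f` is only regular on a
subset. -/
def nemytskii {X Y : Type*} [TopologicalSpace X] [TopologicalSpace Y] [Zero Y] (f : X → Y)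
    (A : C(K, X)) : C(K, Y) :=
  if h : Continuous (f ∘ A) then ⟨f ∘ A, h⟩ else 0

section Topological

variable {X Y : Type*} [TopologicalSpace X] [TopologicalSpace Y] [Zero Y] {f : X → Y} {S : Set X}

theorem nemytskii_apply (hf : ContinuousOn f S) {A : C(K, X)} (hA : ∀ t, A t ∈ S) (t : K) :
    nemytskii f A t = f (A t) := by
  have h : Continuous (f ∘ A) := hf.comp_continuous A.continuous hA
  simp [nemytskii, h]

theorem continuousOn_nemytskii (hf : ContinuousOn f S) :
    ContinuousOn (nemytskii f : C(K, X) → C(K, Y)) {A | ∀ t, A t ∈ S} := by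
  rw [continuousOn_iff_continuous_domRestrict]
  let corestrict : {A : C(K, X) | ∀ t, A t ∈ S} → C(K, S) := fun A =>
    ⟨fun t => ⟨A.1 t, A.2 t⟩, by fun_prop⟩
  have hcorestrict : Continuous corestrict :=
    (ContinuousMap.isInducing_postcomp ⟨Subtype.val, continuous_subtype_val⟩
      IsInducing.subtypeVal).continuous_iff.2 continuous_subtype_val
  have hpost : Continuous fun A : C(K, S) =>
      (⟨S.domRestrict f, hf.domRestrict⟩ : C(S, Y)).comp A :=
    ContinuousMap.continuous_postcomp _
  refine (hpost.comp hcorestrict).congr fun A => ?_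
  ext t
  exact (nemytskii_apply hf A.2 t).symm

end Topological

theorem exists_dist_lt_of_mem_nhds_diag {α : Type*} [PseudoMetricSpace α] {K : Set α}
    (hK : IsCompact K) {T : Set (α × α)} (hT : ∀ z ∈ K, T ∈ 𝓝 (z, z)) :
    ∃ δ > 0, ∀ y ∈ K, ∀ y', dist y' y < δ → (y, y') ∈ T := by
  have hdiag : IsCompact ((fun z => (z, z)) '' K) := hK.image (by fun_prop)
  have hsub : (fun z => (z, z)) '' K ⊆ interior T := by
    rintro _ ⟨z, hz, rfl⟩
    exact mem_interior_iff_mem_nhds.2 (hT z hz)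
  obtain ⟨δ, hδ, h⟩ := hdiag.exists_thickening_subset_open isOpen_interior hsub
  refine ⟨δ, hδ, fun y hy y' hd => interior_subset (h ?_)⟩
  exact mem_thickening_iff.2 ⟨(y, y), ⟨y, hy, rfl⟩, by simp [Prod.dist_eq, hd]⟩

variable [CompactSpace K]

/-- The bilinear operation on continuous maps induced pointwise by a continuous bilinear map. -/
def pointwise (K : Type*) [TopologicalSpace K] [CompactSpace K] {F G H : Type*}
    [NormedAddCommGroup F] [NormedSpace ℝ F] [NormedAddCommGroup G] [NormedSpace ℝ G]
    [NormedAddCommGroup H] [NormedSpace ℝ H] (b : F →L[ℝ] G →L[ℝ] H) :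
    C(K, F) →L[ℝ] C(K, G) →L[ℝ] C(K, H) :=
  LinearMap.mkContinuous₂
    (LinearMap.mk₂ ℝ (fun f g => (⟨fun t => b (f t) (g t), by fun_prop⟩ : C(K, H)))
      (fun f f' g => by ext; simp) (fun c f g => by ext; simp)
      (fun f g g' => by ext; simp) (fun c f g => by ext; simp))
    ‖b‖ (fun f g => by
      refine (ContinuousMap.norm_le _ (by positivity)).2 fun t => ?_
      calc ‖b (f t) (g t)‖ ≤ ‖b‖ * ‖f t‖ * ‖g t‖ := b.le_opNorm₂ _ _
        _ ≤ ‖b‖ * ‖f‖ * ‖g‖ := by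
          gcongr <;> exact ContinuousMap.norm_coe_le_norm _ _)

@[simp]
theorem pointwise_apply {F G H : Type*}
    [NormedAddCommGroup F] [NormedSpace ℝ F] [NormedAddCommGroup G] [NormedSpace ℝ G]
    [NormedAddCommGroup H] [NormedSpace ℝ H] (b : F →L[ℝ] G →L[ℝ] H) (f : C(K, F)) (g : C(K, G))
    (t : K) : pointwise K b f g t = b (f t) (g t) := rfl

theorem hasFDerivWithinAt_nemytskii {X Y : Type*} [NormedAddCommGroup X] [NormedSpace ℝ X]
    [NormedAddCommGroup Y] [NormedSpace ℝ Y] {f : X → Y} {f' : X → X →L[ℝ] Y} {S : Set X}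
    (hS : LocallyQuasiconvex S) (hf : ∀ x ∈ S, HasFDerivWithinAt f (f' x) S x)
    (hf' : ContinuousOn f' S) {A : C(K, X)} (hA : ∀ t, A t ∈ S) :
    HasFDerivWithinAt (nemytskii f : C(K, X) → C(K, Y))
      (pointwise K (.id ℝ (X →L[ℝ] Y)) (nemytskii f' A)) {A | ∀ t, A t ∈ S} A := by
  have hfc : ContinuousOn f S := fun x hx => (hf x hx).continuousWithinAt
  rw [hasFDerivWithinAt_iff_isLittleO, Asymptotics.isLittleO_iff]
  intro ε hε
  obtain ⟨δ, hδ, h⟩ := exists_dist_lt_of_mem_nhds_diag (isCompact_range A.continuous)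
    (T := {p | p.1 ∈ S → p.2 ∈ S → ‖f p.2 - f p.1 - f' p.1 (p.2 - p.1)‖ ≤ ε * ‖p.2 - p.1‖}) (by
      rintro _ ⟨t, rfl⟩
      exact (hS _ (hA t)).eventually_norm_sub_sub_le hf (hf' _ (hA t)) hε)
  filter_upwards [nhdsWithin_le_nhds (ball_mem_nhds A hδ), self_mem_nhdsWithin] with A' hd hA'
  refine (ContinuousMap.norm_le _ (by positivity)).2 fun t => ?_
  simp only [ContinuousMap.sub_apply, pointwise_apply, nemytskii_apply hfc hA,
    nemytskii_apply hfc hA', nemytskii_apply hf' hA, ContinuousLinearMap.id_apply]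
  calc ‖f (A' t) - f (A t) - f' (A t) (A' t - A t)‖
      ≤ ε * ‖A' t - A t‖ :=
        h _ (mem_range_self t) _ ((ContinuousMap.dist_apply_le_dist t).trans_lt hd) (hA t) (hA' t)
    _ ≤ ε * ‖A' - A‖ := by gcongr; exact ContinuousMap.norm_coe_le_norm (A' - A) t

section ContDiff

universe u v

variable {X : Type v} [NormedAddCommGroup X] [NormedSpace ℝ X] {S : Set X}
  {Y : Type (max u v)} [NormedAddCommGroup Y] [NormedSpace ℝ Y] {f : X → Y}

theorem contDiffOn_nat_nemytskii (hS : LocallyQuasiconvex S) (hu : UniqueDiffOn ℝ S) (m : ℕ)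
    (hf : ContDiffOn ℝ m f S) :
    ContDiffOn ℝ m (nemytskii f : C(K, X) → C(K, Y)) {A | ∀ t, A t ∈ S} := by
  induction m generalizing Y with
  | zero =>
    rw [Nat.cast_zero, contDiffOn_zero] at hf ⊢
    exact continuousOn_nemytskii hf
  | succ m ih =>
    have hf' : ContDiffOn ℝ m (fderivWithin ℝ f S) S := hf.fderivWithin hu (by simp)
    have hd : DifferentiableOn ℝ f S := hf.differentiableOn (by simp)
    rw [Nat.cast_succ, contDiffOn_succ_iff_hasFDerivWithinAt (by simp)]
    intro A hA
    refine ⟨{A | ∀ t, A t ∈ S}, ?_, by simp, fun A =>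
      pointwise K (.id ℝ (X →L[ℝ] Y)) (nemytskii (fderivWithin ℝ f S) A), fun A hA => ?_, ?_⟩
    · rw [insert_eq_of_mem hA]
      exact self_mem_nhdsWithin
    · exact hasFDerivWithinAt_nemytskii hS (fun x hx => (hd x hx).hasFDerivWithinAt)
        hf'.continuousOn hA
    · exact (pointwise K (.id ℝ (X →L[ℝ] Y))).contDiff.comp_contDiffOn (ih hf')

theorem contDiffOn_nemytskii (hS : LocallyQuasiconvex S) (hu : UniqueDiffOn ℝ S) {ρ : ℕ∞}
    (hf : ContDiffOn ℝ ρ f S) :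
    ContDiffOn ℝ ρ (nemytskii f : C(K, X) → C(K, Y)) {A | ∀ t, A t ∈ S} :=
  contDiffOn_iff_forall_nat_le.2 fun m hm =>
    contDiffOn_nat_nemytskii hS hu m (hf.of_le (mod_cast hm))

end ContDiff

end Superposition

/-! ### Injective local diffeomorphisms, and maps into a closed subspace -/

section Banach

theorem isOpenMap_domRestrict_of_bijective_fderiv {E F : Type*} [NormedAddCommGroup E]
    [NormedSpace ℝ E] [CompleteSpace E] [NormedAddCommGroup F] [NormedSpace ℝ F] [CompleteSpace F]
    {f : E → F} {s : Set E} {m : WithTop ℕ∞} (hm : m ≠ 0) (hs : IsOpen s) (hf : ContDiffOn ℝ m f s)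
    (hf' : ∀ a ∈ s, Function.Bijective (fderiv ℝ f a)) : IsOpenMap (s.domRestrict f) := by
  rw [isOpenMap_iff_nhds_le]
  rintro ⟨a, ha⟩
  have hstrict : HasStrictFDerivAt f (fderiv ℝ f a) a :=
    (hf.contDiffAt (hs.mem_nhds ha)).hasStrictFDerivAt hm
  have hmap : map (s.domRestrict f) (𝓝 ⟨a, ha⟩) = map f (𝓝 a) := by
    rw [← hs.nhdsWithin_eq ha, nhdsWithin_eq_map_subtype_coe ha, Filter.map_map]
    rfl
  rw [hmap, hstrict.map_nhds_eq_of_surj (LinearMap.range_eq_top.2 (hf' a ha).2)]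
  rfl

theorem exists_openPartialHomeomorph {E F : Type*} [NormedAddCommGroup E]
    [NormedSpace ℝ E] [CompleteSpace E] [NormedAddCommGroup F] [NormedSpace ℝ F] [CompleteSpace F]
    {f : E → F} {s : Set E} {m : WithTop ℕ∞} (hm : m ≠ 0) (hs : IsOpen s) (hf : ContDiffOn ℝ m f s)
    (hinj : InjOn f s) (hf' : ∀ a ∈ s, Function.Bijective (fderiv ℝ f a)) :
    ∃ Φ : OpenPartialHomeomorph E F, Φ.source = s ∧ (Φ : E → F) = f ∧
      ContDiffOn ℝ m Φ.symm Φ.target := by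
  let Φ := OpenPartialHomeomorph.ofContinuousOpenRestrict (hinj.toPartialEquiv f s)
    hf.continuousOn (isOpenMap_domRestrict_of_bijective_fderiv hm hs hf hf') hs
  refine ⟨Φ, rfl, rfl, fun y hy => ?_⟩
  have hmem : Φ.symm y ∈ s := Φ.map_target hy
  have hcd : ContDiffAt ℝ m f (Φ.symm y) := hf.contDiffAt (hs.mem_nhds hmem)
  let e := ContinuousLinearEquiv.ofBijective (fderiv ℝ f (Φ.symm y))
    (LinearMap.ker_eq_bot.2 (hf' _ hmem).1) (LinearMap.range_eq_top.2 (hf' _ hmem).2)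
  have he : HasFDerivAt f (e : E →L[ℝ] F) (Φ.symm y) := by
    rw [ContinuousLinearEquiv.coe_ofBijective]
    exact (hcd.differentiableAt hm).hasFDerivAt
  exact (Φ.contDiffAt_symm hy he hcd).contDiffWithinAt

variable {H G G' : Type*} [NormedAddCommGroup H] [NormedSpace ℝ H] [NormedAddCommGroup G]
  [NormedSpace ℝ G] [NormedAddCommGroup G'] [NormedSpace ℝ G'] {ι : G →L[ℝ] G'} {c : NNReal}

theorem antilipschitzWith_compL (hι : AntilipschitzWith c ι) :
    AntilipschitzWith c (ContinuousLinearMap.compL ℝ H G G' ι) := by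
  refine AddMonoidHomClass.antilipschitz_of_bound _ fun L => ?_
  refine L.opNorm_le_bound (by positivity) fun v => ?_
  calc ‖L v‖ ≤ c * ‖ι (L v)‖ := ι.bound_of_antilipschitz hι _
    _ ≤ c * (‖ContinuousLinearMap.compL ℝ H G G' ι L‖ * ‖v‖) := by
      gcongr
      exact (ContinuousLinearMap.compL ℝ H G G' ι L).le_opNorm v
    _ = c * ‖ContinuousLinearMap.compL ℝ H G G' ι L‖ * ‖v‖ := by ring

theorem exists_comp_eq_of_forall_mem_range (hι : AntilipschitzWith c ι) {L' : H →L[ℝ] G'}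
    (hL' : ∀ v, L' v ∈ range ι) : ∃ L : H →L[ℝ] G, ι.comp L = L' := by
  let e : G ≃ₗ[ℝ] LinearMap.range (ι : G →ₗ[ℝ] G') :=
    LinearEquiv.ofInjective (ι : G →ₗ[ℝ] G') hι.injective
  let L : H →ₗ[ℝ] G := e.symm.toLinearMap.comp (LinearMap.codRestrict _ (L' : H →ₗ[ℝ] G') hL')
  have hL : ∀ v, ι (L v) = L' v := fun v =>
    congrArg Subtype.val (e.apply_symm_apply ⟨L' v, hL' v⟩)
  refine ⟨L.mkContinuous (c * ‖L'‖) fun v => ?_, ContinuousLinearMap.ext hL⟩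
  calc ‖L v‖ ≤ c * ‖ι (L v)‖ := ι.bound_of_antilipschitz hι _
    _ ≤ c * (‖L'‖ * ‖v‖) := by rw [hL]; gcongr; exact L'.le_opNorm v
    _ = c * ‖L'‖ * ‖v‖ := by ring

theorem exists_hasFDerivAt_of_comp_antilipschitz [CompleteSpace G] (hι : AntilipschitzWith c ι)
    {f : H → G} {x : H} {L' : H →L[ℝ] G'} (hf : HasFDerivAt (fun x => ι (f x)) L' x) :
    ∃ L : H →L[ℝ] G, ι.comp L = L' ∧ HasFDerivAt f L x := by
  have hclosed : IsClosed (range ι) := (hι.isClosedEmbedding ι.uniformContinuous).isClosed_range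
  obtain ⟨L, hL⟩ := exists_comp_eq_of_forall_mem_range hι (L' := L') fun v =>
    hclosed.mem_of_tendsto (hf.hasLineDerivAt v).tendsto_slope_zero (Eventually.of_forall fun t =>
      ⟨t⁻¹ • (f (x + t • v) - f (x + (0 : ℝ) • v)), by simp⟩)
  refine ⟨L, hL, ?_⟩
  rw [hasFDerivAt_iff_isLittleO] at hf ⊢
  refine (Asymptotics.IsBigO.of_bound (c : ℝ) (Eventually.of_forall fun y => ?_)).trans_isLittleO hf
  have hcomp : ι (f y - f x - L (y - x)) = ι (f y) - ι (f x) - L' (y - x) := by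
    rw [← hL]
    simp
  rw [← hcomp]
  exact ι.bound_of_antilipschitz hι _

theorem contDiffOn_nat_of_comp_antilipschitz.{u} {H : Type u} [NormedAddCommGroup H]
    [NormedSpace ℝ H] {s : Set H} (hs : IsOpen s) (m : ℕ) {G G' : Type u} [NormedAddCommGroup G]
    [NormedSpace ℝ G] [CompleteSpace G] [NormedAddCommGroup G'] [NormedSpace ℝ G']
    {ι : G →L[ℝ] G'} {c : NNReal} (hι : AntilipschitzWith c ι) {f : H → G}
    (hf : ContDiffOn ℝ m (fun x => ι (f x)) s) : ContDiffOn ℝ m f s := by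
  induction m generalizing G G' with
  | zero =>
    rw [Nat.cast_zero, contDiffOn_zero] at hf ⊢
    exact (hι.isClosedEmbedding ι.uniformContinuous).isInducing.continuousOn_iff.2 hf
  | succ m ih =>
    rw [Nat.cast_succ, contDiffOn_succ_iff_fderiv_of_isOpen hs] at hf ⊢
    obtain ⟨hd, -, hf'⟩ := hf
    have hder : ∀ x ∈ s, ∃ L : H →L[ℝ] G,
        ι.comp L = fderiv ℝ (fun x => ι (f x)) x ∧ HasFDerivAt f L x := fun x hx =>
      exists_hasFDerivAt_of_comp_antilipschitz hι (hd.differentiableAt (hs.mem_nhds hx)).hasFDerivAt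
    refine ⟨fun x hx => ?_, by simp, ?_⟩
    · obtain ⟨L, -, h⟩ := hder x hx
      exact h.differentiableAt.differentiableWithinAt
    · refine ih (antilipschitzWith_compL hι) (hf'.congr fun x hx => ?_)
      obtain ⟨L, hL, h⟩ := hder x hx
      rw [h.fderiv]
      exact hL

theorem contDiffOn_of_comp_antilipschitz.{u} {H : Type u} [NormedAddCommGroup H]
    [NormedSpace ℝ H] {s : Set H} (hs : IsOpen s) {ρ : ℕ∞} {G G' : Type u} [NormedAddCommGroup G]
    [NormedSpace ℝ G] [CompleteSpace G] [NormedAddCommGroup G'] [NormedSpace ℝ G']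
    {ι : G →L[ℝ] G'} {c : NNReal} (hι : AntilipschitzWith c ι) {f : H → G}
    (hf : ContDiffOn ℝ ρ (fun x => ι (f x)) s) : ContDiffOn ℝ ρ f s :=
  contDiffOn_iff_forall_nat_le.2 fun m hm =>
    contDiffOn_nat_of_comp_antilipschitz hs m hι (hf.of_le (mod_cast hm))

end Banach

/-! ### Weighted averages along rays -/

section Average

variable {ℓ : ℕ} {Y : Fin (ℓ + 1) → Type*} [∀ k, NormedAddCommGroup (Y k)]
  [∀ k, NormedSpace ℝ (Y k)]

/-- The dilation of a graded vector by `τ`: multiplication of the `k`-th component by `τ ^ k`. -/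
def weight (Y : Fin (ℓ + 1) → Type*) [∀ k, NormedAddCommGroup (Y k)] [∀ k, NormedSpace ℝ (Y k)]
    (τ : ℝ) : (∀ k, Y k) →L[ℝ] (∀ k, Y k) :=
  ContinuousLinearMap.pi fun k => τ ^ (k : ℕ) • ContinuousLinearMap.proj k

@[simp]
theorem weight_apply (τ : ℝ) (y : ∀ k, Y k) (k : Fin (ℓ + 1)) :
    weight Y τ y k = τ ^ (k : ℕ) • y k := rfl

theorem norm_weight_apply_le {τ : ℝ} (hτ : τ ∈ I) (y : ∀ k, Y k) : ‖weight Y τ y‖ ≤ ‖y‖ := by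
  refine (pi_norm_le_iff_of_nonneg (norm_nonneg _)).2 fun k => ?_
  rw [weight_apply, norm_smul, norm_pow, Real.norm_of_nonneg hτ.1]
  calc τ ^ (k : ℕ) * ‖y k‖ ≤ 1 * ‖y k‖ := by gcongr; exact pow_le_one₀ hτ.1 hτ.2
    _ ≤ ‖y‖ := by rw [one_mul]; exact norm_le_pi_norm y k

/-- The extension of a map on `[0, 1]` to the real line by constants. -/
abbrev extend {X : Type*} [TopologicalSpace X] (w : C(I, X)) : ℝ → X :=
  IccExtend zero_le_one w

theorem continuous_extend {X : Type*} [TopologicalSpace X] (w : C(I, X)) :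
    Continuous (extend w) := w.continuous.Icc_extend'

theorem extend_coe {X : Type*} [TopologicalSpace X] (w : C(I, X)) (t : I) :
    extend w t = w t := IccExtend_val _ _ _

theorem extend_mul {X : Type*} [TopologicalSpace X] (w : C(I, X)) {τ : ℝ} (hτ : τ ∈ I) (t : I) :
    extend w (τ * t) = w (⟨τ, hτ⟩ * t) := extend_coe w (⟨τ, hτ⟩ * t)

theorem continuous_average_integrand (w : C(I, ∀ k, Y k)) :
    Continuous fun p : ℝ × ℝ => weight Y p.2 (extend w (p.2 * p.1)) := by
  have := continuous_extend w
  refine continuous_pi fun k => ?_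
  simp only [weight_apply]
  fun_prop

theorem intervalIntegrable_average (w : C(I, ∀ k, Y k)) (t a b : ℝ) :
    IntervalIntegrable (fun τ => weight Y τ (extend w (τ * t))) MeasureTheory.volume a b :=
  ((continuous_average_integrand w).comp (Continuous.prodMk_right t)).intervalIntegrable _ _

theorem norm_integral_weight_le (w : C(I, ∀ k, Y k)) (t : I) {c : ℝ} {m : ℕ}
    (h : ∀ t : I, ‖w t‖ ≤ c * (t : ℝ) ^ m) :
    ‖∫ τ in (0 : ℝ)..1, weight Y τ (extend w (τ * t))‖ ≤ c * (t : ℝ) ^ m / (m + 1) := by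
  have hbound : ∀ τ ∈ Set.Ioc (0 : ℝ) 1,
      ‖weight Y τ (extend w (τ * t))‖ ≤ c * (t : ℝ) ^ m * τ ^ m := by
    intro τ hτ
    have hτ' : τ ∈ I := ⟨hτ.1.le, hτ.2⟩
    refine (norm_weight_apply_le hτ' _).trans ?_
    rw [extend_mul w hτ']
    refine (h _).trans (le_of_eq ?_)
    rw [Set.Icc.coe_mul, mul_pow]
    ring
  refine (intervalIntegral.norm_integral_le_of_norm_le zero_le_one
    (MeasureTheory.ae_of_all MeasureTheory.volume hbound)
    (by apply Continuous.intervalIntegrable; fun_prop)).trans (le_of_eq ?_)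
  rw [intervalIntegral.integral_const_mul, integral_pow]
  simp [div_eq_mul_inv]

/-- The weighted average `w ↦ (t ↦ ∫₀¹ τ ^ k w_k(τ t) dτ)_k` along a ray. On the restriction of a
form to a ray it inverts the Lie derivative along the Euler vector field. -/
def average (Y : Fin (ℓ + 1) → Type*) [∀ k, NormedAddCommGroup (Y k)] [∀ k, NormedSpace ℝ (Y k)] :
    C(I, ∀ k, Y k) →L[ℝ] C(I, ∀ k, Y k) :=
  LinearMap.mkContinuous
    { toFun := fun w => ⟨fun t : I => ∫ τ in (0 : ℝ)..1, weight Y τ (extend w (τ * t)), by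
        have := intervalIntegral.continuous_parametric_intervalIntegral_of_continuous'
          (μ := MeasureTheory.volume) (f := fun t τ => weight Y τ (extend w (τ * t)))
          (continuous_average_integrand w) 0 1
        exact this.comp continuous_subtype_val⟩
      map_add' := fun w w' => by
        ext1 t
        simp only [ContinuousMap.coe_mk, ContinuousMap.add_apply]
        rw [← intervalIntegral.integral_add (intervalIntegrable_average w _ _ _)
          (intervalIntegrable_average w' _ _ _)]
        simp [IccExtend]
      map_smul' := fun c w => by
        ext1 t
        simp only [ContinuousMap.coe_mk, ContinuousMap.smul_apply, RingHom.id_apply]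
        rw [← intervalIntegral.integral_smul]
        simp [IccExtend] } 1 (fun w => by
    refine (ContinuousMap.norm_le _ (by positivity)).2 fun t => ?_
    have := norm_integral_weight_le w t (c := ‖w‖) (m := 0)
      (fun t => by simpa using w.norm_coe_le_norm t)
    simpa using this)

theorem average_apply (w : C(I, ∀ k, Y k)) (t : I) :
    average Y w t = ∫ τ in (0 : ℝ)..1, weight Y τ (extend w (τ * t)) := rfl

theorem norm_average_apply_le (w : C(I, ∀ k, Y k)) (t : I) {c : ℝ} {m : ℕ}
    (h : ∀ t : I, ‖w t‖ ≤ c * (t : ℝ) ^ m) : ‖average Y w t‖ ≤ c * (t : ℝ) ^ m / (m + 1) :=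
  norm_integral_weight_le w t h

/-- Multiplication by `s` on `[0, 1]`. -/
def mulI (s : I) : C(I, I) := ⟨fun t => s * t, by fun_prop⟩

@[simp]
theorem mulI_apply (s t : I) : mulI s t = s * t := rfl

theorem average_comp_mulI (w : C(I, ∀ k, Y k)) (s t : I) :
    average Y (w.comp (mulI s)) t = average Y w (s * t) := by
  rw [average_apply, average_apply]
  refine intervalIntegral.integral_congr fun τ hτ => ?_
  rw [uIcc_of_le zero_le_one] at hτ
  rw [extend_mul _ hτ, extend_mul _ hτ]
  simp [mul_left_comm]

variable [∀ k, CompleteSpace (Y k)]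

theorem average_apply_apply (w : C(I, ∀ k, Y k)) (t : I) (k : Fin (ℓ + 1)) :
    average Y w t k = ∫ τ in (0 : ℝ)..1, τ ^ (k : ℕ) • extend w (τ * t) k := by
  rw [average_apply]
  exact ((ContinuousLinearMap.proj (R := ℝ) (φ := Y) k).intervalIntegral_comp_comm
    (intervalIntegrable_average w t 0 1)).symm

theorem pow_smul_average (w : C(I, ∀ k, Y k)) (t : I) (k : Fin (ℓ + 1)) :
    (t : ℝ) ^ ((k : ℕ) + 1) • average Y w t k =
      ∫ r in (0 : ℝ)..t, r ^ (k : ℕ) • extend w r k := by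
  have := intervalIntegral.smul_integral_comp_mul_right (a := 0) (b := 1)
    (fun r : ℝ => r ^ (k : ℕ) • extend w r k) (t : ℝ)
  rw [zero_mul, one_mul] at this
  rw [← this, average_apply_apply, pow_succ', mul_smul, ← intervalIntegral.integral_smul]
  simp only [mul_pow, mul_smul]
  congr 2
  funext τ
  rw [smul_comm]

theorem average_zero_apply (w : C(I, ∀ k, Y k)) (k : Fin (ℓ + 1)) :
    average Y w 0 k = ((k : ℝ) + 1)⁻¹ • w 0 k := by
  rw [average_apply_apply]
  have : ∀ τ : ℝ, extend w (τ * (0 : I)) = w 0 := fun τ => by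
    rw [Set.Icc.coe_zero, mul_zero]; exact extend_coe w 0
  simp only [this]
  rw [intervalIntegral.integral_smul_const, integral_pow]
  simp

theorem exp_mem_unitInterval {s : ℝ} (hs : s ≤ 0) : Real.exp s ∈ I :=
  ⟨(Real.exp_pos s).le, Real.exp_le_one_iff.2 hs⟩

theorem extend_average_exp (w : C(I, ∀ k, Y k)) (k : Fin (ℓ + 1)) {s : ℝ} (hs : s ≤ 0) :
    extend (average Y w) (Real.exp s) k =
      Real.exp (-((k : ℝ) + 1) * s) • ∫ r in (0 : ℝ)..Real.exp s, r ^ (k : ℕ) • extend w r k := by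
  have havg := pow_smul_average w ⟨Real.exp s, exp_mem_unitInterval hs⟩ k
  have hexponent : -((k : ℝ) + 1) * s + ((k : ℕ) + 1 : ℕ) * s = 0 := by push_cast; ring
  rw [← havg, smul_smul, ← Real.exp_nat_mul, ← Real.exp_add, hexponent, Real.exp_zero, one_smul]
  exact congrFun (extend_coe (average Y w) ⟨Real.exp s, exp_mem_unitInterval hs⟩) k

theorem hasDerivWithinAt_average_exp (w : C(I, ∀ k, Y k)) (k : Fin (ℓ + 1)) {s : ℝ} (hs : s ≤ 0) :
    HasDerivWithinAt (fun s => extend (average Y w) (Real.exp s) k)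
      (-((k : ℝ) + 1) • extend (average Y w) (Real.exp s) k + extend w (Real.exp s) k)
      (Iic 0) s := by
  have hcont : Continuous fun r : ℝ => r ^ (k : ℕ) • extend w r k := by
    have := continuous_extend w
    fun_prop
  have hintegral : HasDerivAt (fun u : ℝ => ∫ r in (0 : ℝ)..u, r ^ (k : ℕ) • extend w r k)
      (Real.exp s ^ (k : ℕ) • extend w (Real.exp s) k) (Real.exp s) :=
    intervalIntegral.integral_hasDerivAt_right (hcont.intervalIntegrable _ _)
      (hcont.stronglyMeasurableAtFilter _ _) hcont.continuousAt
  have hfactor : HasDerivAt (fun s : ℝ => Real.exp (-((k : ℝ) + 1) * s))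
      (Real.exp (-((k : ℝ) + 1) * s) * -((k : ℝ) + 1)) s := by
    simpa using ((hasDerivAt_id s).const_mul (-((k : ℝ) + 1))).exp
  have hproduct := hfactor.smul (hintegral.scomp s (Real.hasDerivAt_exp s))
  refine (hproduct.hasDerivWithinAt.congr (fun s hs => extend_average_exp w k hs)
    (extend_average_exp w k hs)).congr_deriv ?_
  rw [extend_average_exp w k hs, add_comm]
  congr 1
  · rw [smul_smul, mul_comm]
    rfl
  · have hexponent : -((k : ℝ) + 1) * s + s + (k : ℕ) * s = 0 := by ring
    rw [smul_smul, smul_smul, ← Real.exp_nat_mul, ← Real.exp_add, ← Real.exp_add, hexponent,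
      Real.exp_zero, one_smul]

theorem eq_average_of_hasDerivAt (v w : C(I, ∀ k, Y k))
    (h : ∀ k : Fin (ℓ + 1), ∀ t ∈ Ioo (0 : ℝ) 1,
      HasDerivAt (fun t => t ^ ((k : ℕ) + 1) • extend v t k)
      (t ^ (k : ℕ) • extend w t k) t) : v = average Y w := by
  have := continuous_extend v
  have := continuous_extend w
  have hpos : ∀ t : I, 0 < t → v t = average Y w t := by
    intro t ht
    have ht' : (0 : ℝ) < t := ht
    funext k
    have hftc := intervalIntegral.integral_eq_sub_of_hasDeriv_right_of_le
      (f := fun t => t ^ ((k : ℕ) + 1) • extend v t k)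
      (f' := fun t => t ^ (k : ℕ) • extend w t k) ht'.le
      (Continuous.continuousOn (by fun_prop))
      (fun s hs => (h k s ⟨hs.1, hs.2.trans_le t.2.2⟩).hasDerivWithinAt)
      (Continuous.intervalIntegrable (by fun_prop) _ _)
    rw [← pow_smul_average] at hftc
    simp only [ne_eq, Nat.add_eq_zero_iff, one_ne_zero, and_false, not_false_eq_true, zero_pow,
      zero_smul, sub_zero, extend_coe] at hftc
    exact (smul_right_injective (Y k) (pow_pos ht' ((k : ℕ) + 1)).ne' hftc).symm
  refine ContinuousMap.ext fun t => congrFun (Continuous.ext_on (s := Ioi (0 : I)) ?_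
    v.continuous (average Y w).continuous fun t ht => hpos t ht) t
  rw [dense_iff_closure_eq, closure_Ioi' ⟨1, zero_lt_one⟩]
  exact eq_univ_of_forall fun t => t.2.1

end Average

/-! ### Volterra operators -/

section Volterra

variable {ℓ : ℕ} {Y : Fin (ℓ + 1) → Type*} [∀ k, NormedAddCommGroup (Y k)]
  [∀ k, NormedSpace ℝ (Y k)] {X : Type*} [NormedAddCommGroup X] [NormedSpace ℝ X]
  {E : Type*} [NormedAddCommGroup E] [NormedSpace ℝ E]

/-- Pointwise application of a continuous family of operators to a continuous map. -/
abbrev applyC {K : Type*} [TopologicalSpace K] [CompactSpace K] {F G : Type*}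
    [NormedAddCommGroup F] [NormedSpace ℝ F] [NormedAddCommGroup G] [NormedSpace ℝ G] :
    C(K, F →L[ℝ] G) →L[ℝ] C(K, F) →L[ℝ] C(K, G) :=
  pointwise K (.id ℝ (F →L[ℝ] G))

theorem norm_applyC_apply_le {K : Type*} [TopologicalSpace K] [CompactSpace K] {F G : Type*}
    [NormedAddCommGroup F] [NormedSpace ℝ F] [NormedAddCommGroup G] [NormedSpace ℝ G]
    (M : C(K, F →L[ℝ] G)) (H : C(K, F)) (t : K) : ‖applyC M H t‖ ≤ ‖M‖ * ‖H t‖ :=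
  ((M t).le_opNorm _).trans (by gcongr; exact M.norm_coe_le_norm t)

/-- The ray `t ↦ t x`, as a curve depending linearly on its end point `x`. -/
def ray (E : Type*) [NormedAddCommGroup E] [NormedSpace ℝ E] : E →L[ℝ] C(I, E) :=
  (pointwise I (ContinuousLinearMap.lsmul ℝ ℝ) ⟨((↑) : I → ℝ), continuous_subtype_val⟩).comp
    (ContinuousLinearMap.const ℝ I)

@[simp]
theorem ray_apply (x : E) (t : I) : ray E x t = (t : ℝ) • x := rfl

/-- The operators `w ↦ (t ↦ t J_x w(t))`: along the ray through `x`, apply the value of `J` at the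
point `t x`. -/
def rayApply (J : E →L[ℝ] (∀ k, Y k) →L[ℝ] X) : E →L[ℝ] C(I, ∀ k, Y k) →L[ℝ] C(I, X) :=
  applyC.comp ((ray _).comp J)

@[simp]
theorem rayApply_apply (J : E →L[ℝ] (∀ k, Y k) →L[ℝ] X) (x : E) (w : C(I, ∀ k, Y k)) (t : I) :
    rayApply J x w t = (t : ℝ) • J x (w t) := rfl

theorem norm_le_pow_of_volterra (T : (∀ k, Y k) →L[ℝ] X) {L c : ℝ} (hL : 0 ≤ L) {m : ℕ}
    {H H' : C(I, X)} {w : C(I, ∀ k, Y k)} (hH : ∀ t, H t = (t : ℝ) • T (average Y w t))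
    (hw : ∀ t, ‖w t‖ ≤ L * ‖H' t‖) (hH' : ∀ t : I, ‖H' t‖ ≤ c * (t : ℝ) ^ m) (t : I) :
    ‖H t‖ ≤ (‖T‖ * L) * c / (m + 1) * (t : ℝ) ^ (m + 1) := by
  have havg := norm_average_apply_le w t (c := L * c) (m := m) (fun t => by
    rw [mul_assoc]; exact (hw t).trans (by gcongr; exact hH' t))
  have ht : (0 : ℝ) ≤ t := t.2.1
  rw [hH, norm_smul, Real.norm_of_nonneg ht]
  calc (t : ℝ) * ‖T (average Y w t)‖ ≤ t * (‖T‖ * (L * c * (t : ℝ) ^ m / (m + 1))) := by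
        gcongr; exact (T.le_opNorm _).trans (by gcongr)
    _ = _ := by rw [pow_succ]; ring

theorem eq_zero_of_volterra (T : (∀ k, Y k) →L[ℝ] X) {L : ℝ} (hL : 0 ≤ L)
    {H : C(I, X)} {w : C(I, ∀ k, Y k)} (hH : ∀ t, H t = (t : ℝ) • T (average Y w t))
    (hw : ∀ t, ‖w t‖ ≤ L * ‖H t‖) : H = 0 := by
  have hiterate : ∀ m : ℕ, ∀ t : I, ‖H t‖ ≤ (‖T‖ * L) ^ m / m.factorial * ‖H‖ * (t : ℝ) ^ m := by
    intro m
    induction m with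
    | zero => intro t; simpa using H.norm_coe_le_norm t
    | succ m ih =>
      intro t
      refine (norm_le_pow_of_volterra T hL hH hw ih t).trans (le_of_eq ?_)
      rw [Nat.factorial_succ, pow_succ (‖T‖ * L)]
      push_cast
      field_simp
  ext1 t
  have hlim : Tendsto (fun m : ℕ => (‖T‖ * L) ^ m / m.factorial * ‖H‖) atTop (𝓝 (0 * ‖H‖)) :=
    (FloorSemiring.tendsto_pow_div_factorial_atTop (‖T‖ * L)).mul_const _
  rw [zero_mul] at hlim
  have : ‖H t‖ ≤ 0 := ge_of_tendsto' hlim fun m => (hiterate m t).trans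
    (mul_le_of_le_one_right (by positivity) (pow_le_one₀ t.2.1 t.2.2))
  simpa using this

/-- The Volterra operator `H ↦ (t ↦ t J_x ∫₀¹ τ ^ k (M H)_k(τ t) dτ)`: contract with `t x` the
weighted average of `M H`. -/
def volterra (J : E →L[ℝ] (∀ k, Y k) →L[ℝ] X) (x : E) (M : C(I, X →L[ℝ] ∀ k, Y k)) :
    C(I, X) →L[ℝ] C(I, X) :=
  (rayApply J x).comp ((average Y).comp (applyC M))

theorem volterra_apply (J : E →L[ℝ] (∀ k, Y k) →L[ℝ] X) (x : E) (M : C(I, X →L[ℝ] ∀ k, Y k))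
    (H : C(I, X)) (t : I) :
    volterra J x M H t = (t : ℝ) • J x (average Y (applyC M H) t) := rfl

theorem norm_volterra_pow_apply_le (J : E →L[ℝ] (∀ k, Y k) →L[ℝ] X) (x : E)
    (M : C(I, X →L[ℝ] ∀ k, Y k)) (m : ℕ) (H : C(I, X)) (t : I) :
    ‖(volterra J x M ^ m) H t‖ ≤ (‖J x‖ * ‖M‖) ^ m / m.factorial * ‖H‖ * (t : ℝ) ^ m := by
  induction m generalizing t with
  | zero => simpa using H.norm_coe_le_norm t
  | succ m ih =>
    refine (norm_le_pow_of_volterra (J x) (norm_nonneg M)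
      (w := applyC M ((volterra J x M ^ m) H)) (fun t => ?_) (norm_applyC_apply_le M _)
      ih t).trans (le_of_eq ?_)
    · rw [pow_succ']
      exact volterra_apply J x M _ t
    · rw [Nat.factorial_succ, pow_succ (‖J x‖ * ‖M‖)]
      push_cast
      field_simp

theorem norm_volterra_pow_le (J : E →L[ℝ] (∀ k, Y k) →L[ℝ] X) (x : E)
    (M : C(I, X →L[ℝ] ∀ k, Y k)) (m : ℕ) :
    ‖volterra J x M ^ m‖ ≤ (‖J x‖ * ‖M‖) ^ m / m.factorial := by
  refine ContinuousLinearMap.opNorm_le_bound _ (by positivity) fun H => ?_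
  refine (ContinuousMap.norm_le _ (by positivity)).2 fun t =>
    (norm_volterra_pow_apply_le J x M m H t).trans ?_
  exact mul_le_of_le_one_right (by positivity) (pow_le_one₀ t.2.1 t.2.2)

theorem volterra_comp_mulI (J : E →L[ℝ] (∀ k, Y k) →L[ℝ] X) (x : E)
    (M : C(I, X →L[ℝ] ∀ k, Y k)) (H : C(I, X)) (s : I) :
    volterra J ((s : ℝ) • x) (M.comp (mulI s)) (H.comp (mulI s)) =
      (volterra J x M H).comp (mulI s) := by
  ext1 t
  have haverage : average Y (applyC (M.comp (mulI s)) (H.comp (mulI s))) t =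
      average Y (applyC M H) (s * t) := average_comp_mulI (applyC M H) s t
  rw [ContinuousMap.comp_apply, volterra_apply, volterra_apply, haverage, mulI_apply,
    Set.Icc.coe_mul, map_smul, _root_.smul_apply, smul_smul, mul_comm (t : ℝ)]

theorem isUnit_one_sub_of_isUnit_one_sub_pow {R : Type*} [Ring R] {a : R} {m : ℕ}
    (h : IsUnit (1 - a ^ m)) : IsUnit (1 - a) := by
  rw [← mul_neg_geom_sum a m] at h
  have hcomm : Commute (1 - a) (∑ i ∈ Finset.range m, a ^ i) :=
    Commute.sum_right _ _ _ fun i _ => ((Commute.one_left a).sub_left (Commute.refl a)).pow_right i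
  exact (hcomm.isUnit_mul_iff.1 h).1

theorem isUnit_one_sub_volterra [CompleteSpace X] (J : E →L[ℝ] (∀ k, Y k) →L[ℝ] X) (x : E)
    (M : C(I, X →L[ℝ] ∀ k, Y k)) : IsUnit (1 - volterra J x M) := by
  obtain ⟨m, hm⟩ := ((FloorSemiring.tendsto_pow_div_factorial_atTop
    (‖J x‖ * ‖M‖)).eventually (gt_mem_nhds zero_lt_one)).exists
  exact isUnit_one_sub_of_isUnit_one_sub_pow (isUnit_one_sub_of_norm_lt_one
    (R := C(I, X) →L[ℝ] C(I, X)) ((norm_volterra_pow_le J x M m).trans_lt hm))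

theorem volterra_eq_zero (J : E →L[ℝ] (∀ k, Y k) →L[ℝ] X) (x : E)
    (M : C(I, X →L[ℝ] ∀ k, Y k)) {H : C(I, X)} (h : H = volterra J x M H) : H = 0 :=
  eq_zero_of_volterra (J x) (norm_nonneg M) (w := applyC M H)
    (fun t => by conv_lhs => rw [h, volterra_apply]) (norm_applyC_apply_le M H)

end Volterra

/-! ### The equation along rays -/

theorem nemytskii_comp {K L X Z : Type*} [TopologicalSpace K] [TopologicalSpace L]
    [TopologicalSpace X] [TopologicalSpace Z] [Zero Z] {f : X → Z} {D : Set X}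
    (hf : ContinuousOn f D) {A : C(K, X)} (hA : ∀ t, A t ∈ D) (φ : C(L, K)) :
    nemytskii f (A.comp φ) = (nemytskii f A).comp φ := by
  ext1 t
  rw [nemytskii_apply hf (A := A.comp φ) (fun t => hA _), ContinuousMap.comp_apply,
    ContinuousMap.comp_apply, nemytskii_apply hf hA]

section OpenSuperposition

variable {K : Type*} [TopologicalSpace K] [CompactSpace K]

theorem isOpen_setOf_forall_mem {X : Type*} [TopologicalSpace X] {D : Set X} (hD : IsOpen D) :
    IsOpen {A : C(K, X) | ∀ t, A t ∈ D} := by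
  have := ContinuousMap.isOpen_setOfPred_mapsTo (X := K) isCompact_univ hD
  simpa [MapsTo] using this

theorem hasFDerivAt_nemytskii {X Z : Type*} [NormedAddCommGroup X] [NormedSpace ℝ X]
    [NormedAddCommGroup Z] [NormedSpace ℝ Z] {f : X → Z} {D : Set X} (hD : IsOpen D)
    (hf : ContDiffOn ℝ 1 f D) {A : C(K, X)} (hA : ∀ t, A t ∈ D) :
    HasFDerivAt (nemytskii f : C(K, X) → C(K, Z)) (applyC (nemytskii (fderiv ℝ f) A)) A :=
  (hasFDerivWithinAt_nemytskii (locallyQuasiconvex_of_isOpen hD)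
    (fun _ hx => ((hf.differentiableOn one_ne_zero).differentiableAt
      (hD.mem_nhds hx)).hasFDerivAt.hasFDerivWithinAt)
    (hf.continuousOn_fderiv_of_isOpen hD le_rfl) hA).hasFDerivAt
    ((isOpen_setOf_forall_mem hD).mem_nhds hA)

theorem nemytskii_clm_apply {Z : Type*} [TopologicalSpace Z] {F G : Type*} [NormedAddCommGroup F]
    [NormedSpace ℝ F] [NormedAddCommGroup G] [NormedSpace ℝ G] {S : Set Z} {M : Z → F →L[ℝ] G}
    {H : Z → F} (hM : ContinuousOn M S) (hH : ContinuousOn H S) {A : C(K, Z)}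
    (hA : ∀ t, A t ∈ S) :
    nemytskii (fun z => M z (H z)) A = applyC (nemytskii M A) (nemytskii H A) := by
  ext1 t
  rw [nemytskii_apply (hM.clm_apply hH) hA, pointwise_apply, nemytskii_apply hM hA,
    nemytskii_apply hH hA]
  rfl

theorem exists_norm_comp_sub_comp_le {X Z : Type*} [NormedAddCommGroup X] [NormedSpace ℝ X]
    [NormedAddCommGroup Z] [NormedSpace ℝ Z] {f : X → Z} {D : Set X} (hD : IsOpen D)
    (hf : ContDiffOn ℝ 1 f D) {A A' : C(K, X)} (hA : ∀ t, A t ∈ D) (hA' : ∀ t, A' t ∈ D) :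
    ∃ L : ℝ, 0 ≤ L ∧ ∀ t, ‖f (A t) - f (A' t)‖ ≤ L * ‖A t - A' t‖ := by
  have hsub : range A ∪ range A' ⊆ D :=
    union_subset (range_subset_iff.2 hA) (range_subset_iff.2 hA')
  have hloc : LocallyLipschitzOn (range A ∪ range A') f := fun x hx => by
    obtain ⟨c, t, ht, hc⟩ := (hf.contDiffAt (hD.mem_nhds (hsub hx))).exists_lipschitzOnWith
    exact ⟨c, t, nhdsWithin_le_nhds ht, hc⟩
  obtain ⟨L, hL⟩ := hloc.exists_lipschitzOnWith_of_compact
    ((isCompact_range A.continuous).union (isCompact_range A'.continuous))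
  exact ⟨L, L.2, fun t => hL.norm_sub_le (Or.inl (mem_range_self t)) (Or.inr (mem_range_self t))⟩

end OpenSuperposition

section Rays

variable {ℓ : ℕ} {Y : Fin (ℓ + 1) → Type*} [∀ k, NormedAddCommGroup (Y k)]
  [∀ k, NormedSpace ℝ (Y k)] {X : Type*} [NormedAddCommGroup X] [NormedSpace ℝ X]
  {E : Type*} [NormedAddCommGroup E] [NormedSpace ℝ E]

/-- The restriction of the fixed point equation `A = B + h(f(A))` to the ray through `x`:
`A(t) = B(t x) + t J_x ∫₀¹ τ ^ k f_k(A(τ t)) dτ`, with values in `D`. -/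
structure RaySol (J : E →L[ℝ] (∀ k, Y k) →L[ℝ] X) (f : X → ∀ k, Y k) (D : Set X) (B : E → X)
    (x : E) (A : C(I, X)) : Prop where
  mem : ∀ t, A t ∈ D
  eqn : ∀ t : I, A t = B ((t : ℝ) • x) + (t : ℝ) • J x (average Y (nemytskii f A) t)

/-- The points of `N` such that the equation along the ray through them has a solution. -/
def rayDomain (J : E →L[ℝ] (∀ k, Y k) →L[ℝ] X) (f : X → ∀ k, Y k) (D : Set X) (B : E → X)
    (N : Set E) : Set E :=
  {x ∈ N | ∃ A, RaySol J f D B x A}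

/-- The map `(x, A) ↦ (x, A - t J_x ∫₀¹ τ ^ k f_k(A(τ t)) dτ)`, which straightens the equation
along all rays simultaneously. -/
def rayChart (J : E →L[ℝ] (∀ k, Y k) →L[ℝ] X) (f : X → ∀ k, Y k) (p : E × C(I, X)) :
    E × C(I, X) :=
  (p.1, p.2 - rayApply J p.1 (average Y (nemytskii f p.2)))

/-- The derivative of `rayChart J f` at `(x, A)`, where `M` is the derivative of `f` along `A` and
`w` is the weighted average of `f` along `A`. -/
def rayChartDeriv (J : E →L[ℝ] (∀ k, Y k) →L[ℝ] X) (x : E) (M : C(I, X →L[ℝ] ∀ k, Y k))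
    (w : C(I, ∀ k, Y k)) : (E × C(I, X)) →L[ℝ] (E × C(I, X)) :=
  (ContinuousLinearMap.fst ℝ E C(I, X)).prod
    ((1 - volterra J x M).comp (.snd ℝ E C(I, X)) - ((rayApply J).flip w).comp (.fst ℝ E C(I, X)))

variable {J : E →L[ℝ] (∀ k, Y k) →L[ℝ] X} {f : X → ∀ k, Y k} {D : Set X} {B : E → X} {N : Set E}

theorem ray_mem (hstar : StarConvex ℝ 0 N) {x : E} (hx : x ∈ N) (t : I) : ray E x t ∈ N :=
  hstar.smul_mem hx t.2.1 t.2.2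

theorem nemytskii_ray_smul {Z : Type*} [TopologicalSpace Z] [Zero Z] {g : E → Z}
    (hg : ContinuousOn g N) (hstar : StarConvex ℝ 0 N) {x : E} (hx : x ∈ N) (s : I) :
    nemytskii g (ray E ((s : ℝ) • x)) = (nemytskii g (ray E x)).comp (mulI s) := by
  have hray : ray E ((s : ℝ) • x) = (ray E x).comp (mulI s) := by
    ext1 t
    simp [smul_smul]
  rw [hray, nemytskii_comp hg (ray_mem hstar hx)]

theorem eq_of_volterra_eq (hD : IsOpen D) (hf : ContDiffOn ℝ 1 f D) {A A' : C(I, X)}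
    (hA : ∀ t, A t ∈ D) (hA' : ∀ t, A' t ∈ D) (T : (∀ k, Y k) →L[ℝ] X)
    (h : ∀ t : I, A t - (t : ℝ) • T (average Y (nemytskii f A) t) =
      A' t - (t : ℝ) • T (average Y (nemytskii f A') t)) : A = A' := by
  obtain ⟨L, hL, hLip⟩ := exists_norm_comp_sub_comp_le hD hf hA hA'
  rw [← sub_eq_zero]
  refine eq_zero_of_volterra T hL (w := nemytskii f A - nemytskii f A') (fun t => ?_) (fun t => ?_)
  · rw [map_sub, ContinuousMap.sub_apply, ContinuousMap.sub_apply, map_sub, smul_sub,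
      sub_eq_sub_iff_sub_eq_sub.1 (h t)]
  · simpa [nemytskii_apply hf.continuousOn hA, nemytskii_apply hf.continuousOn hA'] using hLip t

theorem RaySol.unique (hD : IsOpen D) (hf : ContDiffOn ℝ 1 f D) {x : E} {A A' : C(I, X)}
    (hA : RaySol J f D B x A) (hA' : RaySol J f D B x A') : A = A' :=
  eq_of_volterra_eq hD hf hA.mem hA'.mem (J x) fun t => by
    rw [sub_eq_of_eq_add (hA.eqn t), sub_eq_of_eq_add (hA'.eqn t)]

theorem RaySol.scale (hf : ContinuousOn f D) {x : E} {A : C(I, X)} (hA : RaySol J f D B x A)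
    (s : I) : RaySol J f D B ((s : ℝ) • x) (A.comp (mulI s)) where
  mem t := hA.mem _
  eqn t := by
    rw [nemytskii_comp hf hA.mem, average_comp_mulI, ContinuousMap.comp_apply, mulI_apply, hA.eqn]
    simp only [Set.Icc.coe_mul, map_smul, _root_.smul_apply, smul_smul]
    rw [mul_comm (s : ℝ)]

theorem RaySol.at_zero (hB : B 0 ∈ D) : RaySol J f D B 0 (ContinuousMap.const I (B 0)) where
  mem _ := hB
  eqn t := by simp

theorem raySol_iff_rayChart_eq (hstar : StarConvex ℝ 0 N) (hB : ContinuousOn B N) {x : E}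
    (hx : x ∈ N) {A : C(I, X)} : RaySol J f D B x A ↔
      (∀ t, A t ∈ D) ∧ rayChart J f (x, A) = (x, nemytskii B (ray E x)) := by
  have hBx : ∀ t : I, nemytskii B (ray E x) t = B ((t : ℝ) • x) := nemytskii_apply hB
    (ray_mem hstar hx)
  simp only [rayChart, Prod.mk.injEq, true_and]
  refine ⟨fun h => ⟨h.mem, ?_⟩, fun h => ⟨h.1, fun t => ?_⟩⟩
  · ext1 t
    rw [hBx, ContinuousMap.sub_apply, h.eqn t]
    simp
  · rw [← hBx, ← h.2]
    simp

theorem rayDomain_eq_inter_preimage (hstar : StarConvex ℝ 0 N) (hB : ContinuousOn B N) :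
    rayDomain J f D B N = N ∩ (fun x => (x, nemytskii B (ray E x))) ⁻¹'
      (rayChart J f '' {p | ∀ t, p.2 t ∈ D}) := by
  ext x
  refine and_congr_right fun hx => ⟨fun ⟨A, hA⟩ => ?_, ?_⟩
  · obtain ⟨hmem, heq⟩ := (raySol_iff_rayChart_eq hstar hB hx).1 hA
    exact ⟨(x, A), hmem, heq⟩
  · rintro ⟨⟨x', A⟩, hmem, heq⟩
    obtain rfl : x' = x := congrArg Prod.fst heq
    exact ⟨A, (raySol_iff_rayChart_eq hstar hB hx).2 ⟨hmem, heq⟩⟩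

theorem injOn_rayChart (hD : IsOpen D) (hf : ContDiffOn ℝ 1 f D) :
    InjOn (rayChart J f) {p | ∀ t, p.2 t ∈ D} := by
  rintro ⟨x, A⟩ hA ⟨x', A'⟩ hA' h
  obtain ⟨hx, h⟩ := Prod.mk.inj h
  obtain rfl : x = x' := hx
  exact Prod.ext rfl (eq_of_volterra_eq hD hf hA hA' (J x) (DFunLike.congr_fun h))

theorem hasFDerivAt_rayChart (hD : IsOpen D) (hf : ContDiffOn ℝ 1 f D) {p : E × C(I, X)}
    (hp : ∀ t, p.2 t ∈ D) : HasFDerivAt (rayChart J f)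
      (rayChartDeriv J p.1 (nemytskii (fderiv ℝ f) p.2) (average Y (nemytskii f p.2))) p := by
  have haverage : HasFDerivAt (fun p : E × C(I, X) => average Y (nemytskii f p.2))
      ((average Y).comp ((applyC (nemytskii (fderiv ℝ f) p.2)).comp (.snd ℝ E C(I, X)))) p :=
    (average Y).hasFDerivAt.comp p ((hasFDerivAt_nemytskii hD hf hp).comp p hasFDerivAt_snd)
  have hrayApply : HasFDerivAt (fun p : E × C(I, X) => rayApply J p.1)
      ((rayApply J).comp (.fst ℝ E C(I, X))) p :=
    HasFDerivAt.comp (𝕜 := ℝ) (E := E × C(I, X)) (F := E) (G := C(I, ∀ k, Y k) →L[ℝ] C(I, X))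
      (f := Prod.fst) (f' := .fst ℝ E C(I, X)) p
      (ContinuousLinearMap.hasFDerivAt (F := C(I, ∀ k, Y k) →L[ℝ] C(I, X)) (rayApply J))
      hasFDerivAt_fst
  refine (hasFDerivAt_fst.prodMk
    (hasFDerivAt_snd.sub (hrayApply.clm_apply haverage))).congr_fderiv ?_
  ext v t <;> simp [rayChartDeriv, volterra, sub_sub]

variable [CompleteSpace X]

theorem bijective_rayChartDeriv (J : E →L[ℝ] (∀ k, Y k) →L[ℝ] X) (x : E)
    (M : C(I, X →L[ℝ] ∀ k, Y k)) (w : C(I, ∀ k, Y k)) :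
    Function.Bijective (rayChartDeriv J x M w) := by
  obtain ⟨e, he⟩ := isUnit_one_sub_volterra J x M
  have hval : ∀ v, rayChartDeriv J x M w v =
      (v.1, (e : C(I, X) →L[ℝ] C(I, X)) v.2 - rayApply J v.1 w) := fun v => by
    rw [he]
    rfl
  constructor
  · rw [injective_iff_map_eq_zero]
    rintro ⟨ξ, H⟩ h
    rw [hval] at h
    obtain ⟨rfl, h⟩ := Prod.mk.inj h
    have hH : H = volterra J x M H := by
      simpa [he, sub_eq_zero] using h
    rw [volterra_eq_zero J x M hH]
    rfl
  · rintro ⟨η, H⟩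
    have hcancel : ∀ H, (e : C(I, X) →L[ℝ] C(I, X)) ((↑e⁻¹ : C(I, X) →L[ℝ] C(I, X)) H) = H :=
      DFunLike.congr_fun (Units.mul_inv e)
    refine ⟨(η, (↑e⁻¹ : C(I, X) →L[ℝ] C(I, X)) (H + rayApply J η w)), ?_⟩
    rw [hval, hcancel, add_sub_cancel_right]

end Rays

section SmoothRays

universe u

variable {ℓ : ℕ} {Y : Fin (ℓ + 1) → Type u} [∀ k, NormedAddCommGroup (Y k)]
  [∀ k, NormedSpace ℝ (Y k)] {X : Type u} [NormedAddCommGroup X] [NormedSpace ℝ X]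
  {E : Type} [NormedAddCommGroup E] [NormedSpace ℝ E]
  {J : E →L[ℝ] (∀ k, Y k) →L[ℝ] X} {f : X → ∀ k, Y k} {D : Set X} {B : E → X} {N : Set E}
  {M : E → X →L[ℝ] ∀ k, Y k} {K : E → X}

theorem contDiffOn_nemytskii_of_isOpen {K : Type*} [TopologicalSpace K] [CompactSpace K]
    {Z : Type u} [NormedAddCommGroup Z] [NormedSpace ℝ Z] {g : X → Z} (hD : IsOpen D)
    (hg : ContDiffOn ℝ ∞ g D) :
    ContDiffOn ℝ ∞ (nemytskii g : C(K, X) → C(K, Z)) {A | ∀ t, A t ∈ D} :=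
  contDiffOn_nemytskii.{u, u} (ρ := ⊤) (locallyQuasiconvex_of_isOpen hD) hD.uniqueDiffOn hg

theorem contDiffOn_nemytskii_ray {Z : Type u} [NormedAddCommGroup Z] [NormedSpace ℝ Z] {B : E → Z}
    (hq : LocallyQuasiconvex N) (hu : UniqueDiffOn ℝ N) (hstar : StarConvex ℝ 0 N)
    {ρ : ℕ∞} (hB : ContDiffOn ℝ ρ B N) : ContDiffOn ℝ ρ (fun x => nemytskii B (ray E x)) N :=
  (contDiffOn_nemytskii.{u, 0} hq hu hB).comp (ray E).contDiff.contDiffOn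
    fun _ hx t => ray_mem hstar hx t

theorem contDiff_rayApply (J : E →L[ℝ] (∀ k, Y k) →L[ℝ] X) {n : WithTop ℕ∞} :
    ContDiff ℝ n fun x => rayApply J x :=
  ContinuousLinearMap.contDiff (𝕜 := ℝ) (E := E) (F := C(I, ∀ k, Y k) →L[ℝ] C(I, X)) (n := n)
    (rayApply J)

theorem contDiff_applyC {n : WithTop ℕ∞} :
    ContDiff ℝ n fun M : C(I, X →L[ℝ] ∀ k, Y k) => applyC M :=
  ContinuousLinearMap.contDiff (𝕜 := ℝ) (E := C(I, X →L[ℝ] ∀ k, Y k))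
    (F := C(I, X) →L[ℝ] C(I, ∀ k, Y k)) (n := n) applyC

theorem contDiffOn_rayChart (J : E →L[ℝ] (∀ k, Y k) →L[ℝ] X) (hD : IsOpen D)
    (hf : ContDiffOn ℝ ∞ f D) : ContDiffOn ℝ ∞ (rayChart J f) {p | ∀ t, p.2 t ∈ D} := by
  have hnemytskii : ContDiffOn ℝ ∞ (fun p : E × C(I, X) => nemytskii f p.2) {p | ∀ t, p.2 t ∈ D} :=
    (contDiffOn_nemytskii_of_isOpen hD hf).comp contDiffOn_snd fun p hp => hp
  have hrayApply : ContDiff ℝ ∞ fun p : E × C(I, X) => rayApply J p.1 :=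
    (contDiff_rayApply J).comp contDiff_fst
  exact contDiffOn_fst.prodMk (contDiffOn_snd.sub
    (hrayApply.contDiffOn.clm_apply ((average Y).contDiff.comp_contDiffOn hnemytskii)))

theorem linear_solution_unique (J : E →L[ℝ] (∀ k, Y k) →L[ℝ] X) (hstar : StarConvex ℝ 0 N)
    (hM : ContinuousOn M N) {H : E → X} (hH : ContinuousOn H N)
    (h : ∀ x ∈ N, H x = J x (average Y (nemytskii (fun y => M y (H y)) (ray E x)) 1)) :
    ∀ x ∈ N, H x = 0 := by
  intro x hx
  have hvolterra : nemytskii H (ray E x) =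
      volterra J x (nemytskii M (ray E x)) (nemytskii H (ray E x)) := by
    ext1 t
    have htx := ray_mem hstar hx t
    rw [nemytskii_apply hH (ray_mem hstar hx), h _ htx, ray_apply,
      nemytskii_ray_smul (hM.clm_apply hH) hstar hx, average_comp_mulI, volterra_apply,
      nemytskii_clm_apply hM hH (ray_mem hstar hx)]
    simp
  have hzero := DFunLike.congr_fun (volterra_eq_zero J x _ hvolterra) 1
  rw [nemytskii_apply hH (ray_mem hstar hx)] at hzero
  simpa using hzero

variable [CompleteSpace X]

theorem exists_openPartialHomeomorph_rayChart [CompleteSpace E] (J : E →L[ℝ] (∀ k, Y k) →L[ℝ] X)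
    (hD : IsOpen D) (hf : ContDiffOn ℝ ∞ f D) :
    ∃ Φ : OpenPartialHomeomorph (E × C(I, X)) (E × C(I, X)), Φ.source = {p | ∀ t, p.2 t ∈ D} ∧
      (Φ : E × C(I, X) → E × C(I, X)) = rayChart J f ∧ ContDiffOn ℝ ∞ Φ.symm Φ.target := by
  have hf₁ : ContDiffOn ℝ 1 f D := hf.of_le (by simp)
  refine exists_openPartialHomeomorph (by simp)
    ((isOpen_setOf_forall_mem hD).preimage continuous_snd) (contDiffOn_rayChart J hD hf)
    (injOn_rayChart hD hf₁) fun p hp => ?_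
  rw [(hasFDerivAt_rayChart hD hf₁ hp).fderiv]
  exact bijective_rayChartDeriv J _ _ _

theorem exists_raySol_family [CompleteSpace E] (hD : IsOpen D) (hf : ContDiffOn ℝ ∞ f D)
    (hq : LocallyQuasiconvex N) (hu : UniqueDiffOn ℝ N) (hstar : StarConvex ℝ 0 N)
    {ρ : ℕ∞} (hB : ContDiffOn ℝ ρ B N) :
    ∃ V : E → C(I, X), (∃ O, IsOpen O ∧ rayDomain J f D B N = N ∩ O) ∧
      ContDiffOn ℝ ρ V (rayDomain J f D B N) ∧
      ∀ x ∈ rayDomain J f D B N, RaySol J f D B x (V x) := by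
  obtain ⟨Φ, hsource, hΦ, hsymm⟩ := exists_openPartialHomeomorph_rayChart J hD hf
  let g : E → E × C(I, X) := fun x => (x, nemytskii B (ray E x))
  have hg : ContDiffOn ℝ ρ g N :=
    contDiffOn_id.prodMk (contDiffOn_nemytskii_ray hq hu hstar hB)
  have hdomain : rayDomain J f D B N = N ∩ g ⁻¹' Φ.target := by
    rw [← Φ.image_source_eq_target, hΦ, hsource]
    exact rayDomain_eq_inter_preimage hstar hB.continuousOn
  refine ⟨fun x => (Φ.symm (g x)).2, ?_, ?_, ?_⟩
  · obtain ⟨O, hO, h⟩ := continuousOn_iff'.1 hg.continuousOn _ Φ.open_target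
    exact ⟨O, hO, by rw [hdomain, inter_comm, h, inter_comm]⟩
  · rw [hdomain]
    exact contDiff_snd.comp_contDiffOn ((hsymm.of_le (by exact_mod_cast le_top)).comp
      (hg.mono inter_subset_left) inter_subset_right)
  · rintro x ⟨hx, A, hA⟩
    obtain ⟨hmem, heq⟩ := (raySol_iff_rayChart_eq hstar hB.continuousOn hx).1 hA
    have hinv : Φ.symm (g x) = (x, A) := by
      rw [← hΦ] at heq
      rw [show g x = Φ (x, A) from heq.symm, Φ.left_inv (hsource ▸ hmem)]
    change RaySol J f D B x (Φ.symm (g x)).2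
    rwa [hinv]

/-- The solution `H` of the linear equation `H = K + h(M H)` along the ray through `x`. -/
def linearRaySolution (J : E →L[ℝ] (∀ k, Y k) →L[ℝ] X) (M : E → X →L[ℝ] ∀ k, Y k) (K : E → X)
    (x : E) : C(I, X) :=
  Ring.inverse (1 - volterra J x (nemytskii M (ray E x))) (nemytskii K (ray E x))

theorem one_sub_volterra_linearRaySolution (J : E →L[ℝ] (∀ k, Y k) →L[ℝ] X)
    (M : E → X →L[ℝ] ∀ k, Y k) (K : E → X) (x : E) :
    (1 - volterra J x (nemytskii M (ray E x))) (linearRaySolution J M K x) =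
      nemytskii K (ray E x) :=
  DFunLike.congr_fun (Ring.mul_inverse_cancel _ (isUnit_one_sub_volterra J x _)) _

theorem linearRaySolution_apply (J : E →L[ℝ] (∀ k, Y k) →L[ℝ] X) (hstar : StarConvex ℝ 0 N)
    (hK : ContinuousOn K N) {x : E} (hx : x ∈ N) (t : I) :
    linearRaySolution J M K x t = K ((t : ℝ) • x) + (t : ℝ) • J x
      (average Y (applyC (nemytskii M (ray E x)) (linearRaySolution J M K x)) t) := by
  have heq := DFunLike.congr_fun (one_sub_volterra_linearRaySolution J M K x) t
  rw [nemytskii_apply hK (ray_mem hstar hx)] at heq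
  rw [← volterra_apply, ← sub_eq_iff_eq_add]
  exact heq

theorem linearRaySolution_smul (J : E →L[ℝ] (∀ k, Y k) →L[ℝ] X) (hstar : StarConvex ℝ 0 N)
    (hM : ContinuousOn M N) (hK : ContinuousOn K N) {x : E} (hx : x ∈ N) (s : I) :
    linearRaySolution J M K ((s : ℝ) • x) = (linearRaySolution J M K x).comp (mulI s) := by
  have hlarge := one_sub_volterra_linearRaySolution J M K ((s : ℝ) • x)
  have hsmall : (1 - volterra J ((s : ℝ) • x) (nemytskii M (ray E ((s : ℝ) • x))))
      ((linearRaySolution J M K x).comp (mulI s)) = nemytskii K (ray E ((s : ℝ) • x)) := by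
    rw [nemytskii_ray_smul hM hstar hx, nemytskii_ray_smul hK hstar hx,
      ← one_sub_volterra_linearRaySolution J M K x, sub_apply, sub_apply, volterra_comp_mulI]
    rfl
  rw [← hsmall, ← sub_eq_zero, ← map_sub, sub_apply, sub_eq_zero] at hlarge
  exact sub_eq_zero.1 (volterra_eq_zero J _ _ hlarge)

theorem contDiffOn_linearRaySolution (J : E →L[ℝ] (∀ k, Y k) →L[ℝ] X)
    (hq : LocallyQuasiconvex N) (hu : UniqueDiffOn ℝ N) (hstar : StarConvex ℝ 0 N) {ρ : ℕ∞}
    (hM : ContDiffOn ℝ ρ M N) (hK : ContDiffOn ℝ ρ K N) :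
    ContDiffOn ℝ ρ (linearRaySolution J M K) N := by
  have hvolterra : ContDiffOn ℝ ρ (fun x => 1 - volterra J x (nemytskii M (ray E x))) N :=
    contDiffOn_const.sub (ContDiffOn.clm_comp (contDiff_rayApply J).contDiffOn
      (contDiffOn_const.clm_comp
        (contDiff_applyC.comp_contDiffOn (contDiffOn_nemytskii_ray hq hu hstar hM))))
  have hinverse : ContDiffOn ℝ ρ
      (fun x => Ring.inverse (1 - volterra J x (nemytskii M (ray E x)))) N := by
    intro x hx
    obtain ⟨e, he⟩ := isUnit_one_sub_volterra J x (nemytskii M (ray E x))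
    have hsmooth := contDiffAt_ringInverse ℝ (R := C(I, X) →L[ℝ] C(I, X)) (n := ρ) e
    rw [he] at hsmooth
    exact hsmooth.comp_contDiffWithinAt x (hvolterra x hx)
  exact hinverse.clm_apply (contDiffOn_nemytskii_ray hq hu hstar hK)

theorem exists_linear_solution (J : E →L[ℝ] (∀ k, Y k) →L[ℝ] X) (hq : LocallyQuasiconvex N)
    (hu : UniqueDiffOn ℝ N) (hstar : StarConvex ℝ 0 N) {ρ : ℕ∞} (hM : ContDiffOn ℝ ρ M N)
    (hK : ContDiffOn ℝ ρ K N) :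
    ∃ H : E → X, ContDiffOn ℝ ρ H N ∧ ∀ x ∈ N, H x =
      K x + J x (average Y (nemytskii (fun y => M y (H y)) (ray E x)) 1) := by
  set S := linearRaySolution J M K
  have hH : ContDiffOn ℝ ρ (fun x => S x 1) N :=
    (ContinuousLinearMap.contDiff (E := C(I, X)) (ContinuousMap.evalCLM ℝ 1)).comp_contDiffOn
      (contDiffOn_linearRaySolution J hq hu hstar hM hK)
  refine ⟨fun x => S x 1, hH, fun x hx => ?_⟩
  have hray : nemytskii (fun y => S y 1) (ray E x) = S x := by
    ext1 t
    rw [nemytskii_apply hH.continuousOn (ray_mem hstar hx), ray_apply,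
      show S ((t : ℝ) • x) = (S x).comp (mulI t) from
        linearRaySolution_smul J hstar hM.continuousOn hK.continuousOn hx t]
    simp
  rw [nemytskii_clm_apply hM.continuousOn hH.continuousOn (ray_mem hstar hx), hray]
  simpa using linearRaySolution_apply J hstar hK.continuousOn hx 1

end SmoothRays

/-! ### The Euler equation -/

section Euler

variable {ℓ : ℕ} {Y : Fin (ℓ + 1) → Type*} [∀ k, NormedAddCommGroup (Y k)]
  [∀ k, NormedSpace ℝ (Y k)] {X : Type*} [NormedAddCommGroup X] [NormedSpace ℝ X]
  {E : Type*} [NormedAddCommGroup E] [NormedSpace ℝ E]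
  {J : E →L[ℝ] (∀ k, Y k) →L[ℝ] X} {f : X → ∀ k, Y k} {D : Set X} {B : E → X} {N : Set E}

/-- The vertical part `y ↦ (-(k + 1) y_k)_k + f(B_x + J_x y)` of the vector field `Ê_B` over `x`:
the solutions of the Euler equation are the sections along which it is the derivative in the
direction of the Euler vector field. The component `y_k` stands for a form of degree `k + 1`. -/
def eulerField (J : E →L[ℝ] (∀ k, Y k) →L[ℝ] X) (f : X → ∀ k, Y k) (B : E → X) (x : E)
    (y : ∀ k, Y k) : ∀ k, Y k :=
  (fun k : Fin (ℓ + 1) => -((k : ℝ) + 1) • y k) + f (B x + J x y)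

open scoped Classical in
/-- The solution along the ray through `x`, and `0` where there is none. -/
def raySolution (J : E →L[ℝ] (∀ k, Y k) →L[ℝ] X) (f : X → ∀ k, Y k) (D : Set X) (B : E → X)
    (x : E) : C(I, X) :=
  if h : ∃ A, RaySol J f D B x A then h.choose else 0

/-- The greatest solution `a` of the Euler equation, to be considered on `rayDomain J f D B N`. -/
def eulerSolution (J : E →L[ℝ] (∀ k, Y k) →L[ℝ] X) (f : X → ∀ k, Y k) (D : Set X) (B : E → X)
    (x : E) : ∀ k, Y k :=
  average Y (nemytskii f (raySolution J f D B x)) 1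

theorem RaySol.raySolution {x : E} {A : C(I, X)} (hA : RaySol J f D B x A) :
    RaySol J f D B x (raySolution J f D B x) := by
  have h : ∃ A, RaySol J f D B x A := ⟨A, hA⟩
  rw [Kuranishi.raySolution, dif_pos h]
  exact h.choose_spec

theorem RaySol.raySolution_eq (hD : IsOpen D) (hf : ContDiffOn ℝ 1 f D) {x : E} {A : C(I, X)}
    (hA : RaySol J f D B x A) : Kuranishi.raySolution J f D B x = A :=
  hA.raySolution.unique hD hf hA

theorem RaySol.eulerSolution_smul (hD : IsOpen D) (hf : ContDiffOn ℝ 1 f D) {x : E} {A : C(I, X)}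
    (hA : RaySol J f D B x A) (s : I) :
    eulerSolution J f D B ((s : ℝ) • x) = average Y (nemytskii f A) s := by
  rw [eulerSolution, (hA.scale hf.continuousOn s).raySolution_eq hD hf,
    nemytskii_comp hf.continuousOn hA.mem, average_comp_mulI, mul_one]

theorem RaySol.eulerSolution_eq (hD : IsOpen D) (hf : ContDiffOn ℝ 1 f D) {x : E} {A : C(I, X)}
    (hA : RaySol J f D B x A) : eulerSolution J f D B x = average Y (nemytskii f A) 1 := by
  simpa using hA.eulerSolution_smul hD hf 1

theorem RaySol.eq_add_eulerSolution (hD : IsOpen D) (hf : ContDiffOn ℝ 1 f D) {x : E}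
    {A : C(I, X)} (hA : RaySol J f D B x A) (t : I) :
    A t = B ((t : ℝ) • x) + J ((t : ℝ) • x) (eulerSolution J f D B ((t : ℝ) • x)) := by
  rw [hA.eulerSolution_smul hD hf, hA.eqn]
  simp

theorem starConvex_rayDomain (hf : ContinuousOn f D) (hstar : StarConvex ℝ 0 N) :
    StarConvex ℝ 0 (rayDomain J f D B N) := by
  rw [starConvex_zero_iff]
  rintro x ⟨hx, A, hA⟩ s hs₀ hs₁
  exact ⟨ray_mem hstar hx ⟨s, hs₀, hs₁⟩, _, hA.scale hf ⟨s, hs₀, hs₁⟩⟩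

theorem zero_mem_rayDomain (h0 : (0 : E) ∈ N) (hB0 : B 0 ∈ D) :
    (0 : E) ∈ rayDomain J f D B N := ⟨h0, _, RaySol.at_zero hB0⟩

theorem add_eulerSolution_mem (hD : IsOpen D) (hf : ContDiffOn ℝ 1 f D) {x : E}
    (hx : x ∈ rayDomain J f D B N) : B x + J x (eulerSolution J f D B x) ∈ D := by
  obtain ⟨-, A, hA⟩ := hx
  simpa [hA.eq_add_eulerSolution hD hf] using hA.mem 1

theorem eulerSolution_zero [∀ k, CompleteSpace (Y k)] (hD : IsOpen D) (hf : ContDiffOn ℝ 1 f D)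
    (hB0 : B 0 ∈ D) (k : Fin (ℓ + 1)) :
    eulerSolution J f D B 0 k = ((k : ℝ) + 1)⁻¹ • f (B 0) k := by
  have hsol : RaySol J f D B 0 (ContinuousMap.const I (B 0)) := RaySol.at_zero hB0
  have hzero := hsol.eulerSolution_smul hD hf 0
  rw [smul_zero] at hzero
  rw [hzero, average_zero_apply, nemytskii_apply hf.continuousOn hsol.mem,
    ContinuousMap.const_apply]

theorem hasDerivWithinAt_eulerSolution [∀ k, CompleteSpace (Y k)] (hD : IsOpen D)
    (hf : ContDiffOn ℝ 1 f D) {x : E} (hx : x ∈ rayDomain J f D B N) {s : ℝ} (hs : s ≤ 0) :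
    HasDerivWithinAt (fun s : ℝ => eulerSolution J f D B (Real.exp s • x))
      (eulerField J f B (Real.exp s • x) (eulerSolution J f D B (Real.exp s • x))) (Iic 0) s := by
  obtain ⟨-, A, hA⟩ := hx
  have haverage : ∀ s ≤ 0, eulerSolution J f D B (Real.exp s • x) =
      extend (average Y (nemytskii f A)) (Real.exp s) := fun s hs =>
    (hA.eulerSolution_smul hD hf ⟨_, exp_mem_unitInterval hs⟩).trans
      (extend_coe _ ⟨_, exp_mem_unitInterval hs⟩).symm
  have hderiv := hasDerivWithinAt_pi.2 fun k =>
    hasDerivWithinAt_average_exp (nemytskii f A) k hs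
  refine (hderiv.congr haverage (haverage s hs)).congr_deriv ?_
  have hvalue : extend (nemytskii f A) (Real.exp s) =
      f (B (Real.exp s • x) + J (Real.exp s • x) (eulerSolution J f D B (Real.exp s • x))) := by
    refine (extend_coe (nemytskii f A) ⟨_, exp_mem_unitInterval hs⟩).trans ?_
    rw [nemytskii_apply hf.continuousOn hA.mem, hA.eq_add_eulerSolution hD hf]
  rw [← haverage s hs, hvalue]
  rfl

theorem eq_average_of_hasDerivAt_eulerField [∀ k, CompleteSpace (Y k)] {x : E}
    {v w : C(I, ∀ k, Y k)} (hw : ∀ t : I, w t = f (B ((t : ℝ) • x) + J ((t : ℝ) • x) (v t)))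
    (hv : ∀ t ∈ Ioo (0 : ℝ) 1, ∃ d, HasDerivAt (extend v) d t ∧
      t • d = eulerField J f B (t • x) (extend v t)) : v = average Y w := by
  refine eq_average_of_hasDerivAt v w fun k t ht => ?_
  obtain ⟨d, hd, heq⟩ := hv t ht
  have hwt : extend w t = f (B (t • x) + J (t • x) (extend v t)) := by
    have hcoe := extend_coe w ⟨t, ht.1.le, ht.2.le⟩
    rw [hw, ← extend_coe v] at hcoe
    exact hcoe
  have hdk : t • d k = -((k : ℝ) + 1) • extend v t k + extend w t k := by
    rw [hwt]
    exact congrFun heq k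
  refine ((hasDerivAt_pow ((k : ℕ) + 1) t).smul (hasDerivAt_pi.1 hd k)).congr_deriv ?_
  calc t ^ ((k : ℕ) + 1) • d k + (((k : ℕ) + 1 : ℕ) * t ^ ((k : ℕ) + 1 - 1)) • extend v t k
      = t ^ (k : ℕ) • (t • d k + ((k : ℝ) + 1) • extend v t k) := by
        rw [pow_succ, mul_smul, smul_add, smul_smul _ ((k : ℝ) + 1), mul_comm (t ^ (k : ℕ))]
        simp
    _ = t ^ (k : ℕ) • extend w t k := by rw [hdk, neg_smul, neg_add_cancel_comm]

theorem exists_raySol_of_hasDerivAt [∀ k, CompleteSpace (Y k)] (hf : ContinuousOn f D)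
    (hstar : StarConvex ℝ 0 N) (hB : ContinuousOn B N) {x : E} (hx : x ∈ N) {v : C(I, ∀ k, Y k)}
    (hmem : ∀ t : I, B ((t : ℝ) • x) + (t : ℝ) • J x (v t) ∈ D)
    (hv : ∀ t ∈ Ioo (0 : ℝ) 1, ∃ d, HasDerivAt (extend v) d t ∧
      t • d = eulerField J f B (t • x) (extend v t)) :
    ∃ A, RaySol J f D B x A ∧ v = average Y (nemytskii f A) := by
  set A := nemytskii B (ray E x) + rayApply J x v
  have hA : ∀ t : I, A t = B ((t : ℝ) • x) + (t : ℝ) • J x (v t) := fun t => by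
    rw [ContinuousMap.add_apply, nemytskii_apply hB (ray_mem hstar hx), rayApply_apply, ray_apply]
  have hAD : ∀ t : I, A t ∈ D := fun t => hA t ▸ hmem t
  have hav : v = average Y (nemytskii f A) := by
    refine eq_average_of_hasDerivAt_eulerField (fun t => ?_) hv
    rw [nemytskii_apply hf hAD, hA]
    simp
  exact ⟨A, ⟨hAD, fun t => by rw [← hav, hA]⟩, hav⟩

theorem eulerSolution_eq_of_hasDerivAt [∀ k, CompleteSpace (Y k)] (hD : IsOpen D)
    (hf : ContDiffOn ℝ 1 f D) (hstar : StarConvex ℝ 0 N) (hB : ContinuousOn B N) {x : E}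
    (hx : x ∈ N) {v : C(I, ∀ k, Y k)} (hmem : ∀ t : I, B ((t : ℝ) • x) + (t : ℝ) • J x (v t) ∈ D)
    (hv : ∀ t ∈ Ioo (0 : ℝ) 1, ∃ d, HasDerivAt (extend v) d t ∧
      t • d = eulerField J f B (t • x) (extend v t)) :
    x ∈ rayDomain J f D B N ∧ eulerSolution J f D B x = v 1 := by
  obtain ⟨A, hA, rfl⟩ := exists_raySol_of_hasDerivAt hf.continuousOn hstar hB hx hmem hv
  exact ⟨⟨hx, A, hA⟩, hA.eulerSolution_eq hD hf⟩

theorem eulerSolution_eq_average (hD : IsOpen D) (hf : ContDiffOn ℝ 1 f D)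
    (hstar : StarConvex ℝ 0 N)
    (hcont : ContinuousOn (fun y => B y + J y (eulerSolution J f D B y)) (rayDomain J f D B N))
    {x : E} (hx : x ∈ rayDomain J f D B N) : eulerSolution J f D B x =
      average Y (nemytskii (fun y => f (B y + J y (eulerSolution J f D B y))) (ray E x)) 1 := by
  have hfcont : ContinuousOn (fun y => f (B y + J y (eulerSolution J f D B y)))
      (rayDomain J f D B N) :=
    hf.continuousOn.comp hcont fun y hy => add_eulerSolution_mem hD hf hy
  obtain ⟨A, hA⟩ := hx.2
  rw [hA.eulerSolution_eq hD hf]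
  congr 2
  ext1 t
  rw [nemytskii_apply hf.continuousOn hA.mem, hA.eq_add_eulerSolution hD hf,
    nemytskii_apply hfcont (ray_mem (starConvex_rayDomain hf.continuousOn hstar) hx)]
  rfl

theorem raySol_of_integral_eq {A : E → X} (hf : ContinuousOn f D) (hstar : StarConvex ℝ 0 N)
    (hA : ContinuousOn A N) (hAD : ∀ x ∈ N, A x ∈ D)
    (heq : ∀ x ∈ N, A x = B x + J x (average Y (nemytskii (fun y => f (A y)) (ray E x)) 1))
    {x : E} (hx : x ∈ N) : RaySol J f D B x (nemytskii A (ray E x)) := by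
  have hvalue := nemytskii_apply hA (ray_mem hstar hx)
  have hmem : ∀ t, nemytskii A (ray E x) t ∈ D := fun t => by
    rw [hvalue]
    exact hAD _ (ray_mem hstar hx t)
  have hfA : ContinuousOn (fun y => f (A y)) N := hf.comp hA hAD
  have hcomp : nemytskii (fun y => f (A y)) (ray E x) = nemytskii f (nemytskii A (ray E x)) := by
    ext1 t
    rw [nemytskii_apply hfA (ray_mem hstar hx), nemytskii_apply hf hmem, hvalue]
  refine ⟨hmem, fun t => ?_⟩
  rw [hvalue, heq _ (ray_mem hstar hx t), ray_apply, nemytskii_ray_smul hfA hstar hx,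
    average_comp_mulI, hcomp]
  simp

theorem eq_add_eulerSolution_of_integral_eq {A : E → X} (hD : IsOpen D) (hf : ContDiffOn ℝ 1 f D)
    (hstar : StarConvex ℝ 0 N) (hA : ContinuousOn A N) (hAD : ∀ x ∈ N, A x ∈ D)
    (heq : ∀ x ∈ N, A x = B x + J x (average Y (nemytskii (fun y => f (A y)) (ray E x)) 1))
    {x : E} (hx : x ∈ N) :
    x ∈ rayDomain J f D B N ∧ A x = B x + J x (eulerSolution J f D B x) := by
  have hsol := raySol_of_integral_eq hf.continuousOn hstar hA hAD heq hx
  have hvalue := hsol.eq_add_eulerSolution hD hf 1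
  rw [nemytskii_apply hA (ray_mem hstar hx)] at hvalue
  exact ⟨⟨hx, _, hsol⟩, by simpa using hvalue⟩

end Euler

section SmoothEuler

universe u

variable {ℓ : ℕ} {Y : Fin (ℓ + 1) → Type u} [∀ k, NormedAddCommGroup (Y k)]
  [∀ k, NormedSpace ℝ (Y k)] {X : Type u} [NormedAddCommGroup X] [NormedSpace ℝ X]
  [CompleteSpace X] {E : Type} [NormedAddCommGroup E] [NormedSpace ℝ E] [CompleteSpace E]
  {f : X → ∀ k, Y k} {D : Set X} {B : E → X} {N : Set E}

theorem exists_isOpen_rayDomain_eq (J : E →L[ℝ] (∀ k, Y k) →L[ℝ] X) (hD : IsOpen D)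
    (hf : ContDiffOn ℝ ∞ f D) (hq : LocallyQuasiconvex N) (hu : UniqueDiffOn ℝ N)
    (hstar : StarConvex ℝ 0 N) (hB : ContinuousOn B N) :
    ∃ O, IsOpen O ∧ rayDomain J f D B N = N ∩ O := by
  obtain ⟨V, hopen, -⟩ := exists_raySol_family (J := J) (ρ := 0) hD hf hq hu hstar
    (contDiffOn_zero.2 hB)
  exact hopen

theorem contDiffOn_eulerSolution (J : E →L[ℝ] (∀ k, Y k) →L[ℝ] X) (hD : IsOpen D)
    (hf : ContDiffOn ℝ ∞ f D) (hq : LocallyQuasiconvex N) (hu : UniqueDiffOn ℝ N)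
    (hstar : StarConvex ℝ 0 N) {ρ : ℕ∞} (hB : ContDiffOn ℝ ρ B N) :
    ContDiffOn ℝ ρ (eulerSolution J f D B) (rayDomain J f D B N) := by
  obtain ⟨V, -, hV, hsol⟩ := exists_raySol_family (J := J) hD hf hq hu hstar hB
  have hnemytskii : ContDiffOn ℝ ρ (fun x => nemytskii f (V x)) (rayDomain J f D B N) :=
    ((contDiffOn_nemytskii_of_isOpen hD hf).of_le (by exact_mod_cast le_top)).comp hV
      fun x hx => (hsol x hx).mem
  refine ((ContinuousLinearMap.contDiff (E := C(I, ∀ k, Y k))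
    (ContinuousMap.evalCLM ℝ 1)).comp_contDiffOn
    ((average Y).contDiff.comp_contDiffOn hnemytskii)).congr fun x hx => ?_
  exact (hsol x hx).eulerSolution_eq hD (hf.of_le (by simp))

end SmoothEuler

/-! ### Substitution of forms into `F_Q` -/

section Smooth

variable {n ℓ : ℕ} {W : Fin (ℓ + 1) → Type*} [∀ k, NormedAddCommGroup (W k)]
  [∀ k, NormedSpace ℝ (W k)] {U : TopologicalSpace.Opens (W 0)}

theorem contDiff_fiber_apply {m : ℕ} (k : Fin (ℓ + 1)) (v : Fin ((k : ℕ) + m) → Euc n) :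
    ContDiff ℝ ∞ fun α : Fiber W n m => α k v :=
  ((ContinuousAlternatingMap.apply ℝ (Euc n) (W k) v).comp
    (ContinuousLinearMap.proj (R := ℝ)
      (φ := fun k : Fin (ℓ + 1) => Euc n [⋀^Fin ((k : ℕ) + m)]→L[ℝ] W k) k)).contDiff

theorem contDiff_zeroPart : ContDiff ℝ ∞ (zeroPart : Fiber W n 0 → W 0) :=
  contDiff_fiber_apply 0 0

theorem isOpen_setOf_zeroPart_mem (U : TopologicalSpace.Opens (W 0)) :
    IsOpen {α : Fiber W n 0 | zeroPart α ∈ U} :=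
  U.isOpen.preimage contDiff_zeroPart.continuous

theorem exists_contDiffOn_extension (f : SmoothFn W U) :
    ∃ g : W 0 → ℝ, ContDiffOn ℝ ∞ g U ∧ ∀ u : U, f u = g u := by
  classical
  set g : W 0 → ℝ := fun u => if h : u ∈ U then f ⟨u, h⟩ else 0 with hg
  have hfg : ∀ u : U, f u = g u := fun u => by simp [hg]
  refine ⟨g, fun u hu => ?_, hfg⟩
  have hsmooth : ContMDiffAt 𝓘(ℝ, W 0) 𝓘(ℝ, ℝ) ∞ (fun u : U => g u) ⟨u, hu⟩ :=
    (f.contMDiff ⟨u, hu⟩).congr_of_eventuallyEq (Eventually.of_forall fun v => (hfg v).symm)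
  exact ((contMDiffAt_subtype_iff (f := g) (x := ⟨u, hu⟩)).1 hsmooth).contDiffAt.contDiffWithinAt

theorem subst_algebraMap (α : Fiber W n 0) (hα : zeroPart α ∈ U) (f : SmoothFn W U) :
    subst α hα (algebraMap (SmoothFn W U) (FnAlg W U) f) =
      algebraMap ℝ (Ext n) (f ⟨zeroPart α, hα⟩) := by
  let _ : Algebra (SmoothFn W U) (Ext n) := (evalFn n ⟨zeroPart α, hα⟩).toAlgebra' (by
    intro c x
    exact Algebra.commutes (R := ℝ) (A := Ext n) (c ⟨zeroPart α, hα⟩) x)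
  exact AlgHom.commutes (RingQuot.liftAlgHom (SmoothFn W U) _) f

theorem subst_coordFn (α : Fiber W n 0) (hα : zeroPart α ∈ U) (g : Coord W) :
    subst α hα (coordFn U g) = pairing α g := by
  let _ : Algebra (SmoothFn W U) (Ext n) := (evalFn n ⟨zeroPart α, hα⟩).toAlgebra' (by
    intro c x
    exact Algebra.commutes (R := ℝ) (A := Ext n) (c ⟨zeroPart α, hα⟩) x)
  refine (RingQuot.liftAlgHom_mkAlgHom_apply (SmoothFn W U) _ _ _).trans ?_
  exact FreeAlgebra.lift_ι_apply _ _

/-- The result of substituting `α` in `p` depends smoothly on `α`. This is phrased with finitely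
many coefficients because the exterior algebra carries no topology. -/
def SmoothSubst (n : ℕ) (p : FnAlg W U) : Prop :=
  ∃ (ι : Type) (_ : Fintype ι) (f : ι → Fiber W n 0 → ℝ) (e : ι → Ext n),
    (∀ i, ContDiffOn ℝ ∞ (f i) {α | zeroPart α ∈ U}) ∧
      ∀ (α : Fiber W n 0) (hα : zeroPart α ∈ U), subst α hα p = ∑ i, f i α • e i

theorem smoothSubst_algebraMap (n : ℕ) (f : SmoothFn W U) :
    SmoothSubst n (algebraMap (SmoothFn W U) (FnAlg W U) f) := by
  obtain ⟨g, hg, hfg⟩ := exists_contDiffOn_extension f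
  refine ⟨Unit, inferInstance, fun _ α => g (zeroPart α), fun _ => 1, fun _ =>
    hg.comp contDiff_zeroPart.contDiffOn fun α hα => hα, fun α hα => ?_⟩
  rw [subst_algebraMap, hfg]
  simp [Algebra.algebraMap_eq_smul_one]

theorem smoothSubst_coordFn (n : ℕ) (g : Coord W) : SmoothSubst n (coordFn U g) := by
  refine ⟨Fin g.1 → Fin n, inferInstance, fun i α => ((g.1 : ℕ).factorial : ℝ)⁻¹ *
      g.2 (α g.1 fun j => EuclideanSpace.basisFun (Fin n) ℝ (i j)),
    fun i => ExteriorAlgebra.ιMulti ℝ g.1 (fun j => dx (i j)), fun i => ?_, fun α hα => ?_⟩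
  · exact (contDiff_const.mul (g.2.contDiff.comp (contDiff_fiber_apply g.1 _))).contDiffOn
  · rw [subst_coordFn]
    simp only [pairing, toExt, LinearMap.smul_apply, LinearMap.sum_apply, LinearMap.coe_mk,
      AddHom.coe_mk, Finset.smul_sum, smul_smul]
    rfl

theorem SmoothSubst.add {p q : FnAlg W U} (hp : SmoothSubst n p) (hq : SmoothSubst n q) :
    SmoothSubst n (p + q) := by
  obtain ⟨ι, _, f, e, hf, he⟩ := hp
  obtain ⟨ι', _, f', e', hf', he'⟩ := hq
  refine ⟨ι ⊕ ι', inferInstance, Sum.elim f f', Sum.elim e e', ?_, fun α hα => ?_⟩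
  · rintro (i | i)
    exacts [hf i, hf' i]
  · simp [he, he']

theorem SmoothSubst.mul {p q : FnAlg W U} (hp : SmoothSubst n p) (hq : SmoothSubst n q) :
    SmoothSubst n (p * q) := by
  obtain ⟨ι, _, f, e, hf, he⟩ := hp
  obtain ⟨ι', _, f', e', hf', he'⟩ := hq
  refine ⟨ι × ι', inferInstance, fun i α => f i.1 α * f' i.2 α, fun i => e i.1 * e' i.2,
    fun i => (hf i.1).mul (hf' i.2), fun α hα => ?_⟩
  rw [map_mul, he, he', Finset.sum_mul_sum, Fintype.sum_prod_type]
  simp [smul_smul, mul_comm]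

theorem smoothSubst (n : ℕ) (p : FnAlg W U) : SmoothSubst n p := by
  obtain ⟨p, rfl⟩ := RingQuot.mkAlgHom_surjective (SmoothFn W U) (AlgRel W U) p
  induction p with
  | grade0 f => rw [AlgHom.commutes]; exact smoothSubst_algebraMap n f
  | grade1 g => exact smoothSubst_coordFn n g
  | mul p q hp hq => rw [map_mul]; exact hp.mul hq
  | add p q hp hq => rw [map_add]; exact hp.add hq

theorem ofExt_apply {k : ℕ} (w : Ext n) (v : Fin k → Euc n) : ofExt k w v =
    ExteriorAlgebra.liftAlternating (Function.update 0 k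
      (exteriorPower.alternatingMapToDual ℝ (Euc n) k)) w (exteriorPower.ιMulti ℝ k v) := rfl

/-- The degree `k` part of an element of the exterior algebra, as a linear map. -/
def ofExtₗ (n k : ℕ) : Ext n →ₗ[ℝ] (Euc n [⋀^Fin k]→L[ℝ] ℝ) where
  toFun := ofExt k
  map_add' x y := by ext v; simp [ofExt_apply]
  map_smul' c x := by ext v; simp [ofExt_apply]

open scoped Classical in
theorem contDiffOn_ofExt_subst {V : Type*} [NormedAddCommGroup V] [NormedSpace ℝ V] (k : ℕ)
    (p : FnAlg W U) (v : V) :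
    ContDiffOn ℝ ∞ (fun α : Fiber W n 0 => if hα : zeroPart α ∈ U then
      (ofExt k (subst α hα p)).smulRight v else 0) {α | zeroPart α ∈ U} := by
  obtain ⟨ι, _, f, e, hf, he⟩ := smoothSubst n p
  have hsum : ContDiffOn ℝ ∞ (fun α : Fiber W n 0 => ∑ j, f j α • (ofExtₗ n k (e j)).smulRight v)
      {α | zeroPart α ∈ U} := ContDiffOn.sum fun j _ => (hf j).smul contDiffOn_const
  refine hsum.congr fun α (hα : zeroPart α ∈ U) => ?_
  rw [dif_pos hα, he]
  change (ofExtₗ n k (∑ j, f j α • e j)).smulRight _ = _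
  ext v
  simp [Finset.sum_smul, mul_smul]

variable [∀ k, FiniteDimensional ℝ (W k)]

theorem contDiffOn_FQ (Q : Differential W U) :
    ContDiffOn ℝ ∞ (FQ Q : Fiber W n 0 → Fiber W n 1) {α | zeroPart α ∈ U} := by
  classical
  refine contDiffOn_pi.2 fun k => ?_
  refine (ContDiffOn.sum fun i (_ : i ∈ Finset.univ) => contDiffOn_ofExt_subst ((k : ℕ) + 1)
    (Q.toLinearMap (coordFn U
      ⟨k, LinearMap.toContinuousLinearMap ((Module.finBasis ℝ (W k)).coord i)⟩))
    (Module.finBasis ℝ (W k) i)).congr fun α (hα : zeroPart α ∈ U) => ?_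
  rw [FQ, dif_pos hα]
  exact Finset.sum_congr rfl fun i _ => by rw [dif_pos hα]

end Smooth

/-! ### Contraction, homotopy operator and Lie derivative on rays -/

section Operations

variable {n ℓ : ℕ} {W : Fin (ℓ + 1) → Type*} [∀ k, NormedAddCommGroup (W k)]
  [∀ k, NormedSpace ℝ (W k)]

/-- The components of `Fiber W n 1`, in the form in which `average` takes them. -/
abbrev Comp (W : Fin (ℓ + 1) → Type*) [∀ k, NormedAddCommGroup (W k)]
    [∀ k, NormedSpace ℝ (W k)] (n : ℕ) (k : Fin (ℓ + 1)) : Type _ :=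
  Euc n [⋀^Fin ((k : ℕ) + 1)]→L[ℝ] W k

/-- The contraction `(x, α) ↦ i_E α` at the point `x`, as a continuous bilinear map. -/
def contraction (W : Fin (ℓ + 1) → Type*) [∀ k, NormedAddCommGroup (W k)]
    [∀ k, NormedSpace ℝ (W k)] (n : ℕ) :
    Euc n →L[ℝ] (∀ k, Comp W n k) →L[ℝ] Fiber W n 0 :=
  LinearMap.mkContinuous₂
    (LinearMap.mk₂ ℝ (fun x y => iE x y)
      (fun x x' y => by funext k; simp [iE]) (fun c x y => by funext k; simp [iE])
      (fun x y y' => by funext k; simp [iE]) (fun c x y => by funext k; simp [iE])) 1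
    (fun x y => by
      refine (pi_norm_le_iff_of_nonneg (by positivity)).2 fun k => ?_
      calc ‖(y k).curryLeft x‖ ≤ ‖(y k).curryLeft‖ * ‖x‖ := ContinuousLinearMap.le_opNorm _ _
        _ ≤ ‖y‖ * ‖x‖ := by
          rw [ContinuousAlternatingMap.norm_curryLeft]
          gcongr
          exact norm_le_pi_norm y k
        _ = 1 * ‖x‖ * ‖y‖ := by ring)

theorem contraction_apply (x : Euc n) (y : Fiber W n 1) : contraction W n x y = iE x y := rfl

theorem compContinuousLinearMap_smul_id {V : Type*} [NormedAddCommGroup V] [NormedSpace ℝ V]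
    {k : ℕ} (w : Euc n [⋀^Fin k]→L[ℝ] V) (t : ℝ) :
    w.compContinuousLinearMap (t • ContinuousLinearMap.id ℝ (Euc n)) = t ^ k • w := by
  ext v
  have := w.toContinuousMultilinearMap.map_smul_univ (fun _ => t) v
  simpa [Function.comp_def] using this

theorem hW_eq_contraction_average [∀ k, CompleteSpace (W k)] {N : Set (Euc n)}
    (hstar : StarConvex ℝ 0 N) {β : Euc n → Fiber W n 1} (hβ : ContinuousOn β N) {x : Euc n}
    (hx : x ∈ N) :
    hW β x = contraction W n x (average (Comp W n) (nemytskii β (ray (Euc n) x)) 1) := by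
  funext k
  rw [contraction_apply]
  simp only [hW, iE, deRhamHomotopy]
  rw [average_apply_apply]
  set w : C(I, ∀ k, Comp W n k) := nemytskii β (ray (Euc n) x)
  have hintegrable : IntervalIntegrable (fun τ : ℝ => τ ^ (k : ℕ) • extend w (τ * (1 : I)) k)
      MeasureTheory.volume 0 1 := by
    have := continuous_extend w
    exact Continuous.intervalIntegrable (by fun_prop) _ _
  have hcontract := ((ContinuousLinearMap.apply ℝ _ x).comp
    (ContinuousAlternatingMap.curryLeftLI (𝕜 := ℝ) (E := Euc n) (F := W k)
      (n := k)).toContinuousLinearMap).intervalIntegral_comp_comm hintegrable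
  refine Eq.trans ?_ hcontract
  refine intervalIntegral.integral_congr fun τ hτ => ?_
  rw [uIcc_of_le zero_le_one] at hτ
  rw [extend_mul w hτ, nemytskii_apply hβ (ray_mem hstar hx), compContinuousLinearMap_smul_id]
  simp

theorem lieW_eq_add_of_hasDerivWithinAt {a : Euc n → Fiber W n 1} {x : Euc n} {d : Fiber W n 1}
    (h : HasDerivWithinAt (fun s : ℝ => a (Real.exp s • x)) d (Iic 0) 0) :
    lieW a x = (fun k : Fin (ℓ + 1) => ((k : ℝ) + 1) • a x k) + d := by
  funext k
  have hderiv := ((Real.hasDerivAt_exp 0).fun_pow ((k : ℕ) + 1)).hasDerivWithinAt.fun_smul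
    (hasDerivWithinAt_pi.1 h k)
  simp only [lieW, lieDerivEuler, compContinuousLinearMap_smul_id]
  rw [hderiv.derivWithin (uniqueDiffWithinAt_convex (convex_Iic 0) (by simp) (by simp))]
  simp [add_comm]

end Operations

/-! ### The hyperbolic fixed point -/

section Hyperbolic

theorem exp_smul_apply_of_apply_eq_smul {Z : Type*} [NormedAddCommGroup Z] [NormedSpace ℝ Z]
    [CompleteSpace Z] {L : Z →L[ℝ] Z} {v : Z} {c : ℝ} (h : L v = c • v) (t : ℝ) :
    NormedSpace.exp (t • L) v = Real.exp (c * t) • v := by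
  have hpow : ∀ m : ℕ, ((t • L) ^ m) v = (c * t) ^ m • v := by
    intro m
    induction m with
    | zero => simp
    | succ m ih =>
      rw [pow_succ', mul_apply_eq_comp, ih, map_smul, _root_.smul_apply, h, smul_smul, smul_smul,
        pow_succ]
      congr 1
      ring
  have hoperator := (NormedSpace.exp_series_hasSum_exp' (𝕂 := ℝ) (t • L)).mapL
    (ContinuousLinearMap.apply ℝ Z v)
  have hscalar := (NormedSpace.exp_series_hasSum_exp' (𝕂 := ℝ) (c * t)).smul_const v
  rw [← Real.exp_eq_exp_ℝ] at hscalar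
  refine hoperator.unique (hscalar.congr_fun fun m => ?_)
  simp [hpow, smul_smul]

theorem eq_zero_of_tendsto_smul {V : Type*} [NormedAddCommGroup V] [NormedSpace ℝ V]
    {l : Filter ℝ} [l.NeBot] {r : ℝ → ℝ} {w : V} (hr : ∀ᶠ t in l, 1 ≤ r t)
    (h : Tendsto (fun t => r t • w) l (𝓝 0)) : w = 0 := by
  have hle : ∀ᶠ t in l, ‖w‖ ≤ ‖r t • w‖ := by
    filter_upwards [hr] with t ht
    rw [norm_smul, Real.norm_of_nonneg (zero_le_one.trans ht)]
    exact le_mul_of_one_le_left (norm_nonneg _) ht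
  have hnorm := h.norm
  rw [norm_zero] at hnorm
  exact norm_le_zero_iff.1 (ge_of_tendsto hnorm hle)

variable {ℓ : ℕ} {Y : Fin (ℓ + 1) → Type*} [∀ k, NormedAddCommGroup (Y k)]
  [∀ k, NormedSpace ℝ (Y k)] {E : Type*} [NormedAddCommGroup E] [NormedSpace ℝ E]

/-- The vertical part of `E_lift`: multiplication of the `k`-th component, which stands for the
forms of degree `k + 1`, by `-(k + 1)`. -/
def negDegree (Y : Fin (ℓ + 1) → Type*) [∀ k, NormedAddCommGroup (Y k)]
    [∀ k, NormedSpace ℝ (Y k)] : (∀ k, Y k) →L[ℝ] (∀ k, Y k) :=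
  ContinuousLinearMap.pi fun k => (-((k : ℝ) + 1)) • ContinuousLinearMap.proj k

@[simp]
theorem negDegree_apply (y : ∀ k, Y k) (k : Fin (ℓ + 1)) :
    negDegree Y y k = -((k : ℝ) + 1) • y k := rfl

/-- The linear vector field `(ξ, y) ↦ (ξ, M ξ + (-(k + 1) y_k)_k)`. The linearization of `Ê_B` at
its fixed point has this shape. -/
def linearization (M : E →L[ℝ] ∀ k, Y k) : (E × ∀ k, Y k) →L[ℝ] (E × ∀ k, Y k) :=
  (ContinuousLinearMap.fst ℝ E _).prod
    (M.comp (.fst ℝ E _) + (negDegree Y).comp (.snd ℝ E _))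

theorem linearization_apply (M : E →L[ℝ] ∀ k, Y k) (ξ : E) (y : ∀ k, Y k) :
    linearization M (ξ, y) = (ξ, M ξ + negDegree Y y) := rfl

/-- The map whose graph is the unstable subspace of `linearization M`. -/
def unstableSlope (M : E →L[ℝ] ∀ k, Y k) (ξ : E) : ∀ k, Y k :=
  fun k => ((k : ℝ) + 2)⁻¹ • M ξ k

theorem unstableSlope_zero (M : E →L[ℝ] ∀ k, Y k) : unstableSlope M 0 = 0 := by
  funext k
  simp [unstableSlope]

theorem linearization_unstableSlope (M : E →L[ℝ] ∀ k, Y k) (ξ : E) :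
    linearization M (ξ, unstableSlope M ξ) = (ξ, unstableSlope M ξ) := by
  rw [linearization_apply, Prod.mk.injEq]
  refine ⟨rfl, funext fun k => ?_⟩
  have hk : ((k : ℝ) + 2) ≠ 0 := by positivity
  simp only [Pi.add_apply, negDegree_apply, unstableSlope, smul_smul]
  nth_rewrite 1 [← one_smul ℝ (M ξ k)]
  rw [← add_smul]
  congr 1
  field_simp
  ring

theorem linearization_single (M : E →L[ℝ] ∀ k, Y k) (k : Fin (ℓ + 1)) (z : Y k) :
    linearization M ((0, Pi.single k z) : E × ∀ k, Y k) =
      (-((k : ℝ) + 1)) • ((0, Pi.single k z) : E × ∀ k, Y k) := by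
  rw [linearization_apply, Prod.smul_mk, Prod.mk.injEq]
  refine ⟨by simp, funext fun j => ?_⟩
  rw [map_zero, zero_add, negDegree_apply, Pi.smul_apply]
  rcases eq_or_ne j k with rfl | hjk
  · rfl
  · simp [Pi.single_eq_of_ne hjk]

variable [CompleteSpace E] [∀ k, CompleteSpace (Y k)]

theorem exp_linearization_vertical (M : E →L[ℝ] ∀ k, Y k) (t : ℝ) (z : ∀ k, Y k) :
    NormedSpace.exp (t • linearization M) ((0, z) : E × ∀ k, Y k) =
      (0, fun k : Fin (ℓ + 1) => Real.exp (-((k : ℝ) + 1) * t) • z k) := by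
  have hz : ((0, z) : E × ∀ k, Y k) = ∑ k, (0, Pi.single k (z k)) := by
    refine Prod.ext ?_ ?_
    · simp [Prod.fst_sum]
    · simp [Prod.snd_sum, Finset.univ_sum_single]
  rw [hz, map_sum]
  simp only [fun k => exp_smul_apply_of_apply_eq_smul (linearization_single M k (z k)) t,
    Prod.smul_mk]
  refine Prod.ext ?_ ?_
  · simp [Prod.fst_sum]
  · funext j
    rw [Prod.snd_sum, Finset.sum_apply, Finset.sum_eq_single j]
    · simp
    · intro k _ hk
      simp [Pi.single_eq_of_ne hk.symm]
    · simp

theorem exp_linearization (M : E →L[ℝ] ∀ k, Y k) (t : ℝ) (ξ : E) (y : ∀ k, Y k) :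
    NormedSpace.exp (t • linearization M) (ξ, y) = (Real.exp t • ξ, fun k : Fin (ℓ + 1) =>
      Real.exp t • unstableSlope M ξ k +
        Real.exp (-((k : ℝ) + 1) * t) • (y k - unstableSlope M ξ k)) := by
  have hsplit : ((ξ, y) : E × ∀ k, Y k) =
      (ξ, unstableSlope M ξ) + (0, y - unstableSlope M ξ) := by simp
  have hunstable : linearization M (ξ, unstableSlope M ξ) = (1 : ℝ) • (ξ, unstableSlope M ξ) := by
    rw [one_smul, linearization_unstableSlope]
  rw [hsplit, map_add, exp_smul_apply_of_apply_eq_smul hunstable, exp_linearization_vertical,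
    one_mul, Prod.smul_mk, Prod.mk_add_mk, add_zero]
  rfl

theorem mem_stableSubspace_linearization (M : E →L[ℝ] ∀ k, Y k) (ξ : E) (y : ∀ k, Y k) :
    (ξ, y) ∈ stableSubspace (linearization M) ↔ ξ = 0 := by
  change Tendsto (fun t : ℝ => NormedSpace.exp (t • linearization M) (ξ, y)) atTop (𝓝 0) ↔ _
  simp only [exp_linearization]
  constructor
  · intro h
    refine eq_zero_of_tendsto_smul (l := atTop) (r := Real.exp) ?_
      ((continuous_fst.tendsto (0 : E × ∀ k, Y k)).comp h)
    filter_upwards [eventually_ge_atTop 0] with t ht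
    exact Real.one_le_exp ht
  · rintro rfl
    rw [← Prod.mk_zero_zero]
    refine Tendsto.prodMk_nhds (by simp) (tendsto_pi_nhds.2 fun k => ?_)
    simp only [unstableSlope_zero, Pi.zero_apply, smul_zero, zero_add, sub_zero]
    have hdecay : Tendsto (fun t : ℝ => Real.exp (-((k : ℝ) + 1) * t)) atTop (𝓝 0) := by
      refine Real.tendsto_exp_atBot.comp ?_
      exact Tendsto.const_mul_atTop_of_neg (by linarith [Nat.cast_nonneg (α := ℝ) (k : ℕ)])
        tendsto_id
    simpa using hdecay.smul_const (y k)

theorem mem_unstableSubspace_linearization (M : E →L[ℝ] ∀ k, Y k) (ξ : E) (y : ∀ k, Y k) :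
    (ξ, y) ∈ unstableSubspace (linearization M) ↔ y = unstableSlope M ξ := by
  change Tendsto (fun t : ℝ => NormedSpace.exp (t • linearization M) (ξ, y)) atBot (𝓝 0) ↔ _
  simp only [exp_linearization]
  constructor
  · intro h
    funext k
    rw [← sub_eq_zero]
    have hcomponent : Tendsto (fun t : ℝ => Real.exp t • unstableSlope M ξ k +
        Real.exp (-((k : ℝ) + 1) * t) • (y k - unstableSlope M ξ k)) atBot (𝓝 0) :=
      tendsto_pi_nhds.1 ((continuous_snd.tendsto (0 : E × ∀ k, Y k)).comp h) k
    have hdifference := hcomponent.sub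
      (Real.tendsto_exp_atBot.smul_const (unstableSlope M ξ k))
    simp only [add_sub_cancel_left, zero_smul, sub_zero] at hdifference
    refine eq_zero_of_tendsto_smul (l := atBot) ?_ hdifference
    filter_upwards [eventually_le_atBot 0] with t ht
    refine Real.one_le_exp (mul_nonneg_of_nonpos_of_nonpos ?_ ht)
    linarith [Nat.cast_nonneg (α := ℝ) (k : ℕ)]
  · rintro rfl
    rw [← Prod.mk_zero_zero]
    refine Tendsto.prodMk_nhds ?_ (tendsto_pi_nhds.2 fun k => ?_)
    · simpa using Real.tendsto_exp_atBot.smul_const ξ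
    · simpa using Real.tendsto_exp_atBot.smul_const (unstableSlope M ξ k)

theorem isCompl_linearization (M : E →L[ℝ] ∀ k, Y k) :
    IsCompl (stableSubspace (linearization M)) (unstableSubspace (linearization M)) := by
  constructor
  · rw [Submodule.disjoint_def]
    rintro ⟨ξ, y⟩ hstable hunstable
    obtain rfl := (mem_stableSubspace_linearization M ξ y).1 hstable
    obtain rfl := (mem_unstableSubspace_linearization M 0 y).1 hunstable
    rw [unstableSlope_zero, Prod.mk_zero_zero]
  · rw [Submodule.codisjoint_iff_exists_add_eq]
    rintro ⟨ξ, y⟩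
    exact ⟨(0, y - unstableSlope M ξ), (ξ, unstableSlope M ξ),
      (mem_stableSubspace_linearization M _ _).2 rfl,
      (mem_unstableSubspace_linearization M _ _).2 rfl, by simp⟩

theorem bijective_fst_unstableSubspace (M : E →L[ℝ] ∀ k, Y k) : Function.Bijective
    (fun v : unstableSubspace (linearization M) => (v : E × ∀ k, Y k).1) := by
  constructor
  · rintro ⟨⟨ξ, y⟩, h⟩ ⟨⟨ξ', y'⟩, h'⟩ (rfl : ξ = ξ')
    obtain rfl := (mem_unstableSubspace_linearization M _ _).1 h
    obtain rfl := (mem_unstableSubspace_linearization M _ _).1 h'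
    rfl
  · exact fun ξ => ⟨⟨(ξ, unstableSlope M ξ), (mem_unstableSubspace_linearization M _ _).2 rfl⟩, rfl⟩

end Hyperbolic

section FixedPoint

theorem exists_hasFDerivWithinAt_eulerField {ℓ : ℕ} {Y : Fin (ℓ + 1) → Type*}
    [∀ k, NormedAddCommGroup (Y k)] [∀ k, NormedSpace ℝ (Y k)] {X : Type*} [NormedAddCommGroup X]
    [NormedSpace ℝ X] {E : Type*} [NormedAddCommGroup E] [NormedSpace ℝ E]
    {J : E →L[ℝ] (∀ k, Y k) →L[ℝ] X} {f : X → ∀ k, Y k} {B : E → X} {N : Set E}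
    (hB : DifferentiableWithinAt ℝ B N 0) (hf : DifferentiableAt ℝ f (B 0)) (y : ∀ k, Y k)
    {T : Set (E × ∀ k, Y k)} (hT : ∀ p ∈ T, p.1 ∈ N) :
    ∃ M : E →L[ℝ] ∀ k, Y k, HasFDerivWithinAt
      (fun p : E × ∀ k, Y k => (p.1, eulerField J f B p.1 p.2)) (linearization M) T (0, y) := by
  refine ⟨(fderiv ℝ f (B 0)).comp (fderivWithin ℝ B N 0 + J.flip y), ?_⟩
  have hfst : HasFDerivWithinAt (Prod.fst : E × (∀ k, Y k) → E) (.fst ℝ E _) T (0, y) :=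
    hasFDerivWithinAt_fst
  have hbase : HasFDerivWithinAt (fun p : E × ∀ k, Y k => B p.1)
      ((fderivWithin ℝ B N 0).comp (.fst ℝ E _)) T (0, y) :=
    HasFDerivWithinAt.comp (f := Prod.fst) (g := B) (x := ((0, y) : E × ∀ k, Y k))
      hB.hasFDerivWithinAt hfst hT
  have hJ : HasFDerivWithinAt (fun p : E × ∀ k, Y k => J p.1) (J.comp (.fst ℝ E _)) T (0, y) :=
    (J.comp (.fst ℝ E (∀ k, Y k))).hasFDerivWithinAt
  have hcontract : HasFDerivWithinAt (fun p : E × ∀ k, Y k => J p.1 p.2)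
      ((J 0).comp (.snd ℝ E _) + (J.comp (.fst ℝ E _)).flip y) T (0, y) :=
    hJ.clm_apply hasFDerivWithinAt_snd
  have houter : HasFDerivAt f (fderiv ℝ f (B 0)) (B 0 + J 0 y) := by
    simpa using hf.hasFDerivAt
  have hvertical : HasFDerivWithinAt (fun p : E × ∀ k, Y k => f (B p.1 + J p.1 p.2)) _ T (0, y) :=
    HasFDerivAt.comp_hasFDerivWithinAt (f := fun p : E × ∀ k, Y k => B p.1 + J p.1 p.2)
      (0, y) houter (hbase.add hcontract)
  have hlift : HasFDerivWithinAt (fun p : E × ∀ k, Y k => negDegree Y p.2)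
      ((negDegree Y).comp (.snd ℝ E _)) T (0, y) :=
    ((negDegree Y).comp (.snd ℝ E (∀ k, Y k))).hasFDerivWithinAt
  refine (hfst.prodMk (hlift.add hvertical)).congr_fderiv ?_
  ext v k <;> simp [linearization]

variable {n ℓ : ℕ} {W : Fin (ℓ + 1) → Type*} [∀ k, NormedAddCommGroup (W k)]
  [∀ k, NormedSpace ℝ (W k)] [∀ k, FiniteDimensional ℝ (W k)] {U : TopologicalSpace.Opens (W 0)}

theorem hatE_eq_zero_iff (Q : Differential W U) {B : Euc n → Fiber W n 0}
    {p : Euc n × Fiber W n 1} : hatE Q B p = 0 ↔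
      p.1 = 0 ∧ ∀ k : Fin (ℓ + 1), p.2 k = ((k : ℝ) + 1)⁻¹ • FQ Q (B 0) k := by
  obtain ⟨x, y⟩ := p
  rw [hatE, Prod.mk_eq_zero]
  refine and_congr_right fun hx => ?_
  obtain rfl : x = 0 := hx
  rw [← contraction_apply, map_zero, _root_.zero_apply, add_zero, funext_iff]
  refine forall_congr' fun k => ?_
  have hk : (k : ℝ) + 1 ≠ 0 := by positivity
  rw [Pi.add_apply, Pi.zero_apply, neg_smul, neg_add_eq_zero, eq_inv_smul_iff₀ hk]

theorem isHyperbolicFixedPoint (Q : Differential W U) {N : Set (Euc n)} (h0 : (0 : Euc n) ∈ N)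
    {B : Euc n → Fiber W n 0} (hB : DifferentiableWithinAt ℝ B N 0) (hB0 : zeroPart (B 0) ∈ U)
    {P : Euc n × Fiber W n 1} (hbase : P.1 = 0)
    (hvertical : ∀ k : Fin (ℓ + 1), P.2 k = ((k : ℝ) + 1)⁻¹ • FQ Q (B 0) k) :
    IsHyperbolicFixedPoint Q N B P := by
  have hcomplete : ∀ k, CompleteSpace (W k) := fun k => FiniteDimensional.complete ℝ (W k)
  obtain ⟨P₁, y⟩ := P
  obtain rfl : P₁ = 0 := hbase
  have hf : DifferentiableAt ℝ (FQ Q : Fiber W n 0 → Fiber W n 1) (B 0) :=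
    ((contDiffOn_FQ Q).differentiableOn (by simp)).differentiableAt
      ((isOpen_setOf_zeroPart_mem U).mem_nhds hB0)
  obtain ⟨M, hM⟩ := exists_hasFDerivWithinAt_eulerField (Y := Comp W n) (J := contraction W n) hB
    hf y (T := hatDomain U N B) (fun p hp => hp.1)
  refine ⟨rfl, ⟨h0, ?_⟩, fun p _ => ?_, linearization M, hM, isCompl_linearization M, ?_,
    fun y => ?_, bijective_fst_unstableSubspace M, ?_⟩
  · rwa [← contraction_apply, map_zero, _root_.zero_apply, add_zero]
  · rw [hatE_eq_zero_iff, Prod.ext_iff, funext_iff]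
    simp only [← hvertical]
  · ext ⟨ξ, z⟩
    rw [mem_stableSubspace_linearization]
    rfl
  · rw [linearization_apply, map_zero, zero_add]
    rfl
  · rintro ⟨ξ, z⟩ h
    obtain rfl := (mem_unstableSubspace_linearization M ξ z).1 h
    exact linearization_unstableSlope M ξ

end FixedPoint

/-! ### The greatest solution and the unstable manifold -/

section ExponentialTime

variable {V : Type*} [NormedAddCommGroup V] [NormedSpace ℝ V]

theorem hasDerivWithinAt_exp_smul (x : V) (s : ℝ) (T : Set ℝ) :
    HasDerivWithinAt (fun s : ℝ => Real.exp s • x) (Real.exp s • x) T s :=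
  ((Real.hasDerivAt_exp s).smul_const x).hasDerivWithinAt

theorem eq_exp_smul_of_hasDerivWithinAt {g : ℝ → V}
    (h : ∀ s ≤ 0, HasDerivWithinAt g (g s) (Iic 0) s) {s : ℝ} (hs : s ≤ 0) :
    g s = Real.exp s • g 0 := by
  have hconst : ∀ s ∈ Iic (0 : ℝ),
      HasDerivWithinAt (fun s => Real.exp (-s) • g s) 0 (Iic 0) s := fun s hs =>
    ((hasDerivAt_neg s).exp.hasDerivWithinAt.fun_smul (h s hs)).congr_deriv (by simp)
  have heq := (convex_Iic (0 : ℝ)).norm_image_sub_le_of_norm_hasDerivWithin_le (C := 0) hconst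
    (fun s _ => by simp) (mem_Iic.2 le_rfl) (mem_Iic.2 hs)
  rw [zero_mul, norm_le_zero_iff, sub_eq_zero, neg_zero, Real.exp_zero, one_smul] at heq
  rw [← heq, smul_smul, ← Real.exp_add, add_neg_cancel, Real.exp_zero, one_smul]

theorem continuousOn_ite_comp_log {V : Type*} [TopologicalSpace V] {g : ℝ → V} {y : V}
    (hg : ContinuousOn g (Iic 0)) (hy : Tendsto g atBot (𝓝 y)) :
    ContinuousOn (fun t : ℝ => if t ≤ 0 then y else g (Real.log t)) (Icc 0 1) := by
  intro t ht
  rcases eq_or_lt_of_le ht.1 with rfl | ht0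
  · rw [← Set.Ioc_insert_left zero_le_one, continuousWithinAt_insert_self]
    have hlim : Tendsto (fun t => g (Real.log t)) (𝓝[Ioc 0 1] 0) (𝓝 y) :=
      hy.comp (Real.tendsto_log_nhdsGT_zero.mono_left (nhdsWithin_mono _ fun t ht => ht.1))
    rw [ContinuousWithinAt, if_pos le_rfl]
    refine hlim.congr' ?_
    filter_upwards [self_mem_nhdsWithin] with t ht
    rw [if_neg (not_le.2 ht.1)]
  · have hlog : ContinuousWithinAt (fun t => g (Real.log t)) (Icc 0 1 ∩ Ioi 0) t :=
      ContinuousWithinAt.comp (t := Iic 0) (hg _ (Real.log_nonpos ht.1 ht.2))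
        (Real.continuousAt_log ht0.ne').continuousWithinAt
        fun s hs => Real.log_nonpos hs.1.1 hs.1.2
    rw [← continuousWithinAt_inter (Ioi_mem_nhds ht0)]
    exact hlog.congr (fun s hs => if_neg (not_le.2 hs.2)) (if_neg (not_le.2 ht0))

end ExponentialTime

section Solution

variable {n ℓ : ℕ} {W : Fin (ℓ + 1) → Type*} [∀ k, NormedAddCommGroup (W k)]
  [∀ k, NormedSpace ℝ (W k)] [∀ k, FiniteDimensional ℝ (W k)] {U : TopologicalSpace.Opens (W 0)}
  {Q : Differential W U} {N : Set (Euc n)} {ρ : ℕ∞} {B : Euc n → Fiber W n 0}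

/-- The domain of the greatest solution of `ℒ_E a = F_Q(B + i_E a)`: the points such that the
equation can be solved along the whole ray from `0` to the point. -/
def greatestDomain (Q : Differential W U) (N : Set (Euc n)) (B : Euc n → Fiber W n 0) :
    Set (Euc n) :=
  rayDomain (Y := Comp W n) (contraction W n) (FQ Q) {α | zeroPart α ∈ U} B N

/-- The greatest solution of `ℒ_E a = F_Q(B + i_E a)`, to be considered on
`greatestDomain Q N B`. -/
def greatestSolution (Q : Differential W U) (B : Euc n → Fiber W n 0) : Euc n → Fiber W n 1 :=
  eulerSolution (Y := Comp W n) (contraction W n) (FQ Q) {α | zeroPart α ∈ U} B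

theorem greatestDomain_subset : greatestDomain Q N B ⊆ N := fun _ hx => hx.1

theorem contDiffOn_one_FQ (Q : Differential W U) :
    ContDiffOn ℝ 1 (FQ Q : Fiber W n 0 → Fiber W n 1) {α | zeroPart α ∈ U} :=
  (contDiffOn_FQ Q).of_le (by simp)

namespace IsSolution

variable {N' : Set (Euc n)} {a : Euc n → Fiber W n 1} (h : IsSolution Q N ρ B N' a)
include h

theorem subset : N' ⊆ N := by
  obtain ⟨O, -, rfl⟩ := h.isOpen
  exact inter_subset_left

theorem hasFDerivWithinAt (hρ : 1 ≤ ρ) {x : Euc n} (hx : x ∈ N') :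
    HasFDerivWithinAt a (fderivWithin ℝ a N' x) N' x :=
  (h.contDiffOn.differentiableOn (by exact_mod_cast (zero_lt_one.trans_le hρ).ne') x
    hx).hasFDerivWithinAt

theorem exp_smul_mem {x : Euc n} (hx : x ∈ N') {s : ℝ} (hs : s ≤ 0) : Real.exp s • x ∈ N' :=
  h.starConvex.smul_mem hx (exp_mem_unitInterval hs).1 (exp_mem_unitInterval hs).2

theorem hasDerivWithinAt_exp_smul (hρ : 1 ≤ ρ) {x : Euc n} (hx : x ∈ N') {s : ℝ} (hs : s ≤ 0) :
    HasDerivWithinAt (fun s : ℝ => a (Real.exp s • x))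
      (fderivWithin ℝ a N' (Real.exp s • x) (Real.exp s • x)) (Iic 0) s :=
  (h.hasFDerivWithinAt hρ (h.exp_smul_mem hx hs)).comp_hasDerivWithinAt s
    (Kuranishi.hasDerivWithinAt_exp_smul x s (Iic 0)) fun _ hs => h.exp_smul_mem hx hs

theorem fderivWithin_apply_self (hρ : 1 ≤ ρ) {x : Euc n} (hx : x ∈ N') :
    fderivWithin ℝ a N' x x =
      eulerField (Y := Comp W n) (contraction W n) (FQ Q) B x (a x) := by
  have hderiv := h.hasDerivWithinAt_exp_smul hρ hx le_rfl
  rw [Real.exp_zero, one_smul] at hderiv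
  have heqn := h.eqn x hx
  rw [lieW_eq_add_of_hasDerivWithinAt hderiv] at heqn
  funext k
  rw [eulerField, contraction_apply, ← heqn]
  simp only [Pi.add_apply, neg_smul, neg_add_cancel_left]

theorem mem_unstableManifold (hρ : 1 ≤ ρ) {x : Euc n} (hx : x ∈ N') :
    (x, a x) ∈ unstableManifold (hatE Q B) (hatDomain U N B) (0, a 0) := by
  refine ⟨fun s => (Real.exp s • x, a (Real.exp s • x)), by simp, fun s hs => ⟨⟨?_, ?_⟩, ?_⟩, ?_⟩
  · exact h.subset (h.exp_smul_mem hx hs)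
  · exact h.mem _ (h.exp_smul_mem hx hs)
  · refine (Kuranishi.hasDerivWithinAt_exp_smul x s _).prodMk ?_
    exact (h.hasDerivWithinAt_exp_smul hρ hx hs).congr_deriv
      (h.fderivWithin_apply_self hρ (h.exp_smul_mem hx hs))
  · have hbase : Tendsto (fun s : ℝ => Real.exp s • x) atBot (𝓝 0) := by
      simpa using Real.tendsto_exp_atBot.smul_const x
    have hbase' : Tendsto (fun s : ℝ => Real.exp s • x) atBot (𝓝[N'] 0) :=
      tendsto_nhdsWithin_iff.2
        ⟨hbase, (eventually_le_atBot 0).mono fun _ hs => h.exp_smul_mem hx hs⟩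
    exact hbase.prodMk_nhds ((h.contDiffOn.continuousOn 0 h.zero_mem).tendsto.comp hbase')

theorem hasDerivAt_smul (hρ : 1 ≤ ρ) {x : Euc n} (hx : x ∈ N') {t : ℝ} (ht : t ∈ Ioo (0 : ℝ) 1) :
    HasDerivAt (fun t : ℝ => a (t • x)) (fderivWithin ℝ a N' (t • x) x) t := by
  have hmem : ∀ s ∈ Icc (0 : ℝ) 1, s • x ∈ N' := fun s hs => h.starConvex.smul_mem hx hs.1 hs.2
  have hray : HasDerivWithinAt (fun t : ℝ => t • x) x (Icc 0 1) t := by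
    simpa using ((hasDerivAt_id t).smul_const x).hasDerivWithinAt (s := Icc 0 1)
  exact ((h.hasFDerivWithinAt hρ (hmem t ⟨ht.1.le, ht.2.le⟩)).comp_hasDerivWithinAt t hray
    hmem).hasDerivAt (Icc_mem_nhds ht.1 ht.2)

theorem eq_greatestSolution (hρ : 1 ≤ ρ) (hstar : StarConvex ℝ 0 N) (hB : ContinuousOn B N)
    {x : Euc n} (hx : x ∈ N') : x ∈ greatestDomain Q N B ∧ a x = greatestSolution Q B x := by
  have hcomplete : ∀ k, CompleteSpace (W k) := fun k => FiniteDimensional.complete ℝ (W k)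
  have hmem := ray_mem h.starConvex hx
  set v : C(I, ∀ k, Comp W n k) := nemytskii a (ray (Euc n) x)
  have hv : ∀ t : I, v t = a ((t : ℝ) • x) := nemytskii_apply h.contDiffOn.continuousOn hmem
  have hextend : ∀ t ∈ Icc (0 : ℝ) 1, extend v t = a (t • x) := fun t ht =>
    (extend_coe v ⟨t, ht⟩).trans (hv ⟨t, ht⟩)
  have hadmissible : ∀ t : I, B ((t : ℝ) • x) + (t : ℝ) • contraction W n x (v t) ∈
      {α | zeroPart α ∈ U} := fun t => by
    simpa [hv, ← contraction_apply] using h.mem _ (hmem t)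
  have hderiv : ∀ t ∈ Ioo (0 : ℝ) 1, ∃ d, HasDerivAt (extend v) d t ∧
      t • d = eulerField (contraction W n) (FQ Q) B (t • x) (extend v t) := fun t ht => by
    have htI : t ∈ Icc (0 : ℝ) 1 := ⟨ht.1.le, ht.2.le⟩
    refine ⟨fderivWithin ℝ a N' (t • x) x, (h.hasDerivAt_smul hρ hx ht).congr_of_eventuallyEq ?_,
      ?_⟩
    · exact eventually_of_mem (Icc_mem_nhds ht.1 ht.2) hextend
    · rw [← map_smul, hextend t htI,
        h.fderivWithin_apply_self hρ (h.starConvex.smul_mem hx htI.1 htI.2)]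
  obtain ⟨hdomain, heq⟩ := eulerSolution_eq_of_hasDerivAt (isOpen_setOf_zeroPart_mem U)
    (contDiffOn_one_FQ Q) hstar hB (h.subset hx) hadmissible hderiv
  refine ⟨hdomain, ?_⟩
  rw [greatestSolution, heq, hv]
  simp

end IsSolution

section IntegralCurve

variable {γ : ℝ → Euc n × Fiber W n 1}
  (hγ : ∀ s ≤ 0, γ s ∈ hatDomain U N B ∧ HasDerivWithinAt γ (hatE Q B (γ s)) (Iic 0) s)
include hγ

theorem fst_integralCurve_hatE {s : ℝ} (hs : s ≤ 0) : (γ s).1 = Real.exp s • (γ 0).1 :=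
  eq_exp_smul_of_hasDerivWithinAt (g := fun s => (γ s).1) (fun s hs => by
    have hfst := (ContinuousLinearMap.fst ℝ (Euc n) (Fiber W n 1)).hasFDerivAt
      |>.comp_hasDerivWithinAt s (hγ s hs).2
    exact hfst) hs

theorem hasDerivWithinAt_snd_integralCurve_hatE {s : ℝ} (hs : s ≤ 0) :
    HasDerivWithinAt (fun s => (γ s).2) (hatE Q B (γ s)).2 (Iic 0) s :=
  (ContinuousLinearMap.snd ℝ (Euc n) (Fiber W n 1)).hasFDerivAt.comp_hasDerivWithinAt s
    (hγ s hs).2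

theorem fst_integralCurve_hatE_log {t : ℝ} (ht : t ∈ Ioc (0 : ℝ) 1) :
    (γ (Real.log t)).1 = t • (γ 0).1 := by
  rw [fst_integralCurve_hatE hγ (Real.log_nonpos ht.1.le ht.2), Real.exp_log ht.1]

theorem hasDerivAt_snd_integralCurve_hatE_log {t : ℝ} (ht : t ∈ Ioo (0 : ℝ) 1) :
    HasDerivAt (fun t => (γ (Real.log t)).2) (t⁻¹ • eulerField (Y := Comp W n) (contraction W n)
      (FQ Q) B (t • (γ 0).1) (γ (Real.log t)).2) t := by
  have hlog : Real.log t < 0 := Real.log_neg ht.1 ht.2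
  have hderiv := ((hasDerivWithinAt_snd_integralCurve_hatE hγ hlog.le).hasDerivAt
    (Iic_mem_nhds hlog)).scomp t (Real.hasDerivAt_log ht.1.ne')
  rw [← fst_integralCurve_hatE_log hγ ⟨ht.1, ht.2.le⟩]
  exact hderiv

end IntegralCurve

theorem eq_greatestSolution_of_mem_unstableManifold (hstar : StarConvex ℝ 0 N)
    (hB : ContinuousOn B N) (hB0 : zeroPart (B 0) ∈ U) {y : Fiber W n 1}
    {p : Euc n × Fiber W n 1}
    (hp : p ∈ unstableManifold (hatE Q B) (hatDomain U N B) (0, y)) :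
    p.1 ∈ greatestDomain Q N B ∧ greatestSolution Q B p.1 = p.2 := by
  have hcomplete : ∀ k, CompleteSpace (W k) := fun k => FiniteDimensional.complete ℝ (W k)
  obtain ⟨γ, rfl, hγ, hlim⟩ := hp
  have hcont := continuousOn_ite_comp_log (g := fun s => (γ s).2)
    (fun s hs => (hasDerivWithinAt_snd_integralCurve_hatE hγ hs).continuousWithinAt)
    ((continuous_snd.tendsto _).comp hlim)
  set v : C(I, ∀ k, Comp W n k) := ⟨_, continuousOn_iff_continuous_domRestrict.1 hcont⟩
  have hv : ∀ t : I, 0 < (t : ℝ) → v t = (γ (Real.log t)).2 := fun t ht => if_neg (not_le.2 ht)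
  have hextend : ∀ t ∈ Ioc (0 : ℝ) 1, extend v t = (γ (Real.log t)).2 := fun t ht =>
    (extend_coe v ⟨t, ht.1.le, ht.2⟩).trans (hv _ ht.1)
  have hadmissible : ∀ t : I, B ((t : ℝ) • (γ 0).1) + (t : ℝ) • contraction W n (γ 0).1 (v t) ∈
      {α | zeroPart α ∈ U} := fun t => by
    rcases eq_or_lt_of_le t.2.1 with ht | ht
    · simpa [← ht] using hB0
    · have hmem := (hγ _ (Real.log_nonpos ht.le t.2.2)).1.2
      rw [fst_integralCurve_hatE_log hγ ⟨ht, t.2.2⟩, ← hv t ht, ← contraction_apply,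
        map_smul] at hmem
      exact hmem
  have hderiv : ∀ t ∈ Ioo (0 : ℝ) 1, ∃ d, HasDerivAt (extend v) d t ∧ t • d =
      eulerField (contraction W n) (FQ Q) B (t • (γ 0).1) (extend v t) := fun t ht => by
    refine ⟨_, (hasDerivAt_snd_integralCurve_hatE_log hγ ht).congr_of_eventuallyEq
      (eventually_of_mem (Ioc_mem_nhds ht.1 ht.2) hextend), ?_⟩
    rw [smul_inv_smul₀ ht.1.ne', hextend t ⟨ht.1, ht.2.le⟩]
  obtain ⟨hdomain, heq⟩ := eulerSolution_eq_of_hasDerivAt (isOpen_setOf_zeroPart_mem U)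
    (contDiffOn_one_FQ Q) hstar hB (hγ 0 le_rfl).1.1 hadmissible hderiv
  refine ⟨hdomain, ?_⟩
  rw [greatestSolution, heq, hv 1 zero_lt_one]
  simp

theorem kappa_eq (hstar : StarConvex ℝ 0 N) {A : Euc n → Fiber W n 0} (hA : ContinuousOn A N)
    (hAU : ∀ x ∈ N, zeroPart (A x) ∈ U) {x : Euc n} (hx : x ∈ N) :
    kappa Q A x = A x - contraction W n x
      (average (Comp W n) (nemytskii (fun y => FQ Q (A y)) (ray (Euc n) x)) 1) := by
  have hcomplete : ∀ k, CompleteSpace (W k) := fun k => FiniteDimensional.complete ℝ (W k)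
  have hFQ : ContinuousOn (fun y => FQ Q (A y)) N := (contDiffOn_FQ Q).continuousOn.comp hA hAU
  rw [kappa, hW_eq_contraction_average hstar hFQ hx]

theorem IsPreimage.eq_add_greatestSolution (hstar : StarConvex ℝ 0 N) {A : Euc n → Fiber W n 0}
    (hA : IsPreimage Q N ρ B A) {x : Euc n} (hx : x ∈ N) :
    x ∈ greatestDomain Q N B ∧ A x = B x + iE x (greatestSolution Q B x) := by
  refine eq_add_eulerSolution_of_integral_eq (isOpen_setOf_zeroPart_mem U) (contDiffOn_one_FQ Q)
    hstar hA.contDiffOn.continuousOn hA.mem (fun x hx => ?_) hx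
  rw [hA.eqn x hx, kappa_eq hstar hA.contDiffOn.continuousOn hA.mem hx, sub_add_cancel]

theorem isHyperbolicFixedPoint_greatestSolution (h0 : (0 : Euc n) ∈ N)
    (hB : DifferentiableWithinAt ℝ B N 0) (hB0 : zeroPart (B 0) ∈ U) :
    IsHyperbolicFixedPoint Q N B (0, greatestSolution Q B 0) := by
  have hcomplete : ∀ k, CompleteSpace (W k) := fun k => FiniteDimensional.complete ℝ (W k)
  exact isHyperbolicFixedPoint Q h0 hB hB0 rfl
    (eulerSolution_zero (isOpen_setOf_zeroPart_mem U) (contDiffOn_one_FQ Q) hB0)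

end Solution

section GreatestSolution

universe u

variable {n ℓ : ℕ} {W : Fin (ℓ + 1) → Type u} [∀ k, NormedAddCommGroup (W k)]
  [∀ k, NormedSpace ℝ (W k)] [∀ k, FiniteDimensional ℝ (W k)] {U : TopologicalSpace.Opens (W 0)}
  {Q : Differential W U} {N : Set (Euc n)} {ρ : ℕ∞} {B : Euc n → Fiber W n 0}

theorem isSolution_greatestSolution (Q : Differential W U) (hq : LocallyQuasiconvex N)
    (hu : UniqueDiffOn ℝ N) (h0 : (0 : Euc n) ∈ N) (hstar : StarConvex ℝ 0 N)
    (hB : ContDiffOn ℝ ρ B N) (hB0 : zeroPart (B 0) ∈ U) :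
    IsSolution Q N ρ B (greatestDomain Q N B) (greatestSolution Q B) := by
  have hcomplete : ∀ k, CompleteSpace (W k) := fun k => FiniteDimensional.complete ℝ (W k)
  have hopen := isOpen_setOf_zeroPart_mem (n := n) U
  have hFQ := contDiffOn_one_FQ (n := n) Q
  refine ⟨zero_mem_rayDomain h0 hB0, starConvex_rayDomain hFQ.continuousOn hstar,
    exists_isOpen_rayDomain_eq _ hopen (contDiffOn_FQ Q) hq hu hstar hB.continuousOn,
    contDiffOn_eulerSolution _ hopen (contDiffOn_FQ Q) hq hu hstar hB,
    fun x hx => add_eulerSolution_mem hopen hFQ hx, fun x hx => ?_⟩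
  have hderiv := hasDerivWithinAt_eulerSolution hopen hFQ hx le_rfl
  rw [Real.exp_zero, one_smul] at hderiv
  rw [greatestSolution, lieW_eq_add_of_hasDerivWithinAt hderiv]
  funext k
  simp only [eulerField, Pi.add_apply, neg_smul, contraction_apply, add_neg_cancel_left]

theorem image_greatestSolution_eq_unstableManifold (Q : Differential W U)
    (hq : LocallyQuasiconvex N) (hu : UniqueDiffOn ℝ N) (h0 : (0 : Euc n) ∈ N)
    (hstar : StarConvex ℝ 0 N) (hρ : 1 ≤ ρ) (hB : ContDiffOn ℝ ρ B N)
    (hB0 : zeroPart (B 0) ∈ U) :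
    (fun x => (x, greatestSolution Q B x)) '' greatestDomain Q N B =
      unstableManifold (hatE Q B) (hatDomain U N B) (0, greatestSolution Q B 0) := by
  refine Subset.antisymm ?_ fun p hp => ?_
  · rintro _ ⟨x, hx, rfl⟩
    exact (isSolution_greatestSolution Q hq hu h0 hstar hB hB0).mem_unstableManifold hρ hx
  · obtain ⟨hdomain, heq⟩ :=
      eq_greatestSolution_of_mem_unstableManifold hstar hB.continuousOn hB0 hp
    exact ⟨p.1, hdomain, Prod.ext rfl heq⟩

theorem isPreimage_add_greatestSolution (Q : Differential W U) (hq : LocallyQuasiconvex N)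
    (hu : UniqueDiffOn ℝ N) (hstar : StarConvex ℝ 0 N) (hB : ContDiffOn ℝ ρ B N)
    (hN : greatestDomain Q N B = N) :
    IsPreimage Q N ρ B (fun x => B x + iE x (greatestSolution Q B x)) := by
  have hopen := isOpen_setOf_zeroPart_mem (n := n) U
  have hFQ := contDiffOn_one_FQ (n := n) Q
  have hcomplete : ∀ k, CompleteSpace (W k) := fun k => FiniteDimensional.complete ℝ (W k)
  have ha : ContDiffOn ℝ ρ (greatestSolution Q B) N := by
    have := contDiffOn_eulerSolution (contraction W n) hopen (contDiffOn_FQ Q) hq hu hstar hB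
    rwa [← greatestDomain, hN] at this
  have hA : ContDiffOn ℝ ρ (fun x => B x + iE x (greatestSolution Q B x)) N :=
    hB.add ((contraction W n).contDiff.contDiffOn.clm_apply ha)
  have hAU : ∀ x ∈ N, zeroPart (B x + iE x (greatestSolution Q B x)) ∈ U := fun x hx =>
    add_eulerSolution_mem (J := contraction W n) hopen hFQ (hN.ge hx)
  refine ⟨hA, hAU, fun x hx => ?_⟩
  have haverage := eulerSolution_eq_average (J := contraction W n) hopen hFQ hstar
    (hA.continuousOn.mono greatestDomain_subset) (hN.ge hx)
  simp only [contraction_apply] at haverage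
  rw [kappa_eq hstar hA.continuousOn hAU hx, greatestSolution, eq_sub_iff_add_eq, ← haverage,
    contraction_apply]

end GreatestSolution

/-! ### The Banach spaces `C^r(N, F)` -/

section CrMap

variable {n : ℕ} {N : Set (Euc n)} {r : ℕ} {F : Type*} [NormedAddCommGroup F] [NormedSpace ℝ F]

theorem JetSpace.norm_apply_le (J : JetSpace N r F) (i : Fin (r + 1)) (x : N) : ‖J i x‖ ≤ ‖J‖ :=
  (BoundedContinuousFunction.norm_coe_le_norm _ x).trans
    (norm_le_pi_norm (G := fun i : Fin (r + 1) =>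
      BoundedContinuousFunction N (Euc n [×(i : ℕ)]→L[ℝ] F)) J i)

theorem JetSpace.norm_le {J : JetSpace N r F} {C : ℝ} (hC : 0 ≤ C)
    (h : ∀ (i : Fin (r + 1)) (x : N), ‖J i x‖ ≤ C) : ‖J‖ ≤ C :=
  (pi_norm_le_iff_of_nonneg (G := fun i : Fin (r + 1) =>
      BoundedContinuousFunction N (Euc n [×(i : ℕ)]→L[ℝ] F)) hC).2 fun i =>
    (BoundedContinuousFunction.norm_le hC).2 (h i)

instance [CompleteSpace F] : CompleteSpace (JetSpace N r F) :=
  inferInstanceAs (CompleteSpace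
    (∀ i : Fin (r + 1), BoundedContinuousFunction N (Euc n [×(i : ℕ)]→L[ℝ] F)))

theorem ev_of_mem (A : CrMap N r F) {x : Euc n} (hx : x ∈ N) :
    ev A x = (A.1 0 ⟨x, hx⟩).curry0 := dif_pos hx

theorem norm_ev_le (A : CrMap N r F) {x : Euc n} (hx : x ∈ N) : ‖ev A x‖ ≤ ‖A‖ :=
  (congrArg norm (ev_of_mem A hx)).trans_le
    ((ContinuousMultilinearMap.curry0_norm _).le.trans (JetSpace.norm_apply_le A.1 0 _))

theorem ev_add (A B : CrMap N r F) {x : Euc n} (hx : x ∈ N) :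
    ev (A + B) x = ev A x + ev B x := by
  simp only [ev_of_mem _ hx]
  rfl

theorem ev_smul (c : ℝ) (A : CrMap N r F) {x : Euc n} (hx : x ∈ N) :
    ev (c • A) x = c • ev A x := by
  simp only [ev_of_mem _ hx]
  rfl

/-- Evaluation of `C^r` maps at a point of `N`, as a continuous linear map. -/
def evalCLM (r : ℕ) (F : Type*) [NormedAddCommGroup F] [NormedSpace ℝ F] {x : Euc n} (hx : x ∈ N) :
    CrMap N r F →L[ℝ] F :=
  LinearMap.mkContinuous
    { toFun := fun A => ev A x
      map_add' := fun A B => ev_add A B hx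
      map_smul' := fun c A => ev_smul c A hx } 1 fun A => by
    rw [one_mul]
    exact norm_ev_le A hx

theorem ev_sub (A B : CrMap N r F) {x : Euc n} (hx : x ∈ N) : ev (A - B) x = ev A x - ev B x :=
  map_sub (evalCLM r F hx) A B

theorem ev_zero {x : Euc n} (hx : x ∈ N) : ev (0 : CrMap N r F) x = 0 :=
  map_zero (evalCLM r F hx)

namespace CrMap

theorem exists_hasFTaylorSeriesUpToOn (A : CrMap N r F) :
    ∃ p : Euc n → FormalMultilinearSeries ℝ (Euc n) F, HasFTaylorSeriesUpToOn r (ev A) p N ∧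
      ∀ (i : Fin (r + 1)) (x : N), A.1 i x = p x i := by
  obtain ⟨p, hp, hA⟩ := A.2
  refine ⟨p, hp.congr fun x hx => ?_, hA⟩
  rw [ev_of_mem A hx, hA]
  rfl

theorem contDiffOn_ev (A : CrMap N r F) : ContDiffOn ℝ r (ev A) N := by
  obtain ⟨p, hp, -⟩ := exists_hasFTaylorSeriesUpToOn A
  exact HasFTaylorSeriesUpToOn.contDiffOn (n := (r : ℕ∞)) hp

theorem apply_eq_iteratedFDerivWithin (hu : UniqueDiffOn ℝ N) (A : CrMap N r F)
    (i : Fin (r + 1)) (x : N) : A.1 i x = iteratedFDerivWithin ℝ i (ev A) N x := by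
  obtain ⟨p, hp, hA⟩ := exists_hasFTaylorSeriesUpToOn A
  rw [hA]
  exact hp.eq_iteratedFDerivWithin_of_uniqueDiffOn
    (by exact_mod_cast Nat.lt_succ_iff.1 i.2) hu x.2

theorem ext_ev (hu : UniqueDiffOn ℝ N) {A B : CrMap N r F}
    (h : ∀ x ∈ N, ev A x = ev B x) : A = B := by
  refine Subtype.ext (funext fun i => BoundedContinuousFunction.ext fun x => ?_)
  rw [apply_eq_iteratedFDerivWithin hu A, apply_eq_iteratedFDerivWithin hu B]
  exact iteratedFDerivWithin_congr h x.2 i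

theorem norm_le_iff (hu : UniqueDiffOn ℝ N) {A : CrMap N r F} {C : ℝ} (hC : 0 ≤ C) :
    ‖A‖ ≤ C ↔ ∀ i ≤ r, ∀ x ∈ N, ‖iteratedFDerivWithin ℝ i (ev A) N x‖ ≤ C := by
  constructor
  · intro h i hi x hx
    rw [← apply_eq_iteratedFDerivWithin hu A ⟨i, Nat.lt_succ_of_le hi⟩ ⟨x, hx⟩]
    exact (JetSpace.norm_apply_le A.1 _ _).trans h
  · intro h
    refine JetSpace.norm_le (J := A.1) hC fun i x => ?_
    rw [apply_eq_iteratedFDerivWithin hu A]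
    exact h i (Nat.lt_succ_iff.1 i.2) x x.2

theorem norm_zero_order_le (hu : UniqueDiffOn ℝ N) {A : CrMap N 0 F} {C : ℝ} (hC : 0 ≤ C)
    (h : ∀ x ∈ N, ‖ev A x‖ ≤ C) : ‖A‖ ≤ C := by
  refine (norm_le_iff hu hC).2 fun i hi x hx => ?_
  obtain rfl : i = 0 := Nat.le_zero.1 hi
  rw [norm_iteratedFDerivWithin_zero]
  exact h x hx

theorem norm_succ_order_le (hu : UniqueDiffOn ℝ N) {A : CrMap N (r + 1) F}
    {A' : CrMap N r (Euc n →L[ℝ] F)} (hA' : ∀ x ∈ N, ev A' x = fderivWithin ℝ (ev A) N x)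
    {C : ℝ} (hC : ‖A'‖ ≤ C) (h : ∀ x ∈ N, ‖ev A x‖ ≤ C) : ‖A‖ ≤ C := by
  refine (norm_le_iff hu ((norm_nonneg _).trans hC)).2 fun i hi x hx => ?_
  cases i with
  | zero =>
    rw [norm_iteratedFDerivWithin_zero]
    exact h x hx
  | succ i =>
    rw [← norm_iteratedFDerivWithin_fderivWithin hu hx, ← iteratedFDerivWithin_congr hA' hx]
    exact (norm_le_iff hu ((norm_nonneg _).trans hC)).1 hC i (by omega) x hx

end CrMap

theorem hasFTaylorSeriesUpToOn_of_uniform_limit (hq : LocallyQuasiconvex N)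
    {f : ℕ → Euc n → F} {p : ℕ → Euc n → FormalMultilinearSeries ℝ (Euc n) F}
    {q : Euc n → FormalMultilinearSeries ℝ (Euc n) F}
    (hp : ∀ j, HasFTaylorSeriesUpToOn r (f j) (p j) N)
    (hpq : ∀ ε > 0, ∀ᶠ j in atTop, ∀ x ∈ N, ∀ i ≤ r, ‖p j x i - q x i‖ ≤ ε) :
    HasFTaylorSeriesUpToOn r (fun x => (q x 0).curry0) q N := by
  have hunif : ∀ i ≤ r, TendstoUniformlyOn (fun j x => p j x i) (fun x => q x i) atTop N := by
    intro i hi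
    refine Metric.tendstoUniformlyOn_iff.2 fun ε hε => ?_
    filter_upwards [hpq (ε / 2) (half_pos hε)] with j hj x hx
    rw [dist_comm, dist_eq_norm]
    exact (hj x hx i hi).trans_lt (half_lt_self hε)
  refine ⟨fun x _ => rfl, fun m hm x hx => ?_, fun m hm => ?_⟩
  · have hmr : m + 1 ≤ r := Nat.succ_le_of_lt (by exact_mod_cast hm)
    refine hq.hasFDerivWithinAt_of_tendsto (f := fun j x => p j x m)
      (f' := fun j x => (p j x m.succ).curryLeft) (g' := fun x => (q x m.succ).curryLeft)
      (fun j => (hp j).fderivWithin m hm)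
      (fun x hx => (hunif m (by omega)).tendsto_at hx) (fun ε hε => ?_) hx
    filter_upwards [hpq ε hε] with j hj x hx
    calc ‖(p j x m.succ).curryLeft - (q x m.succ).curryLeft‖
        = ‖(p j x m.succ - q x m.succ).curryLeft‖ := rfl
      _ ≤ ε := (ContinuousMultilinearMap.curryLeft_norm _).trans_le (hj x hx m.succ hmr)
  · exact (hunif m (by exact_mod_cast hm)).continuousOn
      (Frequently.of_forall fun j => (hp j).cont m hm)

theorem isClosed_crMap (hq : LocallyQuasiconvex N) :
    IsClosed (CrMap N r F : Set (JetSpace N r F)) := by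
  refine IsSeqClosed.isClosed fun J K hJ hlim => ?_
  choose p hp hJp using hJ
  classical
  let q : Euc n → FormalMultilinearSeries ℝ (Euc n) F := fun x i =>
    if h : x ∈ N ∧ i < r + 1 then K ⟨i, h.2⟩ ⟨x, h.1⟩ else 0
  have hqK : ∀ {x i} (hx : x ∈ N) (hi : i < r + 1), q x i = K ⟨i, hi⟩ ⟨x, hx⟩ :=
    fun hx hi => dif_pos ⟨hx, hi⟩
  refine ⟨q, hasFTaylorSeriesUpToOn_of_uniform_limit hq hp fun ε hε => ?_,
    fun i x => (hqK x.2 i.2).symm⟩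
  filter_upwards [hlim.eventually (closedBall_mem_nhds K hε)] with m hm x hx i hi
  have hir : i < r + 1 := Nat.lt_succ_of_le hi
  rw [hqK hx hir, ← hJp m ⟨i, hir⟩ ⟨x, hx⟩]
  exact (JetSpace.norm_apply_le (J m - K) _ _).trans (by rwa [← dist_eq_norm])

theorem completeSpace_crMap [CompleteSpace F] (hq : LocallyQuasiconvex N) :
    CompleteSpace (CrMap N r F) :=
  (isClosed_crMap hq).completeSpace_coe

section Compact

variable [CompactSpace N]

open Classical in
/-- The element of `C^r(N, F)` with the values of `f`, or `0` if `f` is not `C^r` on `N`. -/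
def crMk (N : Set (Euc n)) (r : ℕ) (f : Euc n → F) : CrMap N r F :=
  if h : ∃ A : CrMap N r F, ∀ x ∈ N, ev A x = f x then h.choose else 0

theorem exists_crMap_ev_eq (hu : UniqueDiffOn ℝ N) {f : Euc n → F} (hf : ContDiffOn ℝ r f N) :
    ∃ A : CrMap N r F, ∀ x ∈ N, ev A x = f x := by
  have hp := hf.ftaylorSeriesWithin hu
  have hcont : ∀ i : Fin (r + 1), Continuous fun x : N => ftaylorSeriesWithin ℝ f N x i :=
    fun i => continuousOn_iff_continuous_domRestrict.1
      (hp.cont i (by exact_mod_cast Nat.lt_succ_iff.1 i.2))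
  refine ⟨⟨fun i => BoundedContinuousFunction.mkOfCompact ⟨_, hcont i⟩,
    ftaylorSeriesWithin ℝ f N, hp.congr fun x hx => hp.zero_eq x hx, fun i x => rfl⟩,
    fun x hx => ?_⟩
  rw [ev_of_mem _ hx]
  exact hp.zero_eq x hx

theorem ev_crMk (hu : UniqueDiffOn ℝ N) {f : Euc n → F} (hf : ContDiffOn ℝ r f N) {x : Euc n}
    (hx : x ∈ N) : ev (crMk N r f) x = f x := by
  have hex := exists_crMap_ev_eq hu hf
  rw [crMk, dif_pos hex]
  exact hex.choose_spec x hx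

/-- The continuous map on `N` underlying a `C^r` map, as a continuous linear operation. -/
def toContinuousMapCLM (N : Set (Euc n)) [CompactSpace N] (r : ℕ) (F : Type*)
    [NormedAddCommGroup F] [NormedSpace ℝ F] : CrMap N r F →L[ℝ] C(N, F) :=
  LinearMap.mkContinuous
    { toFun := fun A => ⟨fun x => ev A x, continuousOn_iff_continuous_domRestrict.1
        (CrMap.contDiffOn_ev A).continuousOn⟩
      map_add' := fun A B => ContinuousMap.ext fun x => ev_add A B x.2
      map_smul' := fun c A => ContinuousMap.ext fun x => ev_smul c A x.2 } 1
    fun A => by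
      rw [one_mul]
      exact (ContinuousMap.norm_le _ (norm_nonneg _)).2 fun x => norm_ev_le A x.2

theorem norm_ev_le_norm_toContinuousMapCLM (A : CrMap N r F) {x : Euc n} (hx : x ∈ N) :
    ‖ev A x‖ ≤ ‖toContinuousMapCLM N r F A‖ :=
  (toContinuousMapCLM N r F A).norm_coe_le_norm ⟨x, hx⟩

end Compact

end CrMap

/-! ### Operators on `C^r(N, F)` -/

section Operators

/-- The closed graph theorem, for a graph cut out by a separating family `φ`. -/
theorem exists_continuousLinearMap_eq_of_separating {ι 𝕜 Z V G : Type*}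
    [NontriviallyNormedField 𝕜] [NormedAddCommGroup Z] [NormedSpace 𝕜 Z] [CompleteSpace Z]
    [NormedAddCommGroup V] [NormedSpace 𝕜 V] [CompleteSpace V] [NormedAddCommGroup G]
    [NormedSpace 𝕜 G] (φ : ι → V →L[𝕜] G) (hφ : ∀ v w, (∀ i, φ i v = φ i w) → v = w)
    (T : Z → V) (L : ι → Z →L[𝕜] G) (hL : ∀ i z, φ i (T z) = L i z) :
    ∃ S : Z →L[𝕜] V, ∀ z, S z = T z := by
  let T₀ : Z →ₗ[𝕜] V :=
    { toFun := T
      map_add' := fun z z' => hφ _ _ fun i => by rw [map_add, hL, hL, hL, map_add]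
      map_smul' := fun c z => hφ _ _ fun i => by
        rw [RingHom.id_apply, map_smul, hL, hL, map_smul] }
  have hcont : Continuous T₀ := by
    refine LinearMap.continuous_of_seq_closed_graph T₀ fun u z v hu hv => hφ _ _ fun i => ?_
    have hlim_v : Tendsto (fun m => L i (u m)) atTop (𝓝 (φ i v)) :=
      (((φ i).continuous.tendsto v).comp hv).congr fun m => hL i (u m)
    have hlim_z : Tendsto (fun m => L i (u m)) atTop (𝓝 (L i z)) :=
      ((L i).continuous.tendsto z).comp hu
    rw [tendsto_nhds_unique hlim_v hlim_z]
    exact (hL i z).symm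
  exact ⟨⟨T₀, hcont⟩, fun z => rfl⟩

variable {n : ℕ} {N : Set (Euc n)} {r : ℕ} {F G H : Type*} [NormedAddCommGroup F]
  [NormedSpace ℝ F] [NormedAddCommGroup G] [NormedSpace ℝ G] [NormedAddCommGroup H]
  [NormedSpace ℝ H] [CompactSpace N]

theorem exists_clm_crMap [CompleteSpace G] (hq : LocallyQuasiconvex N) (hu : UniqueDiffOn ℝ N)
    {Z : Type*} [NormedAddCommGroup Z] [NormedSpace ℝ Z] [CompleteSpace Z]
    (T : Z → Euc n → G) (hT : ∀ z, ContDiffOn ℝ r (T z) N)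
    (hL : ∀ x ∈ N, ∃ L : Z →L[ℝ] G, ∀ z, T z x = L z) :
    ∃ L : Z →L[ℝ] CrMap N r G, ∀ z, ∀ x ∈ N, ev (L z) x = T z x := by
  have hcomplete : CompleteSpace (CrMap N r G) := completeSpace_crMap hq
  choose L hL using hL
  obtain ⟨S, hS⟩ := exists_continuousLinearMap_eq_of_separating
    (fun x : N => evalCLM r G x.2) (fun A B h => CrMap.ext_ev hu fun x hx => h ⟨x, hx⟩)
    (fun z => crMk N r (T z)) (fun x => L x x.2)
    (fun x z => (ev_crMk hu (hT z) x.2).trans (hL x x.2 z))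
  exact ⟨S, fun z x hx => by rw [hS, ev_crMk hu (hT z) hx]⟩

theorem exists_bilinear_crMap [CompleteSpace F] [CompleteSpace G] [CompleteSpace H]
    (hq : LocallyQuasiconvex N) (hu : UniqueDiffOn ℝ N) (b : F →L[ℝ] G →L[ℝ] H) :
    ∃ L : CrMap N r F →L[ℝ] CrMap N r G →L[ℝ] CrMap N r H,
      ∀ A B, ∀ x ∈ N, ev (L A B) x = b (ev A x) (ev B x) := by
  have hcompleteF : CompleteSpace (CrMap N r F) := completeSpace_crMap hq
  have hcompleteG : CompleteSpace (CrMap N r G) := completeSpace_crMap hq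
  have hcompleteH : CompleteSpace (CrMap N r H) := completeSpace_crMap hq
  have hpartial : ∀ A : CrMap N r F, ∃ L : CrMap N r G →L[ℝ] CrMap N r H,
      ∀ B, ∀ x ∈ N, ev (L B) x = b (ev A x) (ev B x) := fun A =>
    exists_clm_crMap hq hu (fun B x => b (ev A x) (ev B x))
      (fun B => (b.contDiff.comp_contDiffOn (CrMap.contDiffOn_ev A)).clm_apply
        (CrMap.contDiffOn_ev B))
      (fun x hx => ⟨(b (ev A x)).comp (evalCLM r G hx), fun B => rfl⟩)
  choose M hM using hpartial
  obtain ⟨S, hS⟩ := exists_continuousLinearMap_eq_of_separating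
    (fun p : CrMap N r G × N => (evalCLM r H p.2.2).comp (ContinuousLinearMap.apply ℝ _ p.1))
    (fun L L' h => ContinuousLinearMap.ext fun B => CrMap.ext_ev hu fun x hx => h (B, ⟨x, hx⟩))
    M (fun p => (b.flip (ev p.1 p.2)).comp (evalCLM r F p.2.2)) (fun p A => hM A p.1 p.2 p.2.2)
  exact ⟨S, fun A B x hx => by rw [hS, hM A B x hx]⟩

theorem exists_fderivWithin_crMap [CompleteSpace F] (hq : LocallyQuasiconvex N)
    (hu : UniqueDiffOn ℝ N) : ∃ L : CrMap N (r + 1) F →L[ℝ] CrMap N r (Euc n →L[ℝ] F),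
      ∀ A, ∀ x ∈ N, ev (L A) x = fderivWithin ℝ (ev A) N x := by
  have hcomplete : CompleteSpace (CrMap N (r + 1) F) := completeSpace_crMap hq
  refine exists_clm_crMap hq hu (fun A => fderivWithin ℝ (ev A) N)
    (fun A => (CrMap.contDiffOn_ev A).fderivWithin hu (by simp)) fun x hx => ?_
  let firstJet : CrMap N (r + 1) F →L[ℝ] Euc n [×1]→L[ℝ] F :=
    LinearMap.mkContinuous
      { toFun := fun A => A.1 ⟨1, by omega⟩ ⟨x, hx⟩
        map_add' := fun A B => rfl
        map_smul' := fun c A => rfl } 1 fun A => by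
      rw [one_mul]
      exact JetSpace.norm_apply_le A.1 _ _
  refine ⟨(continuousMultilinearCurryFin1 ℝ
    (Euc n) F).toContinuousLinearEquiv.toContinuousLinearMap.comp firstJet, fun A => ?_⟩
  obtain ⟨p, hp, hA⟩ := CrMap.exists_hasFTaylorSeriesUpToOn A
  rw [(hp.hasFDerivWithinAt (by simp) hx).fderivWithin (hu x hx)]
  exact congrArg (continuousMultilinearCurryFin1 ℝ (Euc n) F) (hA ⟨1, by omega⟩ ⟨x, hx⟩).symm

theorem exists_inclusion_crMap [CompleteSpace F] (hq : LocallyQuasiconvex N)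
    (hu : UniqueDiffOn ℝ N) : ∃ L : CrMap N (r + 1) F →L[ℝ] CrMap N r F,
      ∀ A, ∀ x ∈ N, ev (L A) x = ev A x := by
  have hcomplete : CompleteSpace (CrMap N (r + 1) F) := completeSpace_crMap hq
  exact exists_clm_crMap hq hu (fun A => ev A)
    (fun A => (CrMap.contDiffOn_ev A).of_le (by exact_mod_cast Nat.le_succ r))
    fun x hx => ⟨evalCLM (r + 1) F hx, fun A => rfl⟩

end Operators

/-! ### Superposition operators on `C^r(N, X)` -/

section CrSuperposition

universe u

variable {n : ℕ} {N : Set (Euc n)} {r : ℕ} {X : Type u} [NormedAddCommGroup X] [NormedSpace ℝ X]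
  {Y : Type u} [NormedAddCommGroup Y] [NormedSpace ℝ Y] {f : X → Y} {D : Set X}

/-- The superposition operator `A ↦ f ∘ A` on `C^r` maps, with value `0` where `f ∘ A` is not
`C^r`. -/
def superposition (N : Set (Euc n)) (r : ℕ) (f : X → Y) (A : CrMap N r X) : CrMap N r Y :=
  crMk N r fun x => f (ev A x)

theorem contDiffOn_comp_ev (hf : ContDiffOn ℝ ∞ f D) {A : CrMap N r X}
    (hA : ∀ x ∈ N, ev A x ∈ D) : ContDiffOn ℝ r (fun x => f (ev A x)) N :=
  (hf.of_le (by exact_mod_cast le_top)).comp (CrMap.contDiffOn_ev A) hA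

variable [CompactSpace N]

theorem ev_superposition (hu : UniqueDiffOn ℝ N) (hf : ContDiffOn ℝ ∞ f D) {A : CrMap N r X}
    (hA : ∀ x ∈ N, ev A x ∈ D) {x : Euc n} (hx : x ∈ N) :
    ev (superposition N r f A) x = f (ev A x) :=
  ev_crMk hu (contDiffOn_comp_ev hf hA) hx

theorem isOpen_setOf_ev_mem (hD : IsOpen D) :
    IsOpen {A : CrMap N r X | ∀ x ∈ N, ev A x ∈ D} := by
  have hpreimage : {A : CrMap N r X | ∀ x ∈ N, ev A x ∈ D} =
      toContinuousMapCLM N r X ⁻¹' {A | ∀ t, A t ∈ D} :=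
    Set.ext fun A => ⟨fun h t => h t t.2, fun h x hx => h ⟨x, hx⟩⟩
  rw [hpreimage]
  exact (isOpen_setOf_forall_mem hD).preimage (toContinuousMapCLM N r X).continuous

theorem contDiffOn_toContinuousMapCLM_superposition (hu : UniqueDiffOn ℝ N) (hD : IsOpen D)
    (hf : ContDiffOn ℝ ∞ f D) :
    ContDiffOn ℝ ∞ (fun A : CrMap N r X => toContinuousMapCLM N r Y (superposition N r f A))
      {A | ∀ x ∈ N, ev A x ∈ D} := by
  have hmaps : MapsTo (toContinuousMapCLM N r X) {A | ∀ x ∈ N, ev A x ∈ D} {A | ∀ t, A t ∈ D} :=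
    fun A hA t => hA t t.2
  refine ((contDiffOn_nemytskii_of_isOpen hD hf).comp
    (toContinuousMapCLM N r X).contDiff.contDiffOn hmaps).congr fun A hA => ?_
  ext t
  exact (ev_superposition hu hf hA t.2).trans
    (nemytskii_apply hf.continuousOn (hmaps hA) t).symm

theorem fderivWithin_ev_superposition (hu : UniqueDiffOn ℝ N) (hD : IsOpen D)
    (hf : ContDiffOn ℝ ∞ f D) {A : CrMap N (r + 1) X} (hA : ∀ x ∈ N, ev A x ∈ D) {x : Euc n}
    (hx : x ∈ N) : fderivWithin ℝ (ev (superposition N (r + 1) f A)) N x =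
      (fderiv ℝ f (ev A x)).comp (fderivWithin ℝ (ev A) N x) := by
  have hf' : HasFDerivAt f (fderiv ℝ f (ev A x)) (ev A x) :=
    ((hf.contDiffAt (hD.mem_nhds (hA x hx))).differentiableAt (by simp)).hasFDerivAt
  have hA' : HasFDerivWithinAt (ev A) (fderivWithin ℝ (ev A) N x) N x :=
    ((CrMap.contDiffOn_ev A).differentiableOn (by simp) x hx).hasFDerivWithinAt
  exact ((hf'.comp_hasFDerivWithinAt x hA').congr (fun y hy => ev_superposition hu hf hA hy)
    (ev_superposition hu hf hA hx)).fderivWithin (hu x hx)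

theorem contDiffOn_superposition_zero [CompleteSpace Y] (hq : LocallyQuasiconvex N)
    (hu : UniqueDiffOn ℝ N) (hD : IsOpen D) (hf : ContDiffOn ℝ ∞ f D) :
    ContDiffOn ℝ ∞ (superposition N 0 f) {A | ∀ x ∈ N, ev A x ∈ D} := by
  have hcomplete : CompleteSpace (CrMap N 0 Y) := completeSpace_crMap hq
  have hanti : AntilipschitzWith 1 (toContinuousMapCLM N 0 Y) :=
    AddMonoidHomClass.antilipschitz_of_bound _ fun A => by
      rw [NNReal.coe_one, one_mul]
      exact CrMap.norm_zero_order_le hu (norm_nonneg _) fun x hx =>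
        norm_ev_le_norm_toContinuousMapCLM A hx
  exact contDiffOn_of_comp_antilipschitz (isOpen_setOf_ev_mem hD) hanti
    (contDiffOn_toContinuousMapCLM_superposition hu hD hf)

/-- The derivative of `f ∘ A` is the product of `Df ∘ A`, which is `C^r` by hypothesis, and of the
derivative of `A`; together with its values it determines the `C^(r + 1)` norm of `f ∘ A`. -/
theorem contDiffOn_superposition_succ [CompleteSpace X] [CompleteSpace Y]
    (hq : LocallyQuasiconvex N) (hu : UniqueDiffOn ℝ N) (hD : IsOpen D) (hf : ContDiffOn ℝ ∞ f D)
    (hf' : ContDiffOn ℝ ∞ (superposition N r (fderiv ℝ f)) {A | ∀ x ∈ N, ev A x ∈ D}) :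
    ContDiffOn ℝ ∞ (superposition N (r + 1) f) {A | ∀ x ∈ N, ev A x ∈ D} := by
  have hcomplete : CompleteSpace (CrMap N (r + 1) Y) := completeSpace_crMap hq
  obtain ⟨derivY, hderivY⟩ := exists_fderivWithin_crMap (r := r) (F := Y) hq hu
  obtain ⟨derivX, hderivX⟩ := exists_fderivWithin_crMap (r := r) (F := X) hq hu
  obtain ⟨incl, hincl⟩ := exists_inclusion_crMap (r := r) (F := X) hq hu
  obtain ⟨mul, hmul⟩ := exists_bilinear_crMap (r := r) hq hu
    (ContinuousLinearMap.compL ℝ (Euc n) X Y)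
  have hanti : AntilipschitzWith 1 ((toContinuousMapCLM N (r + 1) Y).prod derivY) :=
    AddMonoidHomClass.antilipschitz_of_bound _ fun A => by
      rw [NNReal.coe_one, one_mul]
      exact CrMap.norm_succ_order_le hu (hderivY A) (le_max_right _ _) fun x hx =>
        (norm_ev_le_norm_toContinuousMapCLM A hx).trans (le_max_left _ _)
  refine contDiffOn_of_comp_antilipschitz (isOpen_setOf_ev_mem hD) hanti
    ((contDiffOn_toContinuousMapCLM_superposition hu hD hf).prodMk ?_)
  have hmem : ∀ A : CrMap N (r + 1) X, (∀ x ∈ N, ev A x ∈ D) → ∀ x ∈ N, ev (incl A) x ∈ D :=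
    fun A hA x hx => by rw [hincl A x hx]; exact hA x hx
  have hmul_smooth : ContDiff ℝ ∞ fun M => mul M := ContinuousLinearMap.contDiff (𝕜 := ℝ)
    (E := CrMap N r (X →L[ℝ] Y))
    (F := CrMap N r (Euc n →L[ℝ] X) →L[ℝ] CrMap N r (Euc n →L[ℝ] Y)) mul
  have hchain : ContDiffOn ℝ ∞
      (fun A => mul (superposition N r (fderiv ℝ f) (incl A)) (derivX A))
      {A | ∀ x ∈ N, ev A x ∈ D} :=
    (hmul_smooth.comp_contDiffOn (hf'.comp incl.contDiff.contDiffOn hmem)).clm_apply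
      derivX.contDiff.contDiffOn
  refine hchain.congr fun A hA => CrMap.ext_ev hu fun x hx => ?_
  rw [hmul _ _ x hx, ev_superposition hu (hf.fderiv_of_isOpen hD (by simp)) (hmem A hA) hx,
    hincl A x hx, hderivX A x hx]
  exact (hderivY _ x hx).trans (fderivWithin_ev_superposition hu hD hf hA hx)

theorem contDiffOn_superposition [CompleteSpace X] (hq : LocallyQuasiconvex N)
    (hu : UniqueDiffOn ℝ N) (hD : IsOpen D) (r : ℕ) {Y : Type u} [NormedAddCommGroup Y]
    [NormedSpace ℝ Y] [CompleteSpace Y] {f : X → Y} (hf : ContDiffOn ℝ ∞ f D) :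
    ContDiffOn ℝ ∞ (superposition N r f) {A | ∀ x ∈ N, ev A x ∈ D} := by
  induction r generalizing Y with
  | zero => exact contDiffOn_superposition_zero hq hu hD hf
  | succ r ih =>
    exact contDiffOn_superposition_succ hq hu hD hf (ih (hf.fderiv_of_isOpen hD (by simp)))

theorem ev_fderiv_superposition [CompleteSpace X] [CompleteSpace Y] (hq : LocallyQuasiconvex N)
    (hu : UniqueDiffOn ℝ N) (hD : IsOpen D) (hf : ContDiffOn ℝ ∞ f D) {A : CrMap N r X}
    (hA : ∀ x ∈ N, ev A x ∈ D) (H : CrMap N r X) {x : Euc n} (hx : x ∈ N) :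
    ev (fderiv ℝ (superposition N r f) A H) x = fderiv ℝ f (ev A x) (ev H x) := by
  have hmem := (isOpen_setOf_ev_mem (N := N) (r := r) hD).mem_nhds hA
  have hsuperposition :
      HasFDerivAt (superposition N r f) (fderiv ℝ (superposition N r f) A) A :=
    (((contDiffOn_superposition hq hu hD r hf).contDiffAt hmem).differentiableAt
      (by simp)).hasFDerivAt
  have hf' : HasFDerivAt f (fderiv ℝ f (ev A x)) (evalCLM r X hx A) :=
    ((hf.contDiffAt (hD.mem_nhds (hA x hx))).differentiableAt (by simp)).hasFDerivAt
  have hvalue : HasFDerivAt (fun A => ev (superposition N r f A) x)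
      ((fderiv ℝ f (ev A x)).comp (evalCLM r X hx)) A :=
    (hf'.comp A (evalCLM r X hx).hasFDerivAt).congr_of_eventuallyEq
      (by filter_upwards [hmem] with A' hA' using ev_superposition hu hf hA' hx)
  exact DFunLike.congr_fun
    (((evalCLM r Y hx).hasFDerivAt.comp A hsuperposition).unique hvalue) H

end CrSuperposition

/-! ### The map `A ↦ A - h(f(A))` on `C^r(N, X)` -/

section CrKappa

universe u

theorem nemytskii_congr {K X Y : Type*} [TopologicalSpace K] [TopologicalSpace X]
    [TopologicalSpace Y] [Zero Y] {f g : X → Y} {S : Set X} (hf : ContinuousOn f S)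
    (hfg : EqOn f g S) {A : C(K, X)} (hA : ∀ t, A t ∈ S) : nemytskii f A = nemytskii g A := by
  ext t
  rw [nemytskii_apply hf hA, nemytskii_apply (hf.congr hfg.symm) hA, hfg (hA t)]

theorem nemytskii_nemytskii {K X Y Z : Type*} [TopologicalSpace K] [TopologicalSpace X]
    [TopologicalSpace Y] [Zero Y] [TopologicalSpace Z] [Zero Z] {f : X → Y} {g : Y → Z} {S : Set X}
    {T : Set Y} (hg : ContinuousOn g T) (hf : ContinuousOn f S) (hfS : MapsTo f S T) {A : C(K, X)}
    (hA : ∀ t, A t ∈ S) : nemytskii g (nemytskii f A) = nemytskii (fun x => g (f x)) A := by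
  have hgf : ContinuousOn (fun x => g (f x)) S := hg.comp hf hfS
  have hfA : ∀ t, nemytskii f A t = f (A t) := nemytskii_apply hf hA
  ext t
  rw [nemytskii_apply hg fun s => (hfA s).symm ▸ hfS (hA s), nemytskii_apply hgf hA, hfA]

variable {n ℓ : ℕ} {N : Set (Euc n)} {r : ℕ} {X : Type u} [NormedAddCommGroup X]
  [NormedSpace ℝ X] {Y : Fin (ℓ + 1) → Type u} [∀ k, NormedAddCommGroup (Y k)]
  [∀ k, NormedSpace ℝ (Y k)]

/-- The map `κ(A) = A - h(f(A))` on `C^r` maps, where `h` is the homotopy operator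
`h(β)(x) = J_x ∫₀¹ τ ^ k β_k(τ x) dτ`; its value is `0` where `κ(A)` is not `C^r`. -/
def crKappa (J : Euc n →L[ℝ] (∀ k, Y k) →L[ℝ] X) (f : X → ∀ k, Y k) (A : CrMap N r X) :
    CrMap N r X :=
  crMk N r fun x => ev A x - J x (average Y (nemytskii (fun y => f (ev A y)) (ray (Euc n) x)) 1)

variable {J : Euc n →L[ℝ] (∀ k, Y k) →L[ℝ] X} {f : X → ∀ k, Y k} {D : Set X}

theorem contDiffOn_average_ray (J : Euc n →L[ℝ] (∀ k, Y k) →L[ℝ] X) (hq : LocallyQuasiconvex N)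
    (hu : UniqueDiffOn ℝ N) (hstar : StarConvex ℝ 0 N) {ρ : ℕ∞} {β : Euc n → ∀ k, Y k}
    (hβ : ContDiffOn ℝ ρ β N) :
    ContDiffOn ℝ ρ (fun x => J x (average Y (nemytskii β (ray (Euc n) x)) 1)) N :=
  J.contDiff.contDiffOn.clm_apply
    (((ContinuousMap.evalCLM ℝ 1).comp (average Y)).contDiff.comp_contDiffOn
      (contDiffOn_nemytskii_ray hq hu hstar hβ))

theorem nemytskii_ray_ev_mem (hstar : StarConvex ℝ 0 N) {A : CrMap N r X}
    (hA : ∀ x ∈ N, ev A x ∈ D) {x : Euc n} (hx : x ∈ N) (t : I) :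
    nemytskii (ev A) (ray (Euc n) x) t ∈ D := by
  rw [nemytskii_apply (CrMap.contDiffOn_ev A).continuousOn (ray_mem hstar hx)]
  exact hA _ (ray_mem hstar hx t)

variable [CompactSpace N]

theorem ev_crKappa (hq : LocallyQuasiconvex N) (hu : UniqueDiffOn ℝ N) (hstar : StarConvex ℝ 0 N)
    (hf : ContDiffOn ℝ ∞ f D) {A : CrMap N r X} (hA : ∀ x ∈ N, ev A x ∈ D) {x : Euc n}
    (hx : x ∈ N) : ev (crKappa J f A) x =
      ev A x - J x (average Y (nemytskii (fun y => f (ev A y)) (ray (Euc n) x)) 1) :=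
  ev_crMk hu ((CrMap.contDiffOn_ev A).sub
    (contDiffOn_average_ray J hq hu hstar (ρ := (r : ℕ∞)) (contDiffOn_comp_ev hf hA))) hx

theorem ev_crKappa_smul (hq : LocallyQuasiconvex N) (hu : UniqueDiffOn ℝ N)
    (hstar : StarConvex ℝ 0 N) (hf : ContDiffOn ℝ ∞ f D) {A : CrMap N r X}
    (hA : ∀ x ∈ N, ev A x ∈ D) {x : Euc n} (hx : x ∈ N) (t : I) :
    ev (crKappa J f A) ((t : ℝ) • x) = nemytskii (ev A) (ray (Euc n) x) t -
      (t : ℝ) • J x (average Y (nemytskii f (nemytskii (ev A) (ray (Euc n) x))) t) := by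
  have hAcont : ContinuousOn (ev A) N := (CrMap.contDiffOn_ev A).continuousOn
  have hfA : ContinuousOn (fun y => f (ev A y)) N := hf.continuousOn.comp hAcont hA
  have htx : (t : ℝ) • x ∈ N := ray_mem hstar hx t
  rw [ev_crKappa hq hu hstar hf hA htx, nemytskii_ray_smul hfA hstar hx, average_comp_mulI,
    mul_one, ← nemytskii_nemytskii hf.continuousOn hAcont hA (ray_mem hstar hx),
    nemytskii_apply hAcont (ray_mem hstar hx), map_smul, ray_apply]
  rfl

theorem injOn_crKappa (J : Euc n →L[ℝ] (∀ k, Y k) →L[ℝ] X) (hq : LocallyQuasiconvex N)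
    (hu : UniqueDiffOn ℝ N) (hstar : StarConvex ℝ 0 N) (hD : IsOpen D) (hf : ContDiffOn ℝ ∞ f D) :
    InjOn (crKappa J f) {A : CrMap N r X | ∀ x ∈ N, ev A x ∈ D} := by
  intro A hA A' hA' hAA'
  refine CrMap.ext_ev hu fun x hx => ?_
  have hray : nemytskii (ev A) (ray (Euc n) x) = nemytskii (ev A') (ray (Euc n) x) :=
    eq_of_volterra_eq hD (hf.of_le (by simp)) (nemytskii_ray_ev_mem hstar hA hx)
      (nemytskii_ray_ev_mem hstar hA' hx) (J x) fun t => by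
        rw [← ev_crKappa_smul hq hu hstar hf hA hx, hAA', ev_crKappa_smul hq hu hstar hf hA' hx]
  have hend := DFunLike.congr_fun hray 1
  rw [nemytskii_apply (CrMap.contDiffOn_ev A).continuousOn (ray_mem hstar hx),
    nemytskii_apply (CrMap.contDiffOn_ev A').continuousOn (ray_mem hstar hx), ray_apply] at hend
  simpa using hend

variable [CompleteSpace X] [∀ k, CompleteSpace (Y k)]

theorem exists_average_ray_crMap (J : Euc n →L[ℝ] (∀ k, Y k) →L[ℝ] X) (hq : LocallyQuasiconvex N)
    (hu : UniqueDiffOn ℝ N) (hstar : StarConvex ℝ 0 N) :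
    ∃ h : CrMap N r (∀ k, Y k) →L[ℝ] CrMap N r X, ∀ β, ∀ x ∈ N,
      ev (h β) x = J x (average Y (nemytskii (ev β) (ray (Euc n) x)) 1) := by
  have hcomplete : CompleteSpace (CrMap N r (∀ k, Y k)) := completeSpace_crMap hq
  refine exists_clm_crMap hq hu (fun β x => J x (average Y (nemytskii (ev β) (ray (Euc n) x)) 1))
    (fun β => contDiffOn_average_ray J hq hu hstar (ρ := (r : ℕ∞)) (CrMap.contDiffOn_ev β))
    fun x hx => ?_
  have happly : ∀ (β : CrMap N r (∀ k, Y k)) (t : I),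
      nemytskii (ev β) (ray (Euc n) x) t = ev β (ray (Euc n) x t) := fun β t =>
    nemytskii_apply (CrMap.contDiffOn_ev β).continuousOn (ray_mem hstar hx) t
  let alongRay : CrMap N r (∀ k, Y k) →L[ℝ] C(I, ∀ k, Y k) :=
    LinearMap.mkContinuous
      { toFun := fun β => nemytskii (ev β) (ray (Euc n) x)
        map_add' := fun β β' => ContinuousMap.ext fun t => by
          rw [ContinuousMap.add_apply, happly, happly, happly, ev_add _ _ (ray_mem hstar hx t)]
        map_smul' := fun c β => ContinuousMap.ext fun t => by
          rw [RingHom.id_apply, ContinuousMap.smul_apply, happly, happly,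
            ev_smul _ _ (ray_mem hstar hx t)] } 1
      fun β => by
        rw [one_mul]
        exact (ContinuousMap.norm_le _ (norm_nonneg _)).2 fun t =>
          (congrArg norm (happly β t)).trans_le (norm_ev_le β (ray_mem hstar hx t))
  exact ⟨(J x).comp ((ContinuousMap.evalCLM ℝ 1).comp ((average Y).comp alongRay)), fun β => rfl⟩

theorem exists_crKappa_eq_sub (J : Euc n →L[ℝ] (∀ k, Y k) →L[ℝ] X) (hq : LocallyQuasiconvex N)
    (hu : UniqueDiffOn ℝ N) (hstar : StarConvex ℝ 0 N) (hf : ContDiffOn ℝ ∞ f D) :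
    ∃ h : CrMap N r (∀ k, Y k) →L[ℝ] CrMap N r X,
      (∀ β, ∀ x ∈ N, ev (h β) x = J x (average Y (nemytskii (ev β) (ray (Euc n) x)) 1)) ∧
      ∀ A, (∀ x ∈ N, ev A x ∈ D) → crKappa J f A = A - h (superposition N r f A) := by
  obtain ⟨h, hh⟩ := exists_average_ray_crMap (r := r) J hq hu hstar
  refine ⟨h, hh, fun A hA => CrMap.ext_ev hu fun x hx => ?_⟩
  rw [ev_crKappa hq hu hstar hf hA hx, ev_sub _ _ hx, hh _ x hx,
    nemytskii_congr (CrMap.contDiffOn_ev _).continuousOn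
      (fun y hy => ev_superposition hu hf hA hy) (ray_mem hstar hx)]

theorem contDiffOn_crKappa (J : Euc n →L[ℝ] (∀ k, Y k) →L[ℝ] X) (hq : LocallyQuasiconvex N)
    (hu : UniqueDiffOn ℝ N) (hstar : StarConvex ℝ 0 N) (hD : IsOpen D) (hf : ContDiffOn ℝ ∞ f D) :
    ContDiffOn ℝ ∞ (crKappa J f) {A : CrMap N r X | ∀ x ∈ N, ev A x ∈ D} := by
  obtain ⟨h, -, hκ⟩ := exists_crKappa_eq_sub (r := r) J hq hu hstar hf
  exact (contDiffOn_id.sub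
    (h.contDiff.comp_contDiffOn (contDiffOn_superposition hq hu hD r hf))).congr hκ

theorem ev_fderiv_crKappa (hq : LocallyQuasiconvex N) (hu : UniqueDiffOn ℝ N)
    (hstar : StarConvex ℝ 0 N) (hD : IsOpen D) (hf : ContDiffOn ℝ ∞ f D) {A : CrMap N r X}
    (hA : ∀ x ∈ N, ev A x ∈ D) (H : CrMap N r X) {x : Euc n} (hx : x ∈ N) :
    ev (fderiv ℝ (crKappa J f) A H) x = ev H x -
      J x (average Y (nemytskii (fun y => fderiv ℝ f (ev A y) (ev H y)) (ray (Euc n) x)) 1) := by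
  obtain ⟨h, hh, hκ⟩ := exists_crKappa_eq_sub (r := r) J hq hu hstar hf
  have hmem := (isOpen_setOf_ev_mem (N := N) (r := r) hD).mem_nhds hA
  have hsuperposition :
      HasFDerivAt (superposition N r f) (fderiv ℝ (superposition N r f) A) A :=
    (((contDiffOn_superposition hq hu hD r hf).contDiffAt hmem).differentiableAt
      (by simp)).hasFDerivAt
  have hderiv : HasFDerivAt (crKappa J f)
      (.id ℝ _ - h.comp (fderiv ℝ (superposition N r f) A)) A :=
    ((hasFDerivAt_id A).sub (h.hasFDerivAt.comp A hsuperposition)).congr_of_eventuallyEq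
      (by filter_upwards [hmem] with A' hA' using hκ A' hA')
  rw [hderiv.fderiv]
  calc ev (H - h (fderiv ℝ (superposition N r f) A H)) x
      = ev H x - ev (h (fderiv ℝ (superposition N r f) A H)) x := ev_sub _ _ hx
    _ = _ := by
      rw [hh _ x hx, nemytskii_congr (CrMap.contDiffOn_ev _).continuousOn
        (fun y hy => ev_fderiv_superposition hq hu hD hf hA H hy) (ray_mem hstar hx)]

theorem bijective_fderiv_crKappa (J : Euc n →L[ℝ] (∀ k, Y k) →L[ℝ] X) (hq : LocallyQuasiconvex N)
    (hu : UniqueDiffOn ℝ N) (hstar : StarConvex ℝ 0 N) (hD : IsOpen D) (hf : ContDiffOn ℝ ∞ f D)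
    {A : CrMap N r X} (hA : ∀ x ∈ N, ev A x ∈ D) :
    Function.Bijective (fderiv ℝ (crKappa J f) A) := by
  have hM : ContDiffOn ℝ ((r : ℕ∞) : WithTop ℕ∞) (fun y => fderiv ℝ f (ev A y)) N :=
    contDiffOn_comp_ev (hf.fderiv_of_isOpen hD (by simp)) hA
  refine ⟨(injective_iff_map_eq_zero _).2 fun H hH => CrMap.ext_ev hu fun x hx => ?_, fun K => ?_⟩
  · rw [ev_zero hx]
    refine linear_solution_unique J hstar hM.continuousOn
      (CrMap.contDiffOn_ev H).continuousOn (fun y hy => ?_) x hx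
    rw [← sub_eq_zero, ← ev_fderiv_crKappa hq hu hstar hD hf hA H hy, hH, ev_zero hy]
  · obtain ⟨H, hH, hHK⟩ := exists_linear_solution J hq hu hstar hM
      (ρ := (r : ℕ∞)) (CrMap.contDiffOn_ev K)
    have hev : ∀ x ∈ N, ev (crMk N r H) x = H x := fun x hx => ev_crMk hu hH hx
    have hMH : EqOn (fun y => fderiv ℝ f (ev A y) (H y))
        (fun y => fderiv ℝ f (ev A y) (ev (crMk N r H) y)) N :=
      fun y hy => congrArg (fderiv ℝ f (ev A y)) (hev y hy).symm
    refine ⟨crMk N r H, CrMap.ext_ev hu fun x hx => ?_⟩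
    rw [ev_fderiv_crKappa hq hu hstar hD hf hA _ hx, hev x hx, sub_eq_iff_eq_add, hHK x hx,
      nemytskii_congr (hM.continuousOn.clm_apply hH.continuousOn) hMH (ray_mem hstar hx)]

theorem exists_openPartialHomeomorph_crKappa (J : Euc n →L[ℝ] (∀ k, Y k) →L[ℝ] X)
    (hq : LocallyQuasiconvex N) (hu : UniqueDiffOn ℝ N) (hstar : StarConvex ℝ 0 N)
    (hD : IsOpen D) (hf : ContDiffOn ℝ ∞ f D) (r : ℕ) :
    ∃ κ : OpenPartialHomeomorph (CrMap N r X) (CrMap N r X),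
      κ.source = {A | ∀ x ∈ N, ev A x ∈ D} ∧ (κ : CrMap N r X → CrMap N r X) = crKappa J f ∧
      ContDiffOn ℝ ∞ κ.symm κ.target := by
  have hcomplete : CompleteSpace (CrMap N r X) := completeSpace_crMap hq
  exact exists_openPartialHomeomorph (by simp) (isOpen_setOf_ev_mem hD)
    (contDiffOn_crKappa J hq hu hstar hD hf) (injOn_crKappa J hq hu hstar hD hf)
    fun A hA => bijective_fderiv_crKappa J hq hu hstar hD hf hA

end CrKappa

/-! ### The theorem in `C^r(N, W)` -/

section KuranishiMap

universe u

variable {n ℓ : ℕ} {W : Fin (ℓ + 1) → Type u} [∀ k, NormedAddCommGroup (W k)]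
  [∀ k, NormedSpace ℝ (W k)] [∀ k, FiniteDimensional ℝ (W k)] {U : TopologicalSpace.Opens (W 0)}
  {N : Set (Euc n)}

theorem exists_greatest_isSolution (Q : Differential W U) (hq : LocallyQuasiconvex N)
    (hu : UniqueDiffOn ℝ N) (h0 : (0 : Euc n) ∈ N) (hstar : StarConvex ℝ 0 N) {ρ : ℕ∞}
    (hρ : 1 ≤ ρ) {B : Euc n → Fiber W n 0} (hB : ContDiffOn ℝ ρ B N)
    (hB0 : zeroPart (B 0) ∈ U) :
    ∃ (N' : Set (Euc n)) (a : Euc n → Fiber W n 1), IsSolution Q N ρ B N' a ∧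
      (∀ N'' a', IsSolution Q N ρ B N'' a' → N'' ⊆ N' ∧ EqOn a' a N'') ∧
      ((∃ A, IsPreimage Q N ρ B A) ↔ N' = N) ∧
      (∀ A, IsPreimage Q N ρ B A → EqOn A (fun x => B x + iE x (a x)) N) ∧
      ∃ P, IsHyperbolicFixedPoint Q N B P ∧ (fun x => (x, a x)) '' N' =
        unstableManifold (hatE Q B) (hatDomain U N B) P := by
  have hBcont : ContinuousOn B N := hB.continuousOn
  have hBdiff : DifferentiableWithinAt ℝ B N 0 :=
    hB.differentiableOn (by exact_mod_cast (zero_lt_one.trans_le hρ).ne') 0 h0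
  refine ⟨greatestDomain Q N B, greatestSolution Q B,
    isSolution_greatestSolution Q hq hu h0 hstar hB hB0,
    fun N'' a' ha' => ⟨fun x hx => (ha'.eq_greatestSolution hρ hstar hBcont hx).1,
      fun x hx => (ha'.eq_greatestSolution hρ hstar hBcont hx).2⟩,
    ⟨fun ⟨A, hA⟩ => greatestDomain_subset.antisymm
      fun x hx => (hA.eq_add_greatestSolution hstar hx).1,
      fun hN => ⟨_, isPreimage_add_greatestSolution Q hq hu hstar hB hN⟩⟩,
    fun A hA x hx => (hA.eq_add_greatestSolution hstar hx).2,
    (0, greatestSolution Q B 0), isHyperbolicFixedPoint_greatestSolution h0 hBdiff hB0,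
    image_greatestSolution_eq_unstableManifold Q hq hu h0 hstar hρ hB hB0⟩

theorem IsPreimage.zeroPart_mem {Q : Differential W U} {ρ : ℕ∞} {A B : Euc n → Fiber W n 0}
    (hA : IsPreimage Q N ρ B A) (h0 : (0 : Euc n) ∈ N) (hstar : StarConvex ℝ 0 N) :
    zeroPart (B 0) ∈ U := by
  rw [hA.eqn 0 h0, kappa_eq hstar hA.contDiffOn.continuousOn hA.mem h0, map_zero]
  simpa using hA.mem 0 h0

theorem IsPreimage.exists_isSolution {Q : Differential W U} {ρ : ℕ∞} {A B : Euc n → Fiber W n 0}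
    (hA : IsPreimage Q N ρ B A) (hq : LocallyQuasiconvex N) (hu : UniqueDiffOn ℝ N)
    (h0 : (0 : Euc n) ∈ N) (hstar : StarConvex ℝ 0 N) (hρ : 1 ≤ ρ) (hB : ContDiffOn ℝ ρ B N) :
    ∃ (a : Euc n → Fiber W n 1) (P : Euc n × Fiber W n 1), IsSolution Q N ρ B N a ∧
      IsHyperbolicFixedPoint Q N B P ∧
      (fun x => (x, a x)) '' N = unstableManifold (hatE Q B) (hatDomain U N B) P ∧
      ∀ x ∈ N, A x = B x + iE x (a x) := by
  obtain ⟨N', a, ha, -, hiff, heq, P, hP, himage⟩ :=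
    exists_greatest_isSolution Q hq hu h0 hstar hρ hB (hA.zeroPart_mem h0 hstar)
  obtain rfl : N' = N := hiff.1 ⟨A, hA⟩
  exact ⟨a, P, ha, hP, himage, heq A hA⟩

theorem completeSpace_omegaR (hq : LocallyQuasiconvex N) (r : ℕ) :
    CompleteSpace (OmegaR W N r) := by
  have hcomplete : ∀ k, CompleteSpace (W k) := fun k => FiniteDimensional.complete ℝ (W k)
  exact completeSpace_crMap hq

theorem exists_openPartialHomeomorph_kappa (Q : Differential W U) (hq : LocallyQuasiconvex N)
    (hu : UniqueDiffOn ℝ N) (hstar : StarConvex ℝ 0 N) (hN : IsCompact N) (r : ℕ) :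
    ∃ κ : OpenPartialHomeomorph (OmegaR W N r) (OmegaR W N r), κ.source = OmegaRU W N r U ∧
      (∀ A ∈ κ.source, ∀ x ∈ N, ev (κ A) x = kappa Q (ev A) x) ∧
      ContDiffOn ℝ ∞ κ κ.source ∧ ContDiffOn ℝ ∞ κ.symm κ.target := by
  have hcomplete : ∀ k, CompleteSpace (W k) := fun k => FiniteDimensional.complete ℝ (W k)
  have hcompact : CompactSpace N := isCompact_iff_compactSpace.1 hN
  have hopen := isOpen_setOf_zeroPart_mem (n := n) U
  have hFQ := contDiffOn_FQ (n := n) Q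
  obtain ⟨κ, hsource, hκ, hsymm⟩ := exists_openPartialHomeomorph_crKappa (Y := Comp W n)
    (contraction W n) hq hu hstar hopen hFQ r
  refine ⟨κ, hsource, fun A hA x hx => ?_, ?_, hsymm⟩
  · have hAU : ∀ x ∈ N, zeroPart (ev A x) ∈ U := hsource.subset hA
    rw [hκ, ev_crKappa hq hu hstar hFQ hAU hx,
      kappa_eq hstar (CrMap.contDiffOn_ev A).continuousOn hAU hx]
  · rw [hκ, hsource]
    exact contDiffOn_crKappa (contraction W n) hq hu hstar hopen hFQ

end KuranishiMap

end Kuranishi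

end

open Kuranishi in
theorem mainTheorem3_general {n ℓ : ℕ} (N : Set (Euc n)) (hq : LocallyQuasiconvex N)
    (hu : UniqueDiffOn ℝ N) (h0 : (0 : Euc n) ∈ N) (hstar : StarConvex ℝ 0 N)
    (W : Fin (ℓ + 1) → Type*) [∀ k, NormedAddCommGroup (W k)] [∀ k, NormedSpace ℝ (W k)]
    [∀ k, FiniteDimensional ℝ (W k)]
    (U : TopologicalSpace.Opens (W 0)) (Q : Differential W U) :
    (∀ ρ : ℕ∞, 1 ≤ ρ → ∀ B : Euc n → Fiber W n 0, ContDiffOn ℝ ρ B N → zeroPart (B 0) ∈ U →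
      ∃ (N' : Set (Euc n)) (a : Euc n → Fiber W n 1),
        IsSolution Q N ρ B N' a ∧
        (∀ N'' a', IsSolution Q N ρ B N'' a' → N'' ⊆ N' ∧ Set.EqOn a' a N'') ∧
        ((∃ A, IsPreimage Q N ρ B A) ↔ N' = N) ∧
        (∀ A, IsPreimage Q N ρ B A → Set.EqOn A (fun x => B x + iE x (a x)) N) ∧
        ∃ P, IsHyperbolicFixedPoint Q N B P ∧
          (fun x => (x, a x)) '' N' = unstableManifold (hatE Q B) (hatDomain U N B) P) ∧
    (IsCompact N → ∀ r : ℕ, 1 ≤ r →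
      CompleteSpace (OmegaR W N r) ∧
      ∃ κ : OpenPartialHomeomorph (OmegaR W N r) (OmegaR W N r),
        κ.source = OmegaRU W N r U ∧
        (∀ A ∈ κ.source, ∀ x ∈ N, ev (κ A) x = kappa Q (ev A) x) ∧
        ContDiffOn ℝ ∞ κ κ.source ∧ ContDiffOn ℝ ∞ κ.symm κ.target ∧
        ∀ B ∈ κ.target, ∃ (a : Euc n → Fiber W n 1) (P : _),
          IsSolution Q N r (ev B) N a ∧
          IsHyperbolicFixedPoint Q N (ev B) P ∧
          (fun x => (x, a x)) '' N = unstableManifold (hatE Q (ev B)) (hatDomain U N (ev B)) P ∧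
          ∀ x ∈ N, ev (κ.symm B) x = ev B x + iE x (a x)) := by
  refine ⟨fun ρ hρ B hB hB0 => exists_greatest_isSolution Q hq hu h0 hstar hρ hB hB0,
    fun hN r hr => ⟨completeSpace_omegaR hq r, ?_⟩⟩
  obtain ⟨κ, hsource, hev, hκ, hsymm⟩ := exists_openPartialHomeomorph_kappa Q hq hu hstar hN r
  refine ⟨κ, hsource, hev, hκ, hsymm, fun B hB => ?_⟩
  have hA : κ.symm B ∈ κ.source := κ.map_target hB
  have hpreimage : IsPreimage Q N r (ev B) (ev (κ.symm B)) :=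
    ⟨CrMap.contDiffOn_ev _, hsource.subset hA, fun x hx => by rw [← hev _ hA x hx, κ.right_inv hB]⟩
  exact hpreimage.exists_isSolution hq hu h0 hstar (by exact_mod_cast hr) (CrMap.contDiffOn_ev B)

theorem mainTheorem3 {n ℓ : ℕ} (N : Set (Kuranishi.Euc n))
    (hN : Kuranishi.IsSubmanifoldWithCorners N) (h0 : (0 : Kuranishi.Euc n) ∈ N)
    (hstar : StarConvex ℝ 0 N)
    (W : Fin (ℓ + 1) → Type*) [∀ k, NormedAddCommGroup (W k)] [∀ k, NormedSpace ℝ (W k)]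
    [∀ k, FiniteDimensional ℝ (W k)]
    (U : TopologicalSpace.Opens (W 0)) (Q : Kuranishi.Differential W U) :
    (∀ ρ : ℕ∞, 1 ≤ ρ → ∀ B : Kuranishi.Euc n → Kuranishi.Fiber W n 0, ContDiffOn ℝ ρ B N →
      Kuranishi.zeroPart (B 0) ∈ U →
      ∃ (N' : Set (Kuranishi.Euc n)) (a : Kuranishi.Euc n → Kuranishi.Fiber W n 1),
        Kuranishi.IsSolution Q N ρ B N' a ∧
        (∀ N'' a', Kuranishi.IsSolution Q N ρ B N'' a' → N'' ⊆ N' ∧ Set.EqOn a' a N'') ∧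
        ((∃ A, Kuranishi.IsPreimage Q N ρ B A) ↔ N' = N) ∧
        (∀ A, Kuranishi.IsPreimage Q N ρ B A →
          Set.EqOn A (fun x => B x + Kuranishi.iE x (a x)) N) ∧
        ∃ P, Kuranishi.IsHyperbolicFixedPoint Q N B P ∧
          (fun x => (x, a x)) '' N' =
            Kuranishi.unstableManifold (Kuranishi.hatE Q B) (Kuranishi.hatDomain U N B) P) ∧
    (IsCompact N → ∀ r : ℕ, 1 ≤ r →
      CompleteSpace (Kuranishi.OmegaR W N r) ∧
      ∃ κ : OpenPartialHomeomorph (Kuranishi.OmegaR W N r) (Kuranishi.OmegaR W N r),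
        κ.source = Kuranishi.OmegaRU W N r U ∧
        (∀ A ∈ κ.source, ∀ x ∈ N, Kuranishi.ev (κ A) x = Kuranishi.kappa Q (Kuranishi.ev A) x) ∧
        ContDiffOn ℝ ∞ κ κ.source ∧ ContDiffOn ℝ ∞ κ.symm κ.target ∧
        ∀ B ∈ κ.target, ∃ (a : Kuranishi.Euc n → Kuranishi.Fiber W n 1) (P : _),
          Kuranishi.IsSolution Q N r (Kuranishi.ev B) N a ∧
          Kuranishi.IsHyperbolicFixedPoint Q N (Kuranishi.ev B) P ∧
          (fun x => (x, a x)) '' N = Kuranishi.unstableManifold (Kuranishi.hatE Q (Kuranishi.ev B))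
            (Kuranishi.hatDomain U N (Kuranishi.ev B)) P ∧
          ∀ x ∈ N, Kuranishi.ev (κ.symm B) x = Kuranishi.ev B x + Kuranishi.iE x (a x)) :=
  mainTheorem3_general N hN.locallyQuasiconvex hN.uniqueDiffOn h0 hstar W U Q
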